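/- For \(\nu>0\), \(k,\ell\in\mathbb Z\), \(\lambda\in\mathbb R\), \(a\ge 0\) put \(\eta=(k^2+\ell^2)^{1/2}\) and \(L=(|k|/\nu)^{1/3}\). For \(i=1,2\) let \((w_{i,\ell},W_{i,\ell})\) be the solution on \([-1,1]\) of \[ -\nu(\partial_y^2-\eta^2)w_{i,\ell}+ik(y-\lambda)w_{i,\ell}-a(\nu k^2)^{1/3}w_{i,\ell}=0,\qquad w_{i,\ell}=(\partial_y^2-\eta^2)W_{i,\ell},\qquad W_{i,\ell}(\pm1)=0 \] (the factor \(ik\) contains the imaginary unit), with Neumann data \(\partial_yW_{1,\ell}(-1)=0\), \(\partial_yW_{1,\ell}(1)=1\) and \(\partial_yW_{2,\ell}(-1)=1\), \(\partial_yW_{2,\ell}(1)=0\). All norms are over \((-1,1)\), and \(\|(\partial_y,\eta)W\|_{L^2}=(\|\partial_yW\|_{L^2}^2+\eta^2\|W\|_{L^2}^2)^{1/2}\). There are absolute constants \(\epsilon_1>0\), \(k_0>1\) and \(C>0\), and constants \(C_s>0\) depending only on the exponent \(s\), such that, whenever \(0\le a\le\epsilon_1\) and \(L\ge k_0\), the solutions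 \((w_{1,\ell},W_{1,\ell})\), \((w_{2,\ell},W_{2,\ell})\) exist, are unique, and satisfy \begin{align*} &\|w_{1,\ell}\|_{L^\infty}\le C\Big(\big(|k(\lambda-1)/\nu|+\eta^2\big)^{1/2}+(|k|/\nu)^{1/3}\Big),\\ &\|w_{2,\ell}\|_{L^\infty}\le C\Big(\big(|k(\lambda+1)/\nu|+\eta^2\big)^{1/2}+(|k|/\nu)^{1/3}\Big),\\ &\|(1-|y|)^\alpha w_{1,\ell}\|_{L^1}+\|(1-|y|)^\alpha w_{2,\ell}\|_{L^1}\le C_\alpha L^{-\alpha}\quad\text{for all }\alpha\ge0,\\ &\|(1-|y|)^\beta w_{1,\ell}\|_{L^\infty}+\|(1-|y|)^\beta w_{2,\ell}\|_{L^\infty}\le C_\beta L^{1-\beta}\quad\text{for all }\beta\ge1,\\ &\|w_{1,\ell}\|_{L^2}\le C\Big(|k(\lambda-1)/\nu|^{1/4}+|k/\nu|^{1/6}+|k|^{1/2}+(|k/\nu|^{1/3}+|k|)^{-1/2}|\ell|\Big),\\ &\|w_{2,\ell}\|_{L^2}\le C\Big(|k(\lambda+1)/\nu|^{1/4}+|k/\nu|^{1/6}+|k|^{1/2}+(|k/\nu|^{1/3}+|k|)^{-1/2}|\ell|\Big),\\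 &\|(1-|y|)^\beta w_{1,\ell}\|_{L^2}+\|(1-|y|)^\beta w_{2,\ell}\|_{L^2}\le C_\beta L^{1/2-\beta}\quad\text{for all }\beta\ge1/2,\\ &\|(\partial_y,\eta)W_{1,\ell}\|_{L^2}+\|(\partial_y,\eta)W_{2,\ell}\|_{L^2}\le C|\nu/k|^{1/6},\\ &|k|^{1/2}\|W_{1,\ell}\|_{L^2}+|k|^{1/2}\|W_{2,\ell}\|_{L^2}\le C|\nu/k|^{1/3}. \end{align*} -/

import Mathlib

open Set MeasureTheory
open scoped ENNReal

noncomputable section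

/-- The total horizontal wave number `η = (k² + ℓ²)^{1/2}` of the Fourier mode `(k, ℓ)`. -/
def waveNumber (k l : ℤ) : ℝ := Real.sqrt ((k : ℝ) ^ 2 + (l : ℝ) ^ 2)

/-- `L = (|k| / ν)^{1/3}`, the inverse of the boundary layer thickness. -/
def layerScale (ν : ℝ) (k : ℤ) : ℝ := (|(k : ℝ)| / ν) ^ (1 / 3 : ℝ)

/-- The closed interval `[-1, 1]`. -/
abbrev closedChannel : Set ℝ := Icc (-1) 1

/-- The first derivative `∂_y f` on `[-1, 1]` (one-sided at the end points). -/
def dy (f : ℝ → ℂ) (y : ℝ) : ℂ := derivWithin f closedChannel y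

/-- The second derivative `∂_y² f` on `[-1, 1]` (one-sided at the end points). -/
def dyy (f : ℝ → ℂ) (y : ℝ) : ℂ := iteratedDerivWithin 2 f closedChannel y

/-- `(w, W)` is a (classical) solution on `[-1, 1]` of the homogeneous Orr-Sommerfeld problem
around the Couette flow, with vorticity `w`, streamfunction `W` and Neumann data
`∂_y W(-1) = bm`, `∂_y W(1) = bp`:
`-ν(∂_y² - η²)w + ik(y - lam)w - a(νk²)^{1/3} w = 0`, `w = (∂_y² - η²)W`, `W(±1) = 0`. -/
structure IsOrrSommerfeldSolution (ν : ℝ) (k l : ℤ) (lam a : ℝ) (bm bp : ℂ)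
    (w W : ℝ → ℂ) : Prop where
  contDiffOn_w : ContDiffOn ℝ 2 w closedChannel
  contDiffOn_W : ContDiffOn ℝ 2 W closedChannel
  orrSommerfeld : ∀ y ∈ closedChannel,
    -(ν : ℂ) * (dyy w y - (waveNumber k l : ℂ) ^ 2 * w y)
      + Complex.I * (k : ℂ) * ((y : ℂ) - (lam : ℂ)) * w y
      - (a : ℂ) * (((ν * (k : ℝ) ^ 2) ^ (1 / 3 : ℝ) : ℝ) : ℂ) * w y = 0
  stream : ∀ y ∈ closedChannel, w y = dyy W y - (waveNumber k l : ℂ) ^ 2 * W y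
  W_neg_one : W (-1) = 0
  W_one : W 1 = 0
  dy_W_neg_one : dy W (-1) = bm
  dy_W_one : dy W 1 = bp

/-- The corrector `(w_{1,ℓ}, W_{1,ℓ})` of the boundary `y = 1`. -/
def IsCorrectorOne (ν : ℝ) (k l : ℤ) (lam a : ℝ) (w W : ℝ → ℂ) : Prop :=
  IsOrrSommerfeldSolution ν k l lam a 0 1 w W

/-- The corrector `(w_{2,ℓ}, W_{2,ℓ})` of the boundary `y = -1`. -/
def IsCorrectorTwo (ν : ℝ) (k l : ℤ) (lam a : ℝ) (w W : ℝ → ℂ) : Prop :=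
  IsOrrSommerfeldSolution ν k l lam a 1 0 w W

/-- The norm of `L^p(-1, 1)`, with values in `[0, ∞]`. -/
def normLp (p : ℝ≥0∞) {E : Type*} [NormedAddCommGroup E] (f : ℝ → E) : ℝ≥0∞ :=
  eLpNorm f p (volume.restrict (Ioo (-1) 1))

/-- The function `(1 - |y|)^s f(y)`. -/
def weighted (s : ℝ) (f : ℝ → ℂ) (y : ℝ) : ℂ := (((1 - |y|) ^ s : ℝ) : ℂ) * f y

/-- The pointwise length of `(∂_y W, ηW)`, so that its `L²` norm is `‖(∂_y, η)W‖_{L²}`. -/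
def gradLength (k l : ℤ) (W : ℝ → ℂ) (y : ℝ) : ℝ :=
  Real.sqrt (‖dy W y‖ ^ 2 + waveNumber k l ^ 2 * ‖W y‖ ^ 2)

end

/-!
# Boundary layer correctors for the Orr-Sommerfeld equation

With `L = (|k| / ν)^{1/3}` and `σ = sign k` the vorticity equation is `w'' = q w`,
`q = η² - a L² + i σ L³ (y - lam)`. Conjugation removes the sign, and the reflection `y ↦ -y`
exchanges the two walls (`IsVorticitySystem.conjugate`, `IsVorticitySystem.reflect`), so that only
`k > 0` and the wall `y = 1` have to be considered.

*The layer.* The substitution `y = lam + s / L`, `κ = η / L`, turns the equation into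
`f'' = (κ² - a + i s) f`. Barriers for the Riccati equation of the logarithmic derivative
`v = f' / f` give a solution that grows to the right with `Re v ≳ 1 + κ + √|s|`
(`exists_boundaryLayer`, `BoundaryLayer.norm_le`). In the channel this is a solution concentrated at
the wall `y = 1` in a layer of width `1 / M`, where `M = edgeRate η L (1 - lam)`
(`exists_edgeLayer`), and its mirror image is concentrated at the other wall. By the Wronskian the
two layers span all solutions (`exists_layer_coefficients`).

*Non-degeneracy.* The boundary conditions `W (±1) = 0` with prescribed `W' (±1)` amount to
prescribed pairings of `w` with the kernels `sinh (η (1 ± y))` (`wallKernel`,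
`IsStream.integral_wallKernel`). The decisive point is that the pairing of a layer with the kernel
of its own wall does not degenerate; up to a small error it is the value at the wall of the damped
primitive `G' = f - κ G`, so a lower bound for the ratio `m = G / f` is needed, which solves
`m' = 1 - (v + κ) m`. If `κ ≥ 0.65`, then `(v + κ) m` stays close to `1`, because `v` varies slowly
compared with the damping (`exists_boundaryLayer_large`). If `κ ≤ 0.65`, a forward invariant
lens-shaped region `δ ≤ Re ((1 + i τ) m) - β |m|²`, tilted and bent along the way, keeps `m` away from
`0` (`tilted_barrier`, `SmallLayer.weight_ratio_ge`). Its invariance needs rather precise values of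
`v`; they come from an enclosure of `v` for `κ = a = 0` (`exists_reference`), by asymptotic
expansions for `|s| ≥ 4` and by a table, verified in integer arithmetic, for `|s| ≤ 4`, and from a
comparison of the general `v` with this one (`exists_smallLayer`).

*Conclusion.* The pairing of a layer with the kernel of the opposite wall is of second order in the
width. So the 2 × 2 system for the coefficients of the layers is diagonally dominant for large `L`
(`IsCorrector.exists_coefficients`), which gives existence, uniqueness, and the pointwise bound
`LayerBound`: an exponential layer of height `M` and width `1 / M ≤ 1 / L`. All (weighted) norms of
the vorticity are read off from this profile. For the stream function, the energy estimate
`IsStream.energy_le` uses that `W` vanishes at the walls like the square root of the distance times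
the energy norm, and `IsStream.integral_sq_le` pairs with the solution `V` of the dual problem
`V'' - η² V = W`, which satisfies `‖V'‖_∞² ≤ 6 ‖W‖² / η`.
-/

/-! ### The scaled equation `f'' = (D + i s) f` -/

/-- Taylor coefficients at `0` of the solution of `f'' = (p + i s) f` with `f 0 = x0`, `f' 0 = x1`. -/
noncomputable def serCoeff (p x0 x1 : ℂ) : ℕ → ℂ
  | 0 => x0
  | 1 => x1
  | 2 => p * x0 / 2
  | n + 3 => (p * serCoeff p x0 x1 (n + 1) + Complex.I * serCoeff p x0 x1 n) / ((n + 3) * (n + 2))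

/-- The coefficients decay faster than any geometric sequence: from some index on, each of them times
the power of `ρ` is bounded by the maximum of the earlier ones. -/
lemma serCoeff_bound (p x0 x1 : ℂ) (ρ : ℝ) (hρ : 0 < ρ) :
    ∃ K : ℝ, 0 ≤ K ∧ ∀ n, ‖serCoeff p x0 x1 n‖ * ρ ^ n ≤ K := by
  obtain ⟨N, hN⟩ := exists_nat_ge (‖p‖ * ρ ^ 2 + ρ ^ 3)
  set c := serCoeff p x0 x1
  refine ⟨∑ j ∈ Finset.range (N + 3), ‖c j‖ * ρ ^ j, by positivity, ?_⟩
  set K := ∑ j ∈ Finset.range (N + 3), ‖c j‖ * ρ ^ j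
  have hK : 0 ≤ K := by positivity
  intro n
  induction n using Nat.strong_induction_on with
  | _ n ih =>
    by_cases hn : n < N + 3
    · exact Finset.single_le_sum (f := fun j => ‖c j‖ * ρ ^ j) (fun i _ => by positivity)
        (Finset.mem_range.2 hn)
    · obtain ⟨k, rfl⟩ : ∃ k, n = k + 3 := ⟨n - 3, by omega⟩
      have h1 := ih (k + 1) (by omega)
      have h2 := ih k (by omega)
      have hk : (N : ℝ) ≤ k := by exact_mod_cast (by omega : N ≤ k)
      have hc : c (k + 3) = (p * c (k + 1) + Complex.I * c k) / ((k + 3) * (k + 2)) := by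
        simp only [c]; rw [serCoeff]
      have hden : ‖((k : ℂ) + 3) * (k + 2)‖ = ((k : ℝ) + 3) * (k + 2) := by
        rw [norm_mul]
        congr 1
        · exact_mod_cast Complex.norm_natCast (k + 3)
        · exact_mod_cast Complex.norm_natCast (k + 2)
      rw [hc, norm_div, hden, div_mul_eq_mul_div, div_le_iff₀ (by positivity)]
      have h3 : ‖p * c (k + 1) + Complex.I * c k‖ ≤ ‖p‖ * ‖c (k + 1)‖ + ‖c k‖ := by
        refine (norm_add_le _ _).trans ?_
        simp
      calc ‖p * c (k + 1) + Complex.I * c k‖ * ρ ^ (k + 3)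
          ≤ (‖p‖ * ‖c (k + 1)‖ + ‖c k‖) * ρ ^ (k + 3) := by gcongr
        _ = ‖p‖ * ρ ^ 2 * (‖c (k + 1)‖ * ρ ^ (k + 1)) + ρ ^ 3 * (‖c k‖ * ρ ^ k) := by ring
        _ ≤ ‖p‖ * ρ ^ 2 * K + ρ ^ 3 * K := by gcongr
        _ = K * (‖p‖ * ρ ^ 2 + ρ ^ 3) := by ring
        _ ≤ K * ((k + 3) * (k + 2)) := by
            gcongr
            nlinarith

open Complex in
lemma hasDerivAt_powerSeries (c : ℕ → ℂ)
    (hc : ∀ ρ : ℝ, 0 < ρ → ∃ K : ℝ, 0 ≤ K ∧ ∀ n, ‖c n‖ * ρ ^ n ≤ K) (s : ℝ) :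
    HasDerivAt (fun s : ℝ => ∑' n, c n * (s : ℂ) ^ n)
      (∑' n : ℕ, ((n : ℂ) + 1) * c (n + 1) * (s : ℂ) ^ n) s := by
  set R : ℝ := |s| + 1
  have hR : 0 < R := by positivity
  obtain ⟨K, hK, hb⟩ := hc (2 * R) (by positivity)
  have hcn : ∀ n, ‖c n‖ * R ^ n ≤ K * (1 / 2) ^ n := by
    intro n
    have := hb n
    rw [mul_pow] at this
    rw [one_div, inv_pow, ← div_eq_mul_inv, le_div_iff₀ (by positivity)]
    linarith
  have hsum : Summable fun n : ℕ => K / R * ((n : ℝ) * (1 / 2) ^ n) := by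
    apply Summable.mul_left
    have := summable_pow_mul_geometric_of_norm_lt_one 1 (r := (1 / 2 : ℝ)) (by norm_num)
    simpa using this
  have hbd : ∀ (n : ℕ) (t : ℝ), t ∈ Ioo (-R) R →
      ‖c n * ((n : ℂ) * (t : ℂ) ^ (n - 1))‖ ≤ K / R * ((n : ℝ) * (1 / 2) ^ n) := by
    intro n t ht
    rcases n with _ | n
    · simp
    · have h := hcn (n + 1)
      simp only [Nat.add_sub_cancel, norm_mul, norm_pow, Complex.norm_natCast, Complex.norm_real, Real.norm_eq_abs]
      have hs : |t| ^ n ≤ R ^ n := by gcongr; exact (abs_lt.2 ht).le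
      calc ‖c (n + 1)‖ * (((n + 1 : ℕ) : ℝ) * |t| ^ n)
          ≤ ‖c (n + 1)‖ * (((n + 1 : ℕ) : ℝ) * R ^ n) := by gcongr
        _ = ((n + 1 : ℕ) : ℝ) * (‖c (n + 1)‖ * R ^ (n + 1)) / R := by rw [pow_succ]; field_simp
        _ ≤ ((n + 1 : ℕ) : ℝ) * (K * (1 / 2) ^ (n + 1)) / R := by gcongr
        _ = _ := by ring
  have key := hasDerivAt_tsum_of_isPreconnected (𝕜 := ℝ) (F := ℂ)
    (g := fun n (t : ℝ) => c n * (t : ℂ) ^ n)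
    (g' := fun n (t : ℝ) => c n * ((n : ℂ) * (t : ℂ) ^ (n - 1)))
    (t := Ioo (-R) R) (y₀ := 0) (y := s) hsum isOpen_Ioo isPreconnected_Ioo ?_ ?_ ?_ ?_ ?_
  · have hs : Summable fun n : ℕ => c n * ((n : ℂ) * (s : ℂ) ^ (n - 1)) := by
      refine Summable.of_norm_bounded hsum fun n => hbd n s ?_
      exact abs_lt.1 (by simp [R])
    rw [hs.tsum_eq_zero_add] at key
    simp only [Nat.cast_zero, zero_mul, mul_zero, zero_add, Nat.cast_add, Nat.cast_one,
        Nat.add_sub_cancel] at key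
    refine key.congr_deriv ?_
    congr 1; ext n; ring
  · intro n t _
    have h1 : HasDerivAt (fun t : ℝ => (t : ℂ)) 1 t := Complex.ofRealCLM.hasDerivAt
    simpa using (h1.pow n).const_mul (c n)
  · exact fun n t ht => hbd n t ht
  · exact ⟨by linarith, hR⟩
  · refine summable_of_ne_finset_zero (s := {0}) ?_
    intro n hn
    have : n ≠ 0 := by simpa using hn
    simp [this]
  · exact abs_lt.1 (by simp [R])

open Complex in
lemma summable_powerSeries (c : ℕ → ℂ)
    (hc : ∀ ρ : ℝ, 0 < ρ → ∃ K : ℝ, 0 ≤ K ∧ ∀ n, ‖c n‖ * ρ ^ n ≤ K) (s : ℝ) :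
    Summable fun n => c n * (s : ℂ) ^ n := by
  set R : ℝ := |s| + 1
  have hR : 0 < R := by positivity
  obtain ⟨K, hK, hb⟩ := hc (2 * R) (by positivity)
  refine Summable.of_norm_bounded (g := fun n => K * (1 / 2) ^ n)
    ((summable_geometric_of_lt_one (by norm_num) (by norm_num)).mul_left K) ?_
  intro n
  have := hb n
  rw [mul_pow] at this
  simp only [norm_mul, norm_pow, Complex.norm_real, Real.norm_eq_abs]
  rw [one_div, inv_pow, ← div_eq_mul_inv, le_div_iff₀ (by positivity)]
  have hs : |s| ^ n ≤ R ^ n := by gcongr; simp [R]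
  calc ‖c n‖ * |s| ^ n * 2 ^ n ≤ ‖c n‖ * R ^ n * 2 ^ n := by gcongr
    _ ≤ K := by linarith

lemma shift_coeff_bound (c : ℕ → ℂ)
    (hc : ∀ ρ : ℝ, 0 < ρ → ∃ K : ℝ, 0 ≤ K ∧ ∀ n, ‖c n‖ * ρ ^ n ≤ K) :
    ∀ ρ : ℝ, 0 < ρ → ∃ K : ℝ, 0 ≤ K ∧ ∀ n : ℕ, ‖((n : ℂ) + 1) * c (n + 1)‖ * ρ ^ n ≤ K := by
  intro ρ hρ
  obtain ⟨K, hK, hb⟩ := hc (2 * ρ) (by positivity)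
  refine ⟨K / ρ, by positivity, fun n => ?_⟩
  have h := hb (n + 1)
  have h1 : ‖(n : ℂ) + 1‖ = (n : ℝ) + 1 := by exact_mod_cast Complex.norm_natCast (n + 1)
  have h2 : (n : ℝ) + 1 ≤ 2 ^ (n + 1) := by
    exact_mod_cast (Nat.lt_two_pow_self (n := n + 1)).le
  rw [norm_mul, h1, le_div_iff₀ hρ]
  rw [mul_pow] at h
  calc ((n : ℝ) + 1) * ‖c (n + 1)‖ * ρ ^ n * ρ = ((n : ℝ) + 1) * (‖c (n + 1)‖ * ρ ^ (n + 1)) := by ring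
    _ ≤ 2 ^ (n + 1) * (‖c (n + 1)‖ * ρ ^ (n + 1)) := by gcongr
    _ ≤ K := by linarith

lemma exists_entire_solution (p x0 x1 : ℂ) : ∃ f g : ℝ → ℂ, f 0 = x0 ∧ g 0 = x1 ∧
    (∀ s, HasDerivAt f (g s) s) ∧
    ∀ s : ℝ, HasDerivAt g ((p + s * Complex.I) * f s) s := by
  set c := serCoeff p x0 x1 with hcdef
  have hc := fun ρ hρ => serCoeff_bound p x0 x1 ρ hρ
  have hd := shift_coeff_bound c hc
  have hz : ∀ e : ℕ → ℂ, ∑' n, e n * ((0 : ℝ) : ℂ) ^ n = e 0 := by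
    intro e
    rw [tsum_eq_single 0]
    · simp
    · intro n hn; simp [hn]
  refine ⟨fun s : ℝ => ∑' n, c n * (s : ℂ) ^ n,
    fun s : ℝ => ∑' n : ℕ, ((n : ℂ) + 1) * c (n + 1) * (s : ℂ) ^ n, ?_, ?_, ?_, ?_⟩
  · exact (hz c).trans (by simp [hcdef, serCoeff])
  · exact (hz _).trans (by simp [hcdef, serCoeff])
  · exact fun s => hasDerivAt_powerSeries c hc s
  · intro s
    refine (hasDerivAt_powerSeries _ hd s).congr_deriv ?_
    have hs := summable_powerSeries c hc s
    have he := summable_powerSeries _ (shift_coeff_bound _ hd) s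
    have h0 : (fun n : ℕ => p * (c (n + 1) * (s : ℂ) ^ (n + 1))
        + (s * Complex.I) * (c n * (s : ℂ) ^ n)) =
        fun n : ℕ => ((((n + 1 : ℕ) : ℂ) + 1) * ((((n + 1 + 1 : ℕ) : ℂ) + 1) * c (n + 1 + 1 + 1)))
          * (s : ℂ) ^ (n + 1) := by
      ext n
      have : c (n + 1 + 1 + 1) = (p * c (n + 1) + Complex.I * c n) / ((n + 3) * (n + 2)) := by
        rw [hcdef, serCoeff]
      rw [this]
      have h3 : (n : ℂ) + 3 ≠ 0 := by exact_mod_cast (Nat.succ_ne_zero (n + 2))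
      have h2 : (n : ℂ) + 2 ≠ 0 := by exact_mod_cast (Nat.succ_ne_zero (n + 1))
      push_cast
      field_simp
      ring
    rw [he.tsum_eq_zero_add]
    have h1 := (((summable_nat_add_iff 1).2 hs).mul_left p).tsum_add (hs.mul_left (s * Complex.I))
    rw [add_mul p, ← tsum_mul_left, ← tsum_mul_left, (hs.mul_left p).tsum_eq_zero_add, add_assoc (p * _),
      ← h1, h0]
    congr 1
    · have : c (0 + 1 + 1) = p * x0 / 2 := by rw [hcdef]; simp [serCoeff]
      have h00 : c 0 = x0 := by rw [hcdef]; simp [serCoeff]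
      simp only [this, h00]; push_cast; ring

/-- Pairs `(f, f')` solving the scaled equation `f'' = (D + i s) f` on the whole line. -/
def IsLayerPair (D : ℝ) (f g : ℝ → ℂ) : Prop :=
  (∀ s, HasDerivAt f (g s) s) ∧ ∀ s : ℝ, HasDerivAt g (((D : ℂ) + s * Complex.I) * f s) s

lemma exists_layerPair (D s₀ : ℝ) (x0 x1 : ℂ) :
    ∃ f g, IsLayerPair D f g ∧ f s₀ = x0 ∧ g s₀ = x1 := by
  obtain ⟨f, g, h0, h1, hf, hg⟩ := exists_entire_solution (D + s₀ * Complex.I) x0 x1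
  refine ⟨fun s => f (s - s₀), fun s => g (s - s₀), ⟨fun s => (hf _).comp_sub_const s s₀, ?_⟩,
    by simpa using h0, by simpa using h1⟩
  intro s
  refine ((hg (s - s₀)).comp_sub_const s s₀).congr_deriv ?_
  push_cast; ring

/-- The Wronskian with a second solution is constant, so a solution that vanishes together with
its derivative at one point vanishes with its derivative at every point. -/
lemma IsLayerPair.ne_zero {D : ℝ} {f g : ℝ → ℂ} (h : IsLayerPair D f g) {s₀ : ℝ}
    (h0 : f s₀ ≠ 0) {s : ℝ} (hs : f s = 0) : g s ≠ 0 := by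
  intro hg
  obtain ⟨u, v, huv, hu, hv⟩ := exists_layerPair D s₀ 0 1
  have hW : ∀ t, HasDerivAt (fun t => f t * v t - g t * u t) 0 t := fun t =>
    (((h.1 t).mul (huv.2 t)).sub ((h.2 t).mul (huv.1 t))).congr_deriv (by ring)
  have := is_const_of_deriv_eq_zero (fun t => (hW t).differentiableAt) (fun t => (hW t).deriv) s s₀
  simp [hs, hg, hu, hv] at this
  exact h0 this.symm

/-- First-exit barrier: a function that is increasing wherever it vanishes stays nonnegative. -/
lemma nonneg_of_barrier {φ φ' : ℝ → ℝ} {a b : ℝ}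
    (hφ : ∀ s ∈ Icc a b, HasDerivAt φ (φ' s) s) (ha : 0 ≤ φ a)
    (hb : ∀ s ∈ Ico a b, φ s = 0 → 0 < φ' s) : ∀ s ∈ Icc a b, 0 ≤ φ s := by
  intro s hs
  have := image_le_of_deriv_right_lt_deriv_boundary' (f := fun s => - φ s) (f' := fun s => - φ' s)
    (B := fun _ => 0) (B' := fun _ => 0) (a := a) (b := b)
    (fun x hx => (hφ x hx).continuousAt.neg.continuousWithinAt)
    (fun x hx => (hφ x (Ico_subset_Icc_self hx)).neg.hasDerivWithinAt) (by simpa using ha)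
    continuousOn_const (fun x _ => hasDerivWithinAt_const _ _ _)
    (fun x hx h => by have := hb x hx (by linarith); linarith) hs
  linarith

open ComplexConjugate in
lemma hasDerivAt_re_conj_mul {u v : ℝ → ℂ} {u' v' : ℂ} {s : ℝ} (hu : HasDerivAt u u' s)
    (hv : HasDerivAt v v' s) :
    HasDerivAt (fun s => (conj (u s) * v s).re) ((conj u' * v s).re + (conj (u s) * v').re) s := by
  have h1 : HasDerivAt (fun s => conj (u s)) (conj u') s :=
    Complex.conjCLE.toContinuousLinearMap.hasFDerivAt.comp_hasDerivAt s hu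
  have h2 := Complex.reCLM.hasFDerivAt.comp_hasDerivAt s (h1.mul hv)
  exact h2.congr_deriv (by simp)

lemma hasDerivAt_normSq' {u : ℝ → ℂ} {u' : ℂ} {s : ℝ} (hu : HasDerivAt u u' s) :
    HasDerivAt (fun s => ‖u s‖ ^ 2) (2 * ((starRingEnd ℂ) (u s) * u').re) s := by
  have h := hasDerivAt_re_conj_mul hu hu
  have e : (fun s => ((starRingEnd ℂ) (u s) * u s).re) = fun s => ‖u s‖ ^ 2 := by
    ext t
    rw [Complex.conj_mul', ← Complex.ofReal_pow, Complex.ofReal_re]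
  rw [e] at h
  refine h.congr_deriv ?_
  simp [Complex.mul_re]; ring

/-- Linear form of the disc barrier for the Riccati variable `g / f`: the disc of radius `r` about
the reference `c` is forward invariant. Only `f`, `g` enter, so `f` may vanish a priori. -/
lemma IsLayerPair.disc_barrier {D : ℝ} {f g : ℝ → ℂ} (h : IsLayerPair D f g) {a b r : ℝ}
    (hr : 0 < r) (ha0 : f a ≠ 0) {c c' : ℝ → ℂ} {k : ℝ → ℝ}
    (hc : ∀ s ∈ Icc a b, HasDerivAt c (c' s) s)
    (ha : ‖g a - c a * f a‖ ≤ r * ‖f a‖)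
    (hk : ∀ s ∈ Ico a b, ‖g s - c s * f s‖ = r * ‖f s‖ →
      k s * ‖f s‖ ^ 2 ≤ ((starRingEnd ℂ) (f s) * g s).re)
    (he : ∀ s ∈ Ico a b, ‖(D : ℂ) + s * Complex.I - c s ^ 2 - c' s‖ < r * ((c s).re + k s)) :
    ∀ s ∈ Icc a b, ‖g s - c s * f s‖ ≤ r * ‖f s‖ := by
  set F : ℝ → ℂ := fun s => g s - c s * f s with hF
  set e : ℝ → ℂ := fun s => (D : ℂ) + s * Complex.I - c s ^ 2 - c' s with hee
  have hF' : ∀ s ∈ Icc a b, HasDerivAt F (e s * f s - c s * F s) s := fun s hs =>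
    ((h.2 s).sub ((hc s hs).mul (h.1 s))).congr_deriv (by simp only [hF, hee]; ring)
  have key := nonneg_of_barrier (φ := fun s => r ^ 2 * ‖f s‖ ^ 2 - ‖F s‖ ^ 2)
    (fun s hs => ((hasDerivAt_normSq' (h.1 s)).const_mul (r ^ 2)).sub
      (hasDerivAt_normSq' (hF' s hs))) (a := a) (b := b) ?_ ?_
  · intro s hs
    have := key s hs
    refine abs_le_of_sq_le_sq' ?_ (by positivity) |>.2
    show ‖F s‖ ^ 2 ≤ _
    nlinarith
  · have : ‖F a‖ ^ 2 ≤ (r * ‖f a‖) ^ 2 := by gcongr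
    nlinarith
  · intro s hs h0
    have hFe : ‖F s‖ = r * ‖f s‖ := by
      have : ‖F s‖ ^ 2 = (r * ‖f s‖) ^ 2 := by linarith [mul_pow r ‖f s‖ 2]
      exact (pow_left_inj₀ (norm_nonneg _) (by positivity) two_ne_zero).1 this
    have hf0 : f s ≠ 0 := by
      intro hf
      have hg := h.ne_zero ha0 hf
      rw [hf] at hFe; simp [hF, hf] at hFe; exact hg hFe
    have hpos : 0 < ‖f s‖ := norm_pos_iff.2 hf0
    have hk' := hk s hs hFe
    have he' := he s hs
    have h1 : ((starRingEnd ℂ) (F s) * (e s * f s - c s * F s)).re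
        ≤ ‖F s‖ * (‖e s‖ * ‖f s‖) - (c s).re * ‖F s‖ ^ 2 := by
      have e1 : (starRingEnd ℂ) (F s) * (e s * f s - c s * F s)
          = (starRingEnd ℂ) (F s) * (e s * f s) - c s * ((‖F s‖ ^ 2 : ℝ) : ℂ) := by
        rw [Complex.ofReal_pow, ← Complex.conj_mul']; ring
      rw [e1, Complex.sub_re, Complex.re_mul_ofReal]
      gcongr
      refine (Complex.re_le_norm _).trans ?_
      simp
    have h2 : ‖e s‖ < r * ((c s).re + k s) := he'
    have h3 : r * ‖f s‖ * (‖e s‖ * ‖f s‖) < r * ‖f s‖ * ((r * ((c s).re + k s)) * ‖f s‖) := by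
      gcongr
    rw [hFe] at h1
    nlinarith [mul_le_mul_of_nonneg_left hk' (sq_nonneg r)]

/-! ### A validated enclosure of the reference solution, `D = 0` -/

/-- Approximate values of `10⁵ (Re v, Im v)` at the nodes `s = -4 + i / 32`, `0 ≤ i ≤ 256`, where
`v = f' / f` is the logarithmic derivative of the solution of `f'' = i s f` that is recessive at
`-∞`. Nothing is assumed about them; `reference_cells` verifies what is used. -/
def refTable : List (ℤ × ℤ) := [
  (147338, -141692), (146827, -141143), (146315, -140592), (145801, -140039), (145285, -139484),
  (144768, -138927), (144249, -138367), (143729, -137806), (143207, -137242), (142684, -136676),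
  (142158, -136107), (141631, -135536), (141102, -134963), (140572, -134388), (140040, -133810),
  (139506, -133230), (138970, -132648), (138432, -132063), (137893, -131475), (137352, -130885),
  (136809, -130293), (136264, -129697), (135717, -129100), (135169, -128499), (134618, -127896),
  (134066, -127290), (133512, -126682), (132955, -126070), (132397, -125456), (131837, -124839),
  (131274, -124219), (130710, -123596), (130144, -122970), (129575, -122341), (129005, -121709),
  (128432, -121074), (127857, -120436), (127280, -119795), (126701, -119150), (126120, -118502),
  (125537, -117851), (124951, -117197), (124363, -116538), (123773, -115877), (123180, -115212),
  (122586, -114543), (121989, -113871), (121389, -113195), (120787, -112516), (120183, -111832),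
  (119576, -111145), (118967, -110454), (118356, -109759), (117741, -109059), (117125, -108356),
  (116506, -107648), (115884, -106937), (115260, -106221), (114633, -105500), (114003, -104775),
  (113371, -104046), (112736, -103312), (112098, -102573), (111458, -101830), (110815, -101081),
  (110169, -100328), (109520, -99570), (108869, -98806), (108214, -98037), (107557, -97264),
  (106896, -96484), (106233, -95699), (105567, -94909), (104898, -94113), (104225, -93311),
  (103550, -92503), (102872, -91689), (102190, -90869), (101506, -90042), (100818, -89210),
  (100127, -88370), (99433, -87524), (98736, -86671), (98035, -85812), (97331, -84945),
  (96624, -84071), (95913, -83189), (95199, -82300), (94482, -81403), (93762, -80499),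
  (93038, -79586), (92310, -78665), (91580, -77735), (90845, -76797), (90108, -75850),
  (89367, -74894), (88622, -73929), (87874, -72955), (87122, -71970), (86367, -70976),
  (85609, -69972), (84847, -68957), (84081, -67932), (83312, -66895), (82540, -65848),
  (81764, -64789), (80985, -63718), (80203, -62635), (79417, -61540), (78628, -60432),
  (77836, -59311), (77040, -58177), (76241, -57029), (75440, -55867), (74635, -54691),
  (73828, -53499), (73017, -52292), (72205, -51070), (71389, -49831), (70571, -48576),
  (69751, -47304), (68929, -46014), (68105, -44706), (67279, -43380), (66452, -42034),
  (65624, -40669), (64795, -39284), (63965, -37878), (63134, -36451), (62304, -35001),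
  (61474, -33529), (60645, -32034), (59817, -30515), (58991, -28971), (58167, -27402),
  (57345, -25806), (56528, -24184), (55714, -22535), (54905, -20857), (54102, -19150),
  (53305, -17413), (52516, -15646), (51735, -13847), (50963, -12016), (50202, -10151),
  (49453, -8253), (48717, -6321), (47995, -4352), (47290, -2348), (46602, -307), (45933, 1771),
  (45285, 3888), (44661, 6044), (44062, 8238), (43491, 10473), (42950, 12747), (42441, 15062),
  (41967, 17417), (41530, 19812), (41135, 22248), (40783, 24723), (40478, 27237), (40224, 29790),
  (40023, 32380), (39879, 35005), (39796, 37665), (39777, 40358), (39826, 43080), (39947, 45829),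
  (40143, 48603), (40417, 51397), (40774, 54208), (41216, 57031), (41746, 59862), (42367, 62694),
  (43082, 65524), (43891, 68343), (44797, 71147), (45801, 73927), (46902, 76678), (48100, 79390),
  (49395, 82058), (50783, 84673), (52263, 87227), (53830, 89714), (55480, 92126), (57209, 94456),
  (59009, 96697), (60874, 98845), (62797, 100893), (64769, 102838), (66782, 104676),
  (68827, 106404), (70894, 108021), (72975, 109527), (75060, 110921), (77140, 112206),
  (79207, 113384), (81252, 114458), (83266, 115432), (85244, 116312), (87178, 117103),
  (89063, 117811), (90894, 118443), (92666, 119005), (94377, 119504), (96024, 119948),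
  (97606, 120344), (99121, 120697), (100570, 121016), (101953, 121306), (103271, 121574),
  (104526, 121825), (105719, 122065), (106854, 122298), (107932, 122528), (108957, 122760),
  (109932, 122997), (110860, 123242), (111745, 123498), (112589, 123766), (113397, 124049),
  (114171, 124347), (114915, 124662), (115632, 124995), (116324, 125346), (116995, 125714),
  (117648, 126101), (118284, 126506), (118906, 126928), (119517, 127366), (120118, 127821),
  (120711, 128291), (121298, 128776), (121880, 129273), (122459, 129784), (123036, 130305),
  (123611, 130837), (124185, 131378), (124760, 131927), (125335, 132483), (125912, 133046),
  (126490, 133613), (127070, 134185), (127652, 134760), (128236, 135338), (128822, 135918),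
  (129410, 136498), (130000, 137079), (130591, 137660), (131185, 138240), (131779, 138819),
  (132375, 139397), (132972, 139972), (133569, 140545), (134167, 141116), (134765, 141684)]

/-- Real part of the `i`-th entry of `refTable`, in units of `10⁻⁵`. -/
def refX (i : ℕ) : ℤ := (refTable.getD i (0, 0)).1

/-- Imaginary part of the `i`-th entry of `refTable`, in units of `10⁻⁵`. -/
def refY (i : ℕ) : ℤ := (refTable.getD i (0, 0)).2

/-- Real part of the slope `v' = i s - v²`, in units of `10⁻¹⁰`. -/
def slopeX (x y : ℤ) : ℤ := y ^ 2 - x ^ 2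

/-- Imaginary part of the slope `v' = i s - v²`; here `s` and the value are in units of `10⁻¹⁰`. -/
def slopeY (s x y : ℤ) : ℤ := s - 2 * x * y

/-- Quadratic coefficient of the parabola with slope `p` at a node which takes the values `x`, `x'` at
this node and at the next one, at the distance `1 / 32`; in units of `10⁻¹⁰`. -/
def curv (x x' p : ℤ) : ℤ := 102400000 * (x' - x) - 32 * p

/-- The inequalities that make the parabola with value `(x, y)`, slope `(px, py)` and quadratic
coefficient `(qx, qy)` an approximate solution of the Riccati equation `v' = i s - v²` on one cell:
the hypotheses of `quadratic_residual_bound`, multiplied by powers of ten. -/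
def defectOK (x y px py qx qy : ℤ) : Bool :=
  decide (|px| ≤ 10 ^ 10) && decide (|py| ≤ 10 ^ 10) && decide (|qx| ≤ 6 * 10 ^ 9) && decide (|qy| ≤ 6 * 10 ^ 9) &&
  decide (|2 * (x * px - y * py) + 200000 * qx| ≤ 45 * 10 ^ 12) &&
  decide (|10 ^ 15 - 2 * (x * py + y * px) - 200000 * qy| ≤ 45 * 10 ^ 12) &&
  decide (|px ^ 2 - py ^ 2 + 200000 * (x * qx - y * qy)| ≤ 15 * 10 ^ 19) &&
  decide (|2 * px * py + 200000 * (x * qy + y * qx)| ≤ 15 * 10 ^ 19)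

/-- `defectOK` for the parabola through the nodes `i` and `i + 1`, where `s = (i - 128) / 32`. -/
def cellOK (i : ℕ) (x y x' y' : ℤ) : Bool :=
  let px := slopeX x y
  let py := slopeY (312500000 * ((i : ℤ) - 128)) x y
  defectOK x y px py (curv x x' px) (curv y y' py)

/-- A lower bound for `100 Re v` from the left end up to the cell `i`. Being nonincreasing in `i`, it
serves as damping rate for the comparison with other solutions. -/
def amLevel (i : ℕ) : ℤ := if i < 96 then 86 else if i < 128 then 61 else 38

lemma reference_cells : ∀ i < 256, cellOK i (refX i) (refY i) (refX (i + 1)) (refY (i + 1)) = true ∧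
    1000 * amLevel i + 1215 ≤ refX i ∧ 1000 * amLevel i + 1215 ≤ refX (i + 1) ∧
    refX i ≤ 150000 ∧ refX (i + 1) ≤ 150000 := by
  decide +kernel

lemma amLevel_ge (i : ℕ) : 38 ≤ amLevel i := by
  unfold amLevel; split_ifs <;> norm_num

/-- Both `Re (f̄ f')` and `Re (f̄ f') - √D |f|²` are nondecreasing, the derivative of the latter being
`|f' - √D f|²`. -/
lemma IsLayerPair.nonzero_of_re_pos {D : ℝ} (hD : 0 ≤ D) {f g : ℝ → ℂ} (h : IsLayerPair D f g)
    {s₀ : ℝ} (hpos : 0 < ((starRingEnd ℂ) (f s₀) * g s₀).re)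
    (hge : √D * ‖f s₀‖ ^ 2 ≤ ((starRingEnd ℂ) (f s₀) * g s₀).re) {s : ℝ} (hs : s₀ ≤ s) :
    f s ≠ 0 ∧ √D * ‖f s‖ ^ 2 ≤ ((starRingEnd ℂ) (f s) * g s).re := by
  have hd : ∀ t, HasDerivAt (fun t => ((starRingEnd ℂ) (f t) * g t).re)
      (‖g t‖ ^ 2 + D * ‖f t‖ ^ 2) t := by
    intro t
    refine (hasDerivAt_re_conj_mul (h.1 t) (h.2 t)).congr_deriv ?_
    congr 1
    · rw [Complex.conj_mul', ← Complex.ofReal_pow, Complex.ofReal_re]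
    · rw [mul_left_comm, Complex.conj_mul', ← Complex.ofReal_pow, Complex.re_mul_ofReal]
      simp
  have hm1 : Monotone (fun t => ((starRingEnd ℂ) (f t) * g t).re) :=
    monotone_of_deriv_nonneg (fun t => (hd t).differentiableAt)
      (fun t => by rw [(hd t).deriv]; positivity)
  have hd2 : ∀ t, HasDerivAt (fun t => ((starRingEnd ℂ) (f t) * g t).re - √D * ‖f t‖ ^ 2)
      (‖g t - √D * f t‖ ^ 2) t := by
    intro t
    refine ((hd t).sub ((hasDerivAt_normSq' (h.1 t)).const_mul √D)).congr_deriv ?_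
    have e : ‖g t - √D * f t‖ ^ 2 = ‖g t‖ ^ 2 + √D ^ 2 * ‖f t‖ ^ 2
        - 2 * √D * ((starRingEnd ℂ) (f t) * g t).re := by
      rw [← Complex.normSq_eq_norm_sq, ← Complex.normSq_eq_norm_sq, ← Complex.normSq_eq_norm_sq]
      simp [Complex.normSq_apply]; ring
    rw [e, Real.sq_sqrt hD]; ring
  have hm2 : Monotone (fun t => ((starRingEnd ℂ) (f t) * g t).re - √D * ‖f t‖ ^ 2) :=
    monotone_of_deriv_nonneg (fun t => (hd2 t).differentiableAt)
      (fun t => by rw [(hd2 t).deriv]; positivity)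
  constructor
  · intro hf
    have := hm1 hs
    simp only [hf, map_zero, zero_mul, Complex.zero_re] at this
    linarith
  · have := hm2 hs
    simp only at this
    linarith

/-- `disc_barrier` with the bound on `Re (g / f)` that the disc itself provides. -/
lemma IsLayerPair.disc_barrier_self {D : ℝ} {f g : ℝ → ℂ} (h : IsLayerPair D f g) {a b r : ℝ}
    (hr : 0 < r) (ha0 : f a ≠ 0) {c c' : ℝ → ℂ}
    (hc : ∀ s ∈ Icc a b, HasDerivAt c (c' s) s)
    (ha : ‖g a - c a * f a‖ ≤ r * ‖f a‖)
    (he : ∀ s ∈ Ico a b, ‖(D : ℂ) + s * Complex.I - c s ^ 2 - c' s‖ < r * (2 * (c s).re - r)) :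
    ∀ s ∈ Icc a b, ‖g s - c s * f s‖ ≤ r * ‖f s‖ := by
  refine h.disc_barrier hr ha0 hc ha (k := fun s => (c s).re - r) ?_ ?_
  · intro s _ heq
    have e : (starRingEnd ℂ) (f s) * g s
        = c s * ((‖f s‖ ^ 2 : ℝ) : ℂ) + (starRingEnd ℂ) (f s) * (g s - c s * f s) := by
      rw [Complex.ofReal_pow, ← Complex.conj_mul']; ring
    rw [e, Complex.add_re, Complex.re_mul_ofReal]
    have := (abs_le.1 (Complex.abs_re_le_norm ((starRingEnd ℂ) (f s) * (g s - c s * f s)))).1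
    rw [norm_mul, heq, RCLike.norm_conj] at this
    nlinarith
  · intro s hs
    convert he s hs using 2; ring

lemma norm_le_of_abs {z : ℂ} {u v : ℝ} (h1 : |z.re| ≤ u) (h2 : |z.im| ≤ v) : ‖z‖ ≤ u + v :=
  (Complex.norm_le_abs_re_add_abs_im z).trans (add_le_add h1 h2)

/-- On a cell, the parabola stays between its end values up to `0.6 / 4096`. -/
lemma chord_bound {s u u' d e : ℝ} (he : e = 1024 * (u' - u) - 32 * d) (hb : |e| ≤ 0.6) {t : ℝ}
    (ht : t ∈ Icc s (s + 1 / 32)) :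
    min u u' - 0.00015 ≤ u + d * (t - s) + e * (t - s) ^ 2 ∧
      u + d * (t - s) + e * (t - s) ^ 2 ≤ max u u' + 0.00015 := by
  obtain ⟨w, hw⟩ : ∃ w, w = t - s := ⟨_, rfl⟩
  have hw0 : 0 ≤ w := by linarith [ht.1]
  have hw1 : w ≤ 1 / 32 := by linarith [ht.2]
  rw [← hw]
  have hd : d = 32 * (u' - u) - e / 32 := by linarith
  have e1 : u + d * w + e * w ^ 2 = u * (1 - 32 * w) + u' * (32 * w) - e * (w * (1 / 32 - w)) := by
    rw [hd]; ring
  have h3 : |e * (w * (1 / 32 - w))| ≤ 0.6 * (1 / 4096) := by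
    rw [abs_mul, abs_of_nonneg (mul_nonneg hw0 (by linarith : (0 : ℝ) ≤ 1 / 32 - w))]
    refine mul_le_mul hb ?_ (mul_nonneg hw0 (by linarith)) (by norm_num)
    nlinarith [sq_nonneg (w - 1 / 64)]
  have h4 := abs_le.1 h3
  have m1 := min_le_left u u'
  have m2 := min_le_right u u'
  have m3 := le_max_left u u'
  have m4 := le_max_right u u'
  have a1 : 0 ≤ 1 - 32 * w := by linarith
  have a2 : 0 ≤ 32 * w := by linarith
  rw [e1]
  constructor
  · nlinarith [mul_le_mul_of_nonneg_right m1 a1, mul_le_mul_of_nonneg_right m2 a2]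
  · nlinarith [mul_le_mul_of_nonneg_right m3 a1, mul_le_mul_of_nonneg_right m4 a2]

/-- The defect of the parabola `z + p w + q w²` in `v' = i s - v²`, where `p = i s - z²`, has no term of
order zero in `w`. -/
lemma quadratic_residual_bound {x y px py qx qy w : ℝ} {z p q : ℂ} (hz : z = ⟨x, y⟩)
    (hp : p = ⟨px, py⟩) (hq : q = ⟨qx, qy⟩)
    (bpx : |px| ≤ 1) (bpy : |py| ≤ 1) (bqx : |qx| ≤ 0.6) (bqy : |qy| ≤ 0.6)
    (b1x : |2 * (x * px - y * py) + 2 * qx| ≤ 0.045)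
    (b1y : |1 - 2 * (x * py + y * px) - 2 * qy| ≤ 0.045)
    (b2x : |px ^ 2 - py ^ 2 + 2 * (x * qx - y * qy)| ≤ 1.5)
    (b2y : |2 * px * py + 2 * (x * qy + y * qx)| ≤ 1.5) (hw0 : 0 ≤ w) (hw1 : w ≤ 1 / 32) :
    ‖(Complex.I - 2 * z * p - 2 * q) * (w : ℂ) - (p ^ 2 + 2 * z * q) * ((w ^ 2 : ℝ) : ℂ)
          - 2 * p * q * ((w ^ 3 : ℝ) : ℂ) - q ^ 2 * ((w ^ 4 : ℝ) : ℂ)‖ ≤ 0.006 := by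
  have n1 : ‖Complex.I - 2 * z * p - 2 * q‖ ≤ 0.045 + 0.045 := by
    apply norm_le_of_abs
    · have : (Complex.I - 2 * z * p - 2 * q).re = -(2 * (x * px - y * py) + 2 * qx) := by
        simp [hz, hp, hq]; ring
      rw [this, abs_neg]; exact b1x
    · have : (Complex.I - 2 * z * p - 2 * q).im = 1 - 2 * (x * py + y * px) - 2 * qy := by
        simp [hz, hp, hq]; ring
      rw [this]; exact b1y
  have n2 : ‖p ^ 2 + 2 * z * q‖ ≤ 1.5 + 1.5 := by
    apply norm_le_of_abs
    · have : (p ^ 2 + 2 * z * q).re = px ^ 2 - py ^ 2 + 2 * (x * qx - y * qy) := by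
        simp [hz, hp, hq, pow_two]; ring
      rw [this]; exact b2x
    · have : (p ^ 2 + 2 * z * q).im = 2 * px * py + 2 * (x * qy + y * qx) := by
        simp [hz, hp, hq, pow_two]; ring
      rw [this]; exact b2y
  have np : ‖p‖ ≤ 1 + 1 := by rw [hp]; exact norm_le_of_abs bpx bpy
  have nq : ‖q‖ ≤ 0.6 + 0.6 := by rw [hq]; exact norm_le_of_abs bqx bqy
  have w2 : w ^ 2 ≤ (1 / 32) ^ 2 := by gcongr
  have w3 : w ^ 3 ≤ (1 / 32) ^ 3 := by gcongr
  have w4 : w ^ 4 ≤ (1 / 32) ^ 4 := by gcongr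
  have cw : ∀ u : ℝ, 0 ≤ u → ‖(u : ℂ)‖ = u := fun u hu => by
    rw [Complex.norm_real, Real.norm_of_nonneg hu]
  have m1 : ‖(Complex.I - 2 * z * p - 2 * q) * (w : ℂ)‖ ≤ 0.09 * (1 / 32) := by
    rw [norm_mul, cw w hw0]
    exact mul_le_mul (by linarith) hw1 hw0 (by norm_num)
  have m2 : ‖(p ^ 2 + 2 * z * q) * ((w ^ 2 : ℝ) : ℂ)‖ ≤ 3 * (1 / 32) ^ 2 := by
    rw [norm_mul, cw _ (by positivity)]
    exact mul_le_mul (by linarith) w2 (by positivity) (by norm_num)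
  have m3 : ‖2 * p * q * ((w ^ 3 : ℝ) : ℂ)‖ ≤ (2 * 2 * 1.2) * (1 / 32) ^ 3 := by
    rw [norm_mul, norm_mul, norm_mul, cw _ (by positivity), Complex.norm_ofNat]
    refine mul_le_mul ?_ w3 (by positivity) (by norm_num)
    exact mul_le_mul (by linarith) (by linarith) (norm_nonneg _) (by norm_num)
  have m4 : ‖q ^ 2 * ((w ^ 4 : ℝ) : ℂ)‖ ≤ 1.2 ^ 2 * (1 / 32) ^ 4 := by
    rw [norm_mul, norm_pow, cw _ (by positivity)]
    refine mul_le_mul ?_ w4 (by positivity) (by norm_num)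
    gcongr; linarith
  have tri := (norm_sub_le ((Complex.I - 2 * z * p - 2 * q) * (w : ℂ)
    - (p ^ 2 + 2 * z * q) * ((w ^ 2 : ℝ) : ℂ) - 2 * p * q * ((w ^ 3 : ℝ) : ℂ))
    (q ^ 2 * ((w ^ 4 : ℝ) : ℂ)))
  have tri2 := norm_sub_le ((Complex.I - 2 * z * p - 2 * q) * (w : ℂ)
    - (p ^ 2 + 2 * z * q) * ((w ^ 2 : ℝ) : ℂ)) (2 * p * q * ((w ^ 3 : ℝ) : ℂ))
  have tri3 := norm_sub_le ((Complex.I - 2 * z * p - 2 * q) * (w : ℂ))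
    ((p ^ 2 + 2 * z * q) * ((w ^ 2 : ℝ) : ℂ))
  linarith

/-- One step of the enclosure: a disc of radius `0.012` is carried along the parabola through two
neighbouring nodes, since its defect is at most `0.006 < 0.012 (2 · 0.392 - 0.012)`. -/
lemma IsLayerPair.cell_step {f g : ℝ → ℂ} (h : IsLayerPair 0 f g) {s x y x' y' px py qx qy : ℝ}
    (hf : ∀ t, s ≤ t → f t ≠ 0)
    (hpx : px = y ^ 2 - x ^ 2) (hpy : py = s - 2 * x * y)
    (hqx : qx = 1024 * (x' - x) - 32 * px) (hqy : qy = 1024 * (y' - y) - 32 * py)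
    (bpx : |px| ≤ 1) (bpy : |py| ≤ 1) (bqx : |qx| ≤ 0.6) (bqy : |qy| ≤ 0.6)
    (b1x : |2 * (x * px - y * py) + 2 * qx| ≤ 0.045)
    (b1y : |1 - 2 * (x * py + y * px) - 2 * qy| ≤ 0.045)
    (b2x : |px ^ 2 - py ^ 2 + 2 * (x * qx - y * qy)| ≤ 1.5)
    (b2y : |2 * px * py + 2 * (x * qy + y * qx)| ≤ 1.5)
    {am : ℝ} (ham : 0.38 ≤ am) (hx : am + 0.01215 ≤ x) (hx' : am + 0.01215 ≤ x')
    (hs : ‖g s / f s - ⟨x, y⟩‖ ≤ 0.012) :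
    (∀ t ∈ Icc s (s + 1 / 32), (min x x' - 0.01215 ≤ (g t / f t).re) ∧
      ((g t / f t).re ≤ max x x' + 0.01215) ∧
      (min y y' - 0.01215 ≤ (g t / f t).im) ∧ ((g t / f t).im ≤ max y y' + 0.01215)) ∧
    ‖g (s + 1 / 32) / f (s + 1 / 32) - ⟨x', y'⟩‖ ≤ 0.012 := by
  obtain ⟨p, hp⟩ : ∃ p : ℂ, p = ⟨px, py⟩ := ⟨_, rfl⟩
  obtain ⟨q, hq⟩ : ∃ q : ℂ, q = ⟨qx, qy⟩ := ⟨_, rfl⟩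
  obtain ⟨z, hz⟩ : ∃ z : ℂ, z = ⟨x, y⟩ := ⟨_, rfl⟩
  rw [← hz] at hs
  have hpz : p = s * Complex.I - z ^ 2 := by
    apply Complex.ext
    · simp [hp, hz, hpx, pow_two]
    · simp [hp, hz, hpy, pow_two]; ring
  set c : ℝ → ℂ := fun t => z + p * ((t - s : ℝ) : ℂ) + q * ((t - s : ℝ) : ℂ) ^ 2 with hc
  have hcre : ∀ t, (c t).re = x + px * (t - s) + qx * (t - s) ^ 2 := by
    intro t; simp only [hc, ← Complex.ofReal_pow, Complex.add_re, Complex.re_mul_ofReal, hz, hp, hq]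
  have hcim : ∀ t, (c t).im = y + py * (t - s) + qy * (t - s) ^ 2 := by
    intro t; simp only [hc, ← Complex.ofReal_pow, Complex.add_im, Complex.im_mul_ofReal, hz, hp, hq]
  have hder : ∀ t, HasDerivAt c (p + 2 * q * ((t - s : ℝ) : ℂ)) t := by
    intro t
    have h1 : HasDerivAt (fun t : ℝ => ((t - s : ℝ) : ℂ)) 1 t := by
      have := ((hasDerivAt_id t).sub_const s).ofReal_comp
      simpa using this
    refine (((h1.const_mul p).const_add z).add ((h1.pow 2).const_mul q)).congr_deriv ?_
    push_cast; ring
  have hcs : c s = z := by simp [hc]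
  have key := h.disc_barrier_self (a := s) (b := s + 1 / 32) (r := 0.012) (by norm_num)
    (hf s le_rfl) (c := c) (c' := fun t => p + 2 * q * ((t - s : ℝ) : ℂ)) (fun t _ => hder t) ?_ ?_
  · have conv : ∀ t ∈ Icc s (s + 1 / 32), ‖g t / f t - c t‖ ≤ 0.012 := by
      intro t ht
      have hft := hf t ht.1
      have := key t ht
      have e : g t / f t - c t = (g t - c t * f t) / f t := by field_simp
      rw [e, norm_div, div_le_iff₀ (norm_pos_iff.2 hft)]
      exact this
    refine ⟨fun t ht => ?_, ?_⟩
    · have hv := conv t ht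
      have h1 := (abs_le.1 ((Complex.abs_re_le_norm _).trans hv))
      have h2 := (abs_le.1 ((Complex.abs_im_le_norm _).trans hv))
      rw [Complex.sub_re, hcre] at h1
      rw [Complex.sub_im, hcim] at h2
      have cx := chord_bound hqx bqx ht
      have cy := chord_bound hqy bqy ht
      refine ⟨?_, ?_, ?_, ?_⟩ <;> linarith [h1.1, h1.2, h2.1, h2.2, cx.1, cx.2, cy.1, cy.2]
    · have hv := conv (s + 1 / 32) ⟨by linarith, le_rfl⟩
      have e : c (s + 1 / 32) = ⟨x', y'⟩ := by
        apply Complex.ext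
        · rw [hcre]; simp only; rw [hqx]; ring
        · rw [hcim]; simp only; rw [hqy]; ring
      rwa [e] at hv
  · have hfs := hf s le_rfl
    have e : g s - c s * f s = (g s / f s - z) * f s := by rw [hcs]; field_simp
    rw [e, norm_mul]
    gcongr
  · intro t ht
    have ht' : t ∈ Icc s (s + 1 / 32) := Ico_subset_Icc_self ht
    have cx := (chord_bound hqx bqx ht').1
    obtain ⟨w, hw⟩ : ∃ w, w = t - s := ⟨_, rfl⟩
    have hw0 : 0 ≤ w := by linarith [ht.1]
    have hw1 : w ≤ 1 / 32 := by linarith [ht.2]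
    have htw : t = s + w := by linarith
    have eqn : ((0 : ℝ) : ℂ) + t * Complex.I - c t ^ 2 - (p + 2 * q * ((t - s : ℝ) : ℂ))
        = (Complex.I - 2 * z * p - 2 * q) * (w : ℂ) - (p ^ 2 + 2 * z * q) * ((w ^ 2 : ℝ) : ℂ)
          - 2 * p * q * ((w ^ 3 : ℝ) : ℂ) - q ^ 2 * ((w ^ 4 : ℝ) : ℂ) := by
      simp only [hc, ← hw]
      rw [htw]
      have : z ^ 2 = s * Complex.I - p := by rw [hpz]; ring
      push_cast
      linear_combination (-1 : ℂ) * this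
    rw [eqn]
    have hres := quadratic_residual_bound hz hp hq bpx bpy bqx bqy b1x b1y b2x b2y hw0 hw1
    have hcr : 0.392 ≤ (c t).re := by
      rw [hcre]
      have : 0.39215 ≤ min x x' := le_min (by linarith) (by linarith)
      linarith
    refine hres.trans_lt ?_
    norm_num
    linarith

/-! ### The enclosure of the reference solution on the whole line -/

/-- Two-term asymptotics of the recessive logarithmic derivative as `s → -∞`, for `D = 0`. -/
noncomputable def asymMinus (s : ℝ) : ℂ := (√(-s / 2) : ℂ) * (1 - Complex.I) - ((1 / (4 * s) : ℝ) : ℂ)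

/-- Two-term asymptotics of the dominant logarithmic derivative as `s → ∞`, for `D = 0`. -/
noncomputable def asymPlus (s : ℝ) : ℂ := (√(s / 2) : ℂ) * (1 + Complex.I) - ((1 / (4 * s) : ℝ) : ℂ)

lemma asymMinus_re (s : ℝ) : (asymMinus s).re = √(-s / 2) - 1 / (4 * s) := by
  simp [asymMinus]

lemma asymMinus_im (s : ℝ) : (asymMinus s).im = -√(-s / 2) := by
  simp only [asymMinus, Complex.sub_im, Complex.ofReal_im, Complex.mul_im, Complex.ofReal_re]
  simp

lemma asymPlus_re (s : ℝ) : (asymPlus s).re = √(s / 2) - 1 / (4 * s) := by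
  simp [asymPlus]

lemma asymPlus_im (s : ℝ) : (asymPlus s).im = √(s / 2) := by
  simp only [asymPlus, Complex.sub_im, Complex.ofReal_im, Complex.mul_im, Complex.ofReal_re]
  simp

lemma hasDerivAt_inv_four_mul {s : ℝ} (hs : s ≠ 0) :
    HasDerivAt (fun s : ℝ => 1 / (4 * s)) (-(1 / (4 * s ^ 2))) s := by
  have := (hasDerivAt_inv hs).const_mul (1 / 4 : ℝ)
  refine (this.congr_of_eventuallyEq (Filter.Eventually.of_forall fun t => ?_)).congr_deriv ?_
  · simp only [one_div, mul_inv]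
  · field_simp

lemma hasDerivAt_asymMinus {s : ℝ} (hs : s < 0) :
    HasDerivAt asymMinus (((-1 / (4 * √(-s / 2)) : ℝ) : ℂ) * (1 - Complex.I)
      + ((1 / (4 * s ^ 2) : ℝ) : ℂ)) s := by
  have h1 : HasDerivAt (fun s : ℝ => √(-s / 2)) (-1 / (4 * √(-s / 2))) s := by
    have h0 : HasDerivAt (fun s : ℝ => -s / 2) (-1 / 2) s := (hasDerivAt_neg s).div_const 2
    refine (h0.sqrt (by linarith)).congr_deriv ?_
    field_simp; norm_num
  have h2 := (hasDerivAt_inv_four_mul hs.ne).ofReal_comp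
  refine ((h1.ofReal_comp.mul_const (1 - Complex.I)).sub h2).congr_deriv ?_
  push_cast; ring

lemma hasDerivAt_asymPlus {s : ℝ} (hs : 0 < s) :
    HasDerivAt asymPlus (((1 / (4 * √(s / 2)) : ℝ) : ℂ) * (1 + Complex.I)
      + ((1 / (4 * s ^ 2) : ℝ) : ℂ)) s := by
  have h1 : HasDerivAt (fun s : ℝ => √(s / 2)) (1 / (4 * √(s / 2))) s := by
    have h0 : HasDerivAt (fun s : ℝ => s / 2) (1 / 2) s := (hasDerivAt_id s).div_const 2
    refine (h0.sqrt (by positivity)).congr_deriv ?_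
    field_simp; norm_num
  have h2 := (hasDerivAt_inv_four_mul hs.ne').ofReal_comp
  refine ((h1.ofReal_comp.mul_const (1 + Complex.I)).sub h2).congr_deriv ?_
  push_cast; ring

/-- The defect of the asymptotics in the Riccati equation `v' = i s - v²`. -/
lemma asymMinus_residual {s : ℝ} (hs : s < 0) :
    ((0 : ℝ) : ℂ) + s * Complex.I - asymMinus s ^ 2
      - (((-1 / (4 * √(-s / 2)) : ℝ) : ℂ) * (1 - Complex.I) + ((1 / (4 * s ^ 2) : ℝ) : ℂ))
      = ((-(5 / (16 * s ^ 2)) : ℝ) : ℂ) := by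
  obtain ⟨σ, hσ⟩ : ∃ σ, σ = √(-s / 2) := ⟨_, rfl⟩
  have hpos : 0 < σ := hσ ▸ Real.sqrt_pos.2 (by linarith)
  have hs2 : s = -2 * σ ^ 2 := by rw [hσ, Real.sq_sqrt (by linarith)]; ring
  have hσc : (σ : ℂ) ≠ 0 := by exact_mod_cast hpos.ne'
  rw [asymMinus, ← hσ, hs2]
  have hI : Complex.I ^ 2 = -1 := Complex.I_sq
  push_cast
  field_simp
  ring_nf
  simp only [hI]
  ring

/-- The defect of the asymptotics in the Riccati equation `v' = i s - v²`. -/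
lemma asymPlus_residual {s : ℝ} (hs : 0 < s) :
    ((0 : ℝ) : ℂ) + s * Complex.I - asymPlus s ^ 2
      - (((1 / (4 * √(s / 2)) : ℝ) : ℂ) * (1 + Complex.I) + ((1 / (4 * s ^ 2) : ℝ) : ℂ))
      = ((-(5 / (16 * s ^ 2)) : ℝ) : ℂ) := by
  obtain ⟨σ, hσ⟩ : ∃ σ, σ = √(s / 2) := ⟨_, rfl⟩
  have hpos : 0 < σ := hσ ▸ Real.sqrt_pos.2 (by linarith)
  have hs2 : s = 2 * σ ^ 2 := by rw [hσ, Real.sq_sqrt (by linarith)]; ring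
  have hσc : (σ : ℂ) ≠ 0 := by exact_mod_cast hpos.ne'
  rw [asymPlus, ← hσ, hs2]
  have hI : Complex.I ^ 2 = -1 := Complex.I_sq
  push_cast
  field_simp
  ring_nf
  simp only [hI]
  ring

lemma residual_small {s : ℝ} (hs : 4 ≤ |s|) : ‖((-(5 / (16 * s ^ 2)) : ℝ) : ℂ)‖ ≤ 0.01954 := by
  rw [Complex.norm_real, norm_neg, Real.norm_of_nonneg (by positivity), div_le_iff₀]
  · have : 4 ^ 2 ≤ s ^ 2 := by rw [← sq_abs s]; gcongr
    linarith
  · have : s ≠ 0 := by rintro rfl; norm_num at hs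
    positivity

lemma sqrt_two_bounds : 1.4142 ≤ √(2 : ℝ) ∧ √(2 : ℝ) ≤ 1.41422 := by
  constructor
  · exact Real.le_sqrt_of_sq_le (by norm_num)
  · exact Real.sqrt_le_iff.2 ⟨by norm_num, by norm_num⟩

lemma sqrt_half_ge {s : ℝ} (hs : 4 ≤ s) : 1.4142 ≤ √(s / 2) :=
  sqrt_two_bounds.1.trans (Real.sqrt_le_sqrt (by linarith))

/-- Real part of the tabulated value at the `i`-th node. -/
noncomputable def nodeX (i : ℕ) : ℝ := (refX i : ℝ) / 100000

/-- Imaginary part of the tabulated value at the `i`-th node. -/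
noncomputable def nodeY (i : ℕ) : ℝ := (refY i : ℝ) / 100000

/-- Position of the `i`-th node. -/
noncomputable def nodeS (i : ℕ) : ℝ := -4 + (i : ℝ) / 32

lemma abs_cast_le {z : ℤ} {n d : ℕ} (h : |z| ≤ n) (hd : 0 < d) : |(z : ℝ) / d| ≤ (n : ℝ) / d := by
  rw [abs_div, abs_of_nonneg (Nat.cast_nonneg d : (0 : ℝ) ≤ d)]
  have : (|z| : ℝ) ≤ n := by exact_mod_cast h
  gcongr

/-- Enclosure of the logarithmic derivative of the solution of `f'' = i s f` which starts on its left
asymptotics at `-R`: by the asymptotics outside `[-4, 4]` and by the table inside. The finite starting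
point `-R` replaces the recessive solution, all bounds being independent of `R`. -/
structure RefEnclosure (f g : ℝ → ℂ) (R : ℝ) : Prop where
  pair : IsLayerPair 0 f g
  ne_zero : ∀ s, -R ≤ s → f s ≠ 0
  init : f (-R) = 1 ∧ g (-R) = asymMinus (-R)
  left : ∀ s ∈ Icc (-R) (-4), ‖g s / f s - asymMinus s‖ ≤ 0.0072
  mid : ∀ i < 256, ∀ s ∈ Icc (nodeS i) (nodeS (i + 1)),
    min (nodeX i) (nodeX (i + 1)) - 0.01215 ≤ (g s / f s).re ∧
    (g s / f s).re ≤ max (nodeX i) (nodeX (i + 1)) + 0.01215 ∧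
    min (nodeY i) (nodeY (i + 1)) - 0.01215 ≤ (g s / f s).im ∧
    (g s / f s).im ≤ max (nodeY i) (nodeY (i + 1)) + 0.01215
  right : ∀ s, 4 ≤ s → ‖g s / f s - asymPlus s‖ ≤ 0.02

lemma norm_div_sub_le_iff {f g c : ℂ} {r : ℝ} (hf : f ≠ 0) :
    ‖g / f - c‖ ≤ r ↔ ‖g - c * f‖ ≤ r * ‖f‖ := by
  have e : g / f - c = (g - c * f) / f := by field_simp
  rw [e, norm_div, div_le_iff₀ (norm_pos_iff.2 hf)]

lemma reference_step {f g : ℝ → ℂ} (h : IsLayerPair 0 f g) {i : ℕ} (hi : i < 256)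
    (hf : ∀ t, nodeS i ≤ t → f t ≠ 0)
    (hs : ‖g (nodeS i) / f (nodeS i) - ⟨nodeX i, nodeY i⟩‖ ≤ 0.012) :
    (∀ s ∈ Icc (nodeS i) (nodeS (i + 1)),
      min (nodeX i) (nodeX (i + 1)) - 0.01215 ≤ (g s / f s).re ∧
      (g s / f s).re ≤ max (nodeX i) (nodeX (i + 1)) + 0.01215 ∧
      min (nodeY i) (nodeY (i + 1)) - 0.01215 ≤ (g s / f s).im ∧
      (g s / f s).im ≤ max (nodeY i) (nodeY (i + 1)) + 0.01215) ∧
    ‖g (nodeS (i + 1)) / f (nodeS (i + 1)) - ⟨nodeX (i + 1), nodeY (i + 1)⟩‖ ≤ 0.012 := by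
  obtain ⟨hc, hx, hx', -, -⟩ := reference_cells i hi
  have hl := amLevel_ge i
  simp only [cellOK, defectOK, Bool.and_eq_true, decide_eq_true_eq] at hc
  obtain ⟨⟨⟨⟨⟨⟨⟨c1, c2⟩, c3⟩, c4⟩, c5⟩, c6⟩, c7⟩, c8⟩ := hc
  have hx1 : (39215 : ℝ) ≤ refX i := by exact_mod_cast (by omega : (39215 : ℤ) ≤ refX i)
  have hx2 : (39215 : ℝ) ≤ refX (i + 1) := by
    exact_mod_cast (by omega : (39215 : ℤ) ≤ refX (i + 1))
  have hnS : nodeS (i + 1) = nodeS i + 1 / 32 := by simp only [nodeS]; push_cast; ring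
  have d10 : (0 : ℕ) < 10 ^ 10 := by norm_num
  have d15 : (0 : ℕ) < 10 ^ 15 := by norm_num
  have d20 : (0 : ℕ) < 10 ^ 20 := by norm_num
  have c1' := abs_cast_le (n := 10 ^ 10) (by exact_mod_cast c1) d10
  have c2' := abs_cast_le (n := 10 ^ 10) (by exact_mod_cast c2) d10
  have c3' := abs_cast_le (n := 6 * 10 ^ 9) (by exact_mod_cast c3) d10
  have c4' := abs_cast_le (n := 6 * 10 ^ 9) (by exact_mod_cast c4) d10
  have c5' := abs_cast_le (n := 45 * 10 ^ 12) (by exact_mod_cast c5) d15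
  have c6' := abs_cast_le (n := 45 * 10 ^ 12) (by exact_mod_cast c6) d15
  have c7' := abs_cast_le (n := 15 * 10 ^ 19) (by exact_mod_cast c7) d20
  have c8' := abs_cast_le (n := 15 * 10 ^ 19) (by exact_mod_cast c8) d20
  simp only [slopeX, slopeY, curv] at c1' c2' c3' c4' c5' c6' c7' c8'
  rw [hnS]
  refine h.cell_step (am := 0.38) hf rfl rfl rfl rfl (c1'.trans' (le_of_eq ?_) |>.trans (by norm_num))
    (c2'.trans' (le_of_eq ?_) |>.trans (by norm_num)) (c3'.trans' (le_of_eq ?_) |>.trans (by norm_num))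
    (c4'.trans' (le_of_eq ?_) |>.trans (by norm_num)) (c5'.trans' (le_of_eq ?_) |>.trans (by norm_num))
    (c6'.trans' (le_of_eq ?_) |>.trans (by norm_num)) (c7'.trans' (le_of_eq ?_) |>.trans (by norm_num))
    (c8'.trans' (le_of_eq ?_) |>.trans (by norm_num)) le_rfl ?_ ?_ hs
  · congr 1; simp only [nodeX, nodeY]; push_cast; ring
  · congr 1; simp only [nodeX, nodeY, nodeS]; push_cast; ring
  · congr 1; simp only [nodeX, nodeY]; push_cast; ring
  · congr 1; simp only [nodeX, nodeY, nodeS]; push_cast; ring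
  · congr 1; simp only [nodeX, nodeY, nodeS]; push_cast; ring
  · congr 1; simp only [nodeX, nodeY, nodeS]; push_cast; ring
  · congr 1; simp only [nodeX, nodeY, nodeS]; push_cast; ring
  · congr 1; simp only [nodeX, nodeY, nodeS]; push_cast; ring
  · simp only [nodeX]; rw [le_div_iff₀ (by norm_num)]; linarith
  · simp only [nodeX]; rw [le_div_iff₀ (by norm_num)]; linarith

lemma refTable_ends : refX 0 = 147338 ∧ refY 0 = -141692 ∧ refX 256 = 134765 ∧
    refY 256 = 141684 := by
  decide +kernel

theorem exists_reference (R : ℝ) (hR : 4 ≤ R) : ∃ f g : ℝ → ℂ, RefEnclosure f g R := by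
  obtain ⟨f, g, h, hf0, hg0⟩ := exists_layerPair 0 (-R) 1 (asymMinus (-R))
  have hne : ∀ s, -R ≤ s → f s ≠ 0 := fun s hs =>
    (h.nonzero_of_re_pos le_rfl (s₀ := -R) (by
        rw [hf0, hg0, map_one, one_mul, asymMinus_re]
        have : 0 ≤ √(-(-R) / 2) := Real.sqrt_nonneg _
        have : 0 < 1 / (4 * R) := by positivity
        have e : 1 / (4 * -R) = -(1 / (4 * R)) := by rw [mul_neg, one_div_neg_eq_neg_one_div]
        rw [e]; linarith)
      (by
        rw [hf0, hg0, map_one, one_mul, asymMinus_re]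
        have : 0 ≤ √(-(-R) / 2) := Real.sqrt_nonneg _
        have : 0 < 1 / (4 * R) := by positivity
        have e : 1 / (4 * -R) = -(1 / (4 * R)) := by rw [mul_neg, one_div_neg_eq_neg_one_div]
        rw [e, Real.sqrt_zero, zero_mul]; linarith) hs).1
  have left : ∀ s ∈ Icc (-R) (-4), ‖g s / f s - asymMinus s‖ ≤ 0.0072 := by
    intro s hs
    rw [norm_div_sub_le_iff (hne s hs.1)]
    refine h.disc_barrier_self (by norm_num) (hne (-R) le_rfl) (c := asymMinus)
      (fun t ht => hasDerivAt_asymMinus (by linarith [ht.2])) ?_ ?_ s hs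
    · rw [hf0, hg0]; simp; norm_num
    · intro t ht
      rw [asymMinus_residual (by linarith [ht.2])]
      refine (residual_small (by rw [abs_of_neg (by linarith [ht.2])]; linarith [ht.2])).trans_lt ?_
      rw [asymMinus_re]
      have h1 := sqrt_half_ge (s := -t) (by linarith [ht.2])
      have h2 : 1 / (4 * t) < 0 := one_div_neg.2 (by linarith [ht.2])
      generalize √(-t / 2) = w at *
      generalize 1 / (4 * t) = w' at *
      norm_num at h1 ⊢; linarith
  have nodes : ∀ i ≤ 256, ‖g (nodeS i) / f (nodeS i) - ⟨nodeX i, nodeY i⟩‖ ≤ 0.012 := by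
    intro i
    induction i with
    | zero =>
      intro _
      have e : nodeS 0 = -4 := by simp [nodeS]
      rw [e]
      have h1 := left (-4) ⟨by linarith, le_rfl⟩
      have h2 : ‖asymMinus (-4) - ⟨nodeX 0, nodeY 0⟩‖ ≤ 0.0045 := by
        refine abs_le_of_sq_le_sq' ?_ (by norm_num) |>.2
        rw [← Complex.normSq_eq_norm_sq, Complex.normSq_apply, Complex.sub_re, Complex.sub_im,
          asymMinus_re, asymMinus_im]
        have hx : nodeX 0 = 1.47338 := by rw [nodeX, refTable_ends.1]; norm_num
        have hy : nodeY 0 = -1.41692 := by rw [nodeY, refTable_ends.2.1]; norm_num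
        have e2 : (-(-4 : ℝ) / 2) = 2 := by norm_num
        rw [e2]; simp only [hx, hy]
        obtain ⟨b1, b2⟩ := sqrt_two_bounds
        norm_num at b1 b2 ⊢
        nlinarith
      have := norm_add_le (g (-4) / f (-4) - asymMinus (-4)) (asymMinus (-4) - ⟨nodeX 0, nodeY 0⟩)
      rw [sub_add_sub_cancel] at this
      linarith
    | succ i ih =>
      intro hi
      refine (reference_step h (by omega) (fun t ht => hne t ?_) (ih (by omega))).2
      have : -4 ≤ nodeS i := by simp [nodeS]; positivity
      linarith
  refine ⟨f, g, h, hne, ⟨hf0, hg0⟩, left, ?_, ?_⟩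
  · intro i hi
    refine (reference_step h hi (fun t ht => hne t ?_) (nodes i hi.le)).1
    have : -4 ≤ nodeS i := by simp [nodeS]; positivity
    linarith
  · intro s hs
    rw [norm_div_sub_le_iff (hne s (by linarith))]
    refine h.disc_barrier_self (a := 4) (b := s) (by norm_num) (hne 4 (by linarith)) (c := asymPlus)
      (fun t ht => hasDerivAt_asymPlus (by linarith [ht.1])) ?_ ?_ s ⟨hs, le_rfl⟩
    · rw [← norm_div_sub_le_iff (hne 4 (by linarith))]
      have h1 := nodes 256 le_rfl
      have e : nodeS 256 = 4 := by norm_num [nodeS]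
      rw [e] at h1
      have h2 : ‖(⟨nodeX 256, nodeY 256⟩ : ℂ) - asymPlus 4‖ ≤ 0.0045 + 0.0030 := by
        have hx : nodeX 256 = 1.34765 := by rw [nodeX, refTable_ends.2.2.1]; norm_num
        have hy : nodeY 256 = 1.41684 := by rw [nodeY, refTable_ends.2.2.2]; norm_num
        have e2 : ((4 : ℝ) / 2) = 2 := by norm_num
        obtain ⟨b1, b2⟩ := sqrt_two_bounds
        apply norm_le_of_abs
        · rw [Complex.sub_re, asymPlus_re, e2, abs_le]
          simp only [hx]
          norm_num at b1 b2 ⊢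
          constructor <;> linarith
        · rw [Complex.sub_im, asymPlus_im, e2, abs_le]
          simp only [hy]
          norm_num at b1 b2 ⊢
          constructor <;> linarith
      have := norm_add_le (g 4 / f 4 - ⟨nodeX 256, nodeY 256⟩) (⟨nodeX 256, nodeY 256⟩ - asymPlus 4)
      rw [sub_add_sub_cancel] at this
      linarith
    · intro t ht
      rw [asymPlus_residual (by linarith [ht.1])]
      refine (residual_small (by rw [abs_of_pos (by linarith [ht.1])]; linarith [ht.1])).trans_lt ?_
      rw [asymPlus_re]
      have h1 := sqrt_half_ge (s := t) ht.1
      have h2 : 1 / (4 * t) ≤ 1 / 16 := one_div_le_one_div_of_le (by norm_num) (by linarith [ht.1])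
      linarith

/-! ### Comparison of the layer with the reference -/

/-- Bound for the distance of the logarithmic derivatives for `D = κ² - a` and `D = 0`, as long as
the real part of the latter is at least `α`. -/
noncomputable def deviation (α κ : ℝ) : ℝ := κ ^ 2 / (α + κ) + 0.001

lemma exists_cell {s : ℝ} (hs : -4 ≤ s) : ∀ n : ℕ, 0 < n → s ≤ nodeS n →
    ∃ i < n, s ∈ Icc (nodeS i) (nodeS (i + 1)) := by
  intro n
  induction n with
  | zero => intro h; omega
  | succ n ih =>
    intro _ hsn
    rcases Nat.eq_zero_or_pos n with rfl | hn
    · exact ⟨0, by omega, by simpa [nodeS] using hs, hsn⟩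
    · rcases le_or_gt s (nodeS n) with h | h
      · obtain ⟨i, hi, h⟩ := ih hn h
        exact ⟨i, by omega, h⟩
      · exact ⟨n, by omega, h.le, hsn⟩

lemma node_ge {i : ℕ} (hi : i < 256) :
    (amLevel i : ℝ) / 100 + 0.01215 ≤ min (nodeX i) (nodeX (i + 1)) := by
  obtain ⟨-, hx, hx', -, -⟩ := reference_cells i hi
  have h1 : (1000 : ℝ) * amLevel i + 1215 ≤ refX i := by exact_mod_cast hx
  have h2 : (1000 : ℝ) * amLevel i + 1215 ≤ refX (i + 1) := by exact_mod_cast hx'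
  refine le_min ?_ ?_ <;> simp only [nodeX] <;> rw [le_div_iff₀ (by norm_num)] <;> linarith

lemma RefEnclosure.re_mid_ge {f g : ℝ → ℂ} {R : ℝ} (h : RefEnclosure f g R) {i : ℕ} (hi : i < 256)
    {s : ℝ} (hs : s ∈ Icc (nodeS i) (nodeS (i + 1))) : (amLevel i : ℝ) / 100 ≤ (g s / f s).re := by
  have h1 := (h.mid i hi s hs).1
  have h2 := node_ge hi
  linarith

lemma RefEnclosure.re_mid_le {f g : ℝ → ℂ} {R : ℝ} (h : RefEnclosure f g R) {i : ℕ} (hi : i < 256)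
    {s : ℝ} (hs : s ∈ Icc (nodeS i) (nodeS (i + 1))) : (g s / f s).re ≤ 1.52 := by
  have h1 := (h.mid i hi s hs).2.1
  obtain ⟨-, -, -, hx, hx'⟩ := reference_cells i hi
  have h3 : (refX i : ℝ) ≤ 150000 := by exact_mod_cast hx
  have h4 : (refX (i + 1) : ℝ) ≤ 150000 := by exact_mod_cast hx'
  have h5 : max (nodeX i) (nodeX (i + 1)) ≤ 1.5 := by
    refine max_le ?_ ?_ <;> simp only [nodeX] <;> rw [div_le_iff₀ (by norm_num)] <;> linarith
  linarith

lemma RefEnclosure.left_bounds {f g : ℝ → ℂ} {R : ℝ} (h : RefEnclosure f g R) {s : ℝ}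
    (hs : s ∈ Icc (-R) (-4)) :
    √(-s / 2) - 0.0072 ≤ (g s / f s).re ∧ (g s / f s).re ≤ √(-s / 2) + 0.0697 ∧
      |(g s / f s).im + √(-s / 2)| ≤ 0.0072 := by
  have h0 := h.left s hs
  have h1 := abs_le.1 ((Complex.abs_re_le_norm _).trans h0)
  have h2 := abs_le.1 ((Complex.abs_im_le_norm _).trans h0)
  rw [Complex.sub_re, asymMinus_re] at h1
  rw [Complex.sub_im, asymMinus_im] at h2
  have h3 : -(1 / 16) ≤ 1 / (4 * s) ∧ 1 / (4 * s) < 0 := by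
    refine ⟨?_, one_div_neg.2 (by linarith [hs.2])⟩
    have e : 1 / (4 * s) = -(1 / (4 * -s)) := by rw [mul_neg, one_div_neg_eq_neg_one_div, neg_neg]
    rw [e]
    exact neg_le_neg (one_div_le_one_div_of_le (by norm_num) (by linarith [hs.2]))
  refine ⟨by linarith [h1.1], by linarith [h1.2], abs_le.2 ⟨by linarith [h2.1], by linarith [h2.2]⟩⟩

lemma RefEnclosure.right_bounds {f g : ℝ → ℂ} {R : ℝ} (h : RefEnclosure f g R) {s : ℝ}
    (hs : 4 ≤ s) :
    √(s / 2) - 0.0825 ≤ (g s / f s).re ∧ (g s / f s).re ≤ √(s / 2) + 0.02 ∧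
      |(g s / f s).im - √(s / 2)| ≤ 0.02 := by
  have h0 := h.right s hs
  have h1 := abs_le.1 ((Complex.abs_re_le_norm _).trans h0)
  have h2 := abs_le.1 ((Complex.abs_im_le_norm _).trans h0)
  rw [Complex.sub_re, asymPlus_re] at h1
  rw [Complex.sub_im, asymPlus_im] at h2
  have h3 : 1 / (4 * s) ≤ 1 / 16 := one_div_le_one_div_of_le (by norm_num) (by linarith)
  have h4 : 0 < 1 / (4 * s) := by positivity
  refine ⟨by linarith [h1.1], by linarith [h1.2], abs_le.2 ⟨by linarith [h2.1], by linarith [h2.2]⟩⟩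

lemma amLevel_antitone {i n : ℕ} (h : i ≤ n) : amLevel n ≤ amLevel i := by
  unfold amLevel; split_ifs <;> omega

lemma RefEnclosure.re_ge_of_le_node {f g : ℝ → ℂ} {R : ℝ} (h : RefEnclosure f g R) {n : ℕ}
    (hn : n < 256) {s : ℝ} (hs : -R ≤ s) (hsn : s ≤ nodeS (n + 1)) :
    (amLevel n : ℝ) / 100 ≤ (g s / f s).re := by
  rcases le_or_gt s (-4) with h4 | h4
  · have h1 := (h.left_bounds ⟨hs, h4⟩).1
    have h2 := sqrt_half_ge (s := -s) (by linarith)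
    have h3 : (amLevel n : ℝ) ≤ 86 := by
      have : amLevel n ≤ 86 := by unfold amLevel; split_ifs <;> norm_num
      exact_mod_cast this
    linarith
  · obtain ⟨i, hi, hc⟩ := exists_cell h4.le (n + 1) (by omega) hsn
    have h1 := h.re_mid_ge (by omega) hc
    have h2 : (amLevel n : ℝ) ≤ amLevel i := by exact_mod_cast amLevel_antitone (by omega)
    linarith

lemma RefEnclosure.re_ge {f g : ℝ → ℂ} {R : ℝ} (h : RefEnclosure f g R) {s : ℝ} (hs : -R ≤ s) :
    0.38 ≤ (g s / f s).re := by
  rcases le_or_gt s 4 with h4 | h4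
  · have e : nodeS (255 + 1) = 4 := by norm_num [nodeS]
    have := h.re_ge_of_le_node (n := 255) (by norm_num) hs (e ▸ h4)
    norm_num [amLevel] at this ⊢
    linarith
  · have h1 := (h.right_bounds h4.le).1
    have h2 := sqrt_half_ge h4.le
    linarith

lemma IsLayerPair.hasDerivAt_div {D : ℝ} {f g : ℝ → ℂ} (h : IsLayerPair D f g) {s : ℝ}
    (hs : f s ≠ 0) :
    HasDerivAt (fun s => g s / f s) ((D : ℂ) + s * Complex.I - (g s / f s) ^ 2) s := by
  refine ((h.2 s).div (h.1 s) hs).congr_deriv ?_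
  field_simp

lemma deviation_pos {α κ : ℝ} (hα : 0 < α) (hκ : 0 ≤ κ) : 0.001 ≤ deviation α κ := by
  unfold deviation
  have : 0 ≤ κ ^ 2 / (α + κ) := by positivity
  linarith

/-- The difference `D = κ² - a` of the two Riccati equations is absorbed by the damping, which is at
least `x + √D` when the real parts of the two solutions are at least `x` and `√D`. -/
lemma discrepancy_lt {α κ a x : ℝ} (hα : 0 < α) (hκ : 0 ≤ κ) (ha : 0 ≤ a) (hD : 0 ≤ κ ^ 2 - a)
    (hx : α ≤ x) : κ ^ 2 - a < deviation α κ * (x + √(κ ^ 2 - a)) := by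
  obtain ⟨w, hw⟩ : ∃ w, w = √(κ ^ 2 - a) := ⟨_, rfl⟩
  have hw0 : 0 ≤ w := hw ▸ Real.sqrt_nonneg _
  have hw2 : w ^ 2 = κ ^ 2 - a := by rw [hw, Real.sq_sqrt hD]
  have hwκ : w ≤ κ := abs_le_of_sq_le_sq' (by linarith) hκ |>.2
  rw [← hw, ← hw2]
  have h1 : w ^ 2 ≤ κ ^ 2 / (α + κ) * (α + w) := by
    rw [div_mul_eq_mul_div, le_div_iff₀ (by positivity)]
    nlinarith [mul_nonneg hw0 hκ, mul_nonneg (mul_nonneg hw0 hκ) (sub_nonneg.2 hwκ),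
      mul_nonneg hα.le (sub_nonneg.2 (pow_le_pow_left₀ hw0 hwκ 2))]
  have h0 : 0 ≤ κ ^ 2 / (α + κ) := by positivity
  calc w ^ 2 ≤ κ ^ 2 / (α + κ) * (α + w) := h1
    _ < deviation α κ * (α + w) := by
        unfold deviation
        have : 0 < α + w := by positivity
        nlinarith
    _ ≤ _ := by
        have := deviation_pos hα hκ
        gcongr

/-- For `D < 0` only the real part `x` of the reference provides damping, but `|D| ≤ a` is tiny. -/
lemma discrepancy_lt_of_neg {α κ a x : ℝ} (hα : 0.38 ≤ α) (hκ : 0 ≤ κ) (ha : a ≤ 0.0005)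
    (hD : κ ^ 2 - a < 0) (hx : α ≤ x) :
    |κ ^ 2 - a| < deviation α κ * (2 * x - deviation α κ) ∧ deviation α κ ≤ 0.0024 := by
  have h0 := deviation_pos (by linarith : 0 < α) hκ
  have h1 : deviation α κ ≤ 0.0024 := by
    unfold deviation
    have : κ ^ 2 / (α + κ) ≤ 0.0014 := by
      rw [div_le_iff₀ (by linarith)]; nlinarith
    linarith
  refine ⟨?_, h1⟩
  rw [abs_of_neg hD]
  nlinarith [sq_nonneg κ]

/-- The layer solution for small `κ`, compared with the reference. -/
structure SmallLayer (κ a R : ℝ) (f₀ g₀ f g : ℝ → ℂ) : Prop where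
  ref : RefEnclosure f₀ g₀ R
  pair : IsLayerPair (κ ^ 2 - a) f g
  init : f (-R) = 1 ∧ g (-R) = asymMinus (-R)
  ne_zero : ∀ s, -R ≤ s → f s ≠ 0
  re_ge : ∀ s, -R ≤ s → √(κ ^ 2 - a) ≤ (g s / f s).re
  dev_node : ∀ n < 256, ∀ s, -R ≤ s → s ≤ nodeS (n + 1) →
    ‖g s / f s - g₀ s / f₀ s‖ ≤ deviation ((amLevel n : ℝ) / 100) κ
  dev : ∀ s, -R ≤ s → ‖g s / f s - g₀ s / f₀ s‖ ≤ deviation 0.38 κ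

lemma asymMinus_neg_re {R : ℝ} (hR : 4 ≤ R) : 1.4142 ≤ (asymMinus (-R)).re := by
  rw [asymMinus_re, neg_neg, mul_neg, one_div_neg_eq_neg_one_div]
  have := sqrt_half_ge hR
  have h : 0 < 1 / (4 * R) := by positivity
  linarith

lemma IsLayerPair.deviation_barrier {κ a R : ℝ} (hκ : 0 ≤ κ) (ha0 : 0 ≤ a)
    (ha : a ≤ 0.0005) {f₀ g₀ f g : ℝ → ℂ} (h₀ : RefEnclosure f₀ g₀ R)
    (h : IsLayerPair (κ ^ 2 - a) f g) (hf : f (-R) = 1) (hg : g (-R) = asymMinus (-R))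
    (hpos : 0 ≤ κ ^ 2 - a → ∀ s, -R ≤ s →
      √(κ ^ 2 - a) * ‖f s‖ ^ 2 ≤ ((starRingEnd ℂ) (f s) * g s).re)
    {α b : ℝ} (hα : 0.38 ≤ α) (hb : ∀ s ∈ Icc (-R) b, α ≤ (g₀ s / f₀ s).re) :
    ∀ s ∈ Icc (-R) b, ‖g s - g₀ s / f₀ s * f s‖ ≤ deviation α κ * ‖f s‖ := by
  have hd := deviation_pos (by linarith : 0 < α) hκ
  have hα' : 0 < α := by linarith
  have hres : ∀ s : ℝ, ((κ ^ 2 - a : ℝ) : ℂ) + s * Complex.I - (g₀ s / f₀ s) ^ 2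
      - (((0 : ℝ) : ℂ) + s * Complex.I - (g₀ s / f₀ s) ^ 2) = ((κ ^ 2 - a : ℝ) : ℂ) := by
    intro s; push_cast; ring
  have hinit : ‖g (-R) - g₀ (-R) / f₀ (-R) * f (-R)‖ ≤ deviation α κ * ‖f (-R)‖ := by
    rw [hf, hg, h₀.init.1, h₀.init.2]; simp; linarith
  have hf1 : f (-R) ≠ 0 := by rw [hf]; exact one_ne_zero
  rcases le_or_gt 0 (κ ^ 2 - a) with hD | hD
  · refine h.disc_barrier (by linarith) hf1 (c := fun s => g₀ s / f₀ s)
      (k := fun _ => √(κ ^ 2 - a))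
      (fun s hs => h₀.pair.hasDerivAt_div (h₀.ne_zero s hs.1)) hinit
      (fun s hs _ => hpos hD s hs.1) ?_
    intro s hs
    rw [hres, Complex.norm_real, Real.norm_of_nonneg hD]
    exact discrepancy_lt hα' hκ ha0 hD (hb s (Ico_subset_Icc_self hs))
  · refine h.disc_barrier_self (by linarith) hf1 (c := fun s => g₀ s / f₀ s)
      (fun s hs => h₀.pair.hasDerivAt_div (h₀.ne_zero s hs.1)) hinit ?_
    intro s hs
    rw [hres, Complex.norm_real]
    exact (discrepancy_lt_of_neg hα hκ ha hD (hb s (Ico_subset_Icc_self hs))).1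

theorem exists_smallLayer {κ a R : ℝ} (hκ : 0 ≤ κ) (hκ1 : κ ≤ 0.65) (ha0 : 0 ≤ a)
    (ha : a ≤ 0.0005) (hR : 4 ≤ R) : ∃ f₀ g₀ f g, SmallLayer κ a R f₀ g₀ f g := by
  obtain ⟨f₀, g₀, h₀⟩ := exists_reference R hR
  obtain ⟨f, g, h, hf, hg⟩ := exists_layerPair (κ ^ 2 - a) (-R) 1 (asymMinus (-R))
  have hre := asymMinus_neg_re hR
  have hsq : √(κ ^ 2 - a) ≤ 0.65 := by
    rw [Real.sqrt_le_left (by norm_num)]; nlinarith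
  have hpos : 0 ≤ κ ^ 2 - a → ∀ s, -R ≤ s →
      f s ≠ 0 ∧ √(κ ^ 2 - a) * ‖f s‖ ^ 2 ≤ ((starRingEnd ℂ) (f s) * g s).re := by
    intro hD s hs
    refine h.nonzero_of_re_pos hD (s₀ := -R) ?_ ?_ hs
    · rw [hf, hg, map_one, one_mul]; linarith
    · rw [hf, hg, map_one, one_mul, norm_one]; linarith
  have hbar := fun (α b : ℝ) => IsLayerPair.deviation_barrier (α := α) (b := b) hκ ha0 ha h₀ h hf hg
    (fun hD s hs => (hpos hD s hs).2)
  have hall : ∀ s, -R ≤ s → ‖g s - g₀ s / f₀ s * f s‖ ≤ deviation 0.38 κ * ‖f s‖ := fun s hs =>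
    hbar 0.38 s le_rfl (fun t ht => h₀.re_ge ht.1) s ⟨hs, le_rfl⟩
  have hne : ∀ s, -R ≤ s → f s ≠ 0 := by
    intro s hs h0
    have := hall s hs
    rw [h0, mul_zero, sub_zero, norm_zero, mul_zero] at this
    exact h.ne_zero (s₀ := -R) (by rw [hf]; exact one_ne_zero) h0 (norm_le_zero_iff.1 this)
  refine ⟨f₀, g₀, f, g, h₀, h, ⟨hf, hg⟩, hne, ?_, ?_, ?_⟩
  · intro s hs
    rcases le_or_gt 0 (κ ^ 2 - a) with hD | hD
    · have h1 := (hpos hD s hs).2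
      have h2 : 0 < ‖f s‖ ^ 2 := by have := norm_pos_iff.2 (hne s hs); positivity
      have e : (g s / f s).re = ((starRingEnd ℂ) (f s) * g s).re / ‖f s‖ ^ 2 := by
        rw [Complex.div_re, ← Complex.normSq_eq_norm_sq]; simp; ring
      rw [e, le_div_iff₀ h2]; exact h1
    · rw [Real.sqrt_eq_zero_of_nonpos hD.le]
      have h1 := (norm_div_sub_le_iff (hne s hs)).2 (hall s hs)
      have h2 := (abs_le.1 ((Complex.abs_re_le_norm _).trans h1)).1
      have h3 := (discrepancy_lt_of_neg le_rfl hκ ha hD (h₀.re_ge hs)).2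
      have h4 := h₀.re_ge hs
      rw [Complex.sub_re] at h2
      linarith
  · intro n hn s hs hsn
    rw [norm_div_sub_le_iff (hne s hs)]
    refine hbar _ (nodeS (n + 1)) ?_ (fun t ht => h₀.re_ge_of_le_node hn ht.1 ht.2) s ⟨hs, hsn⟩
    have : (38 : ℝ) ≤ amLevel n := by exact_mod_cast amLevel_ge n
    linarith
  · intro s hs
    rw [norm_div_sub_le_iff (hne s hs)]
    exact hall s hs

/-! ### The weighted integral of the layer: the tilted barrier -/

/-- `G s = exp (-κ (s - s₀)) x + ∫ exp (-κ (s - t)) f t`, an exponentially weighted integral of `f`. -/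
lemma exists_damped_primitive {f : ℝ → ℂ} (hf : Continuous f) (κ s₀ : ℝ) (x : ℂ) :
    ∃ G : ℝ → ℂ, G s₀ = x ∧ ∀ s, HasDerivAt G (f s - κ * G s) s := by
  refine ⟨fun s => Complex.exp (-(κ * s : ℝ)) *
    (Complex.exp ((κ * s₀ : ℝ)) * x + ∫ t in s₀..s, Complex.exp ((κ * t : ℝ)) * f t), ?_, ?_⟩
  · simp only [intervalIntegral.integral_same, add_zero]
    rw [← mul_assoc, ← Complex.exp_add]; simp
  · intro s
    have h1 : HasDerivAt (fun s : ℝ => Complex.exp (-(κ * s : ℝ)))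
        (Complex.exp (-(κ * s : ℝ)) * (-κ)) s := by
      have h0 : HasDerivAt (fun s : ℝ => (-((κ * s : ℝ) : ℂ))) (-κ) s := by
        exact (((hasDerivAt_id s).const_mul κ).ofReal_comp).neg.congr_deriv (by simp)
      exact h0.cexp
    have hc : Continuous fun t : ℝ => Complex.exp ((κ * t : ℝ)) * f t := by fun_prop
    have h2 := (hc.integral_hasStrictDerivAt s₀ s).hasDerivAt
    refine (h1.mul (h2.const_add (Complex.exp ((κ * s₀ : ℝ)) * x))).congr_deriv ?_
    have e : Complex.exp (-(κ * s : ℝ)) * (Complex.exp ((κ * s : ℝ)) * f s) = f s := by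
      rw [← mul_assoc, ← Complex.exp_add]; simp
    linear_combination e

/-- A positive definite quadratic form in the real and imaginary part. -/
lemma quadratic_pos {e P n₁ n₂ : ℝ} (hP : 0 < P) (h : n₁ ^ 2 + n₂ ^ 2 < 4 * P * e) (x y : ℝ) :
    0 < e + n₁ * x + n₂ * y + P * (x ^ 2 + y ^ 2) := by
  have : 0 < 4 * P * (e + n₁ * x + n₂ * y + P * (x ^ 2 + y ^ 2)) := by
    nlinarith [sq_nonneg (2 * P * x + n₁), sq_nonneg (2 * P * y + n₂)]
  exact pos_of_mul_pos_right this (by positivity)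

/-- The lens `δ ≤ Re ((1 + iτ) m) - β |m|²` is forward invariant for `m' = 1 - V m`. -/
lemma tilted_barrier {m V : ℝ → ℂ} {τ τ' β β' δ δ' : ℝ → ℝ} {a b : ℝ}
    (hm : ∀ s ∈ Icc a b, HasDerivAt m (1 - V s * m s) s)
    (hτ : ∀ s ∈ Icc a b, HasDerivAt τ (τ' s) s) (hβ : ∀ s ∈ Icc a b, HasDerivAt β (β' s) s)
    (hδ : ∀ s ∈ Icc a b, HasDerivAt δ (δ' s) s)
    (ha : δ a ≤ (m a).re - τ a * (m a).im - β a * ‖m a‖ ^ 2)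
    (hP : ∀ s ∈ Ico a b, 0 < β s * (V s).re - β' s)
    (hc : ∀ s ∈ Ico a b, ((V s).im * τ s - 2 * β s) ^ 2 + (τ' s - (V s).im) ^ 2
      < 4 * (β s * (V s).re - β' s) * (1 - (V s).re * δ s - δ' s)) :
    ∀ s ∈ Icc a b, δ s ≤ (m s).re - τ s * (m s).im - β s * ‖m s‖ ^ 2 := by
  have hre : ∀ s ∈ Icc a b, HasDerivAt (fun s => (m s).re) (1 - V s * m s).re s := fun s hs =>
    Complex.reCLM.hasFDerivAt.comp_hasDerivAt s (hm s hs)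
  have him : ∀ s ∈ Icc a b, HasDerivAt (fun s => (m s).im) (1 - V s * m s).im s := fun s hs =>
    Complex.imCLM.hasFDerivAt.comp_hasDerivAt s (hm s hs)
  have hn : ∀ z : ℂ, ‖z‖ ^ 2 = z.re ^ 2 + z.im ^ 2 := fun z => by
    rw [← Complex.normSq_eq_norm_sq, Complex.normSq_apply]; ring
  have key := nonneg_of_barrier
    (φ := fun s => (m s).re - τ s * (m s).im - β s * ((m s).re ^ 2 + (m s).im ^ 2) - δ s)
    (fun s hs => (((hre s hs).sub ((hτ s hs).mul (him s hs))).sub ((hβ s hs).mul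
      (((hre s hs).pow 2).add ((him s hs).pow 2)))).sub (hδ s hs)) (by rw [hn] at ha; linarith) ?_
  · intro s hs
    have := key s hs
    rw [hn]; linarith
  · intro s hs h0
    have hq := quadratic_pos (hP s hs) (n₁ := (V s).im * τ s - 2 * β s)
      (n₂ := (V s).im - τ' s) (e := 1 - (V s).re * δ s - δ' s)
      (by have := hc s hs; nlinarith) (m s).re (m s).im
    simp only [Complex.sub_re, Complex.sub_im, Complex.mul_re, Complex.mul_im, Complex.one_re,
      Complex.one_im, Nat.cast_ofNat, pow_one, Nat.add_one_sub_one]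
    have hδ0 : δ s = (m s).re - τ s * (m s).im - β s * ((m s).re ^ 2 + (m s).im ^ 2) := by
      linarith
    rw [hδ0] at hq
    refine hq.trans_le (le_of_eq ?_)
    norm_num
    ring

lemma norm_ge_of_tilted {z : ℂ} {τ β δ : ℝ} (hβ : 0 ≤ β)
    (h : δ ≤ z.re - τ * z.im - β * ‖z‖ ^ 2) : δ ≤ (1 + |τ|) * ‖z‖ := by
  have h1 := Complex.re_le_norm z
  have h2 : -(τ * z.im) ≤ |τ| * ‖z‖ := by
    refine (neg_le_abs _).trans ?_
    rw [abs_mul]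
    exact mul_le_mul_of_nonneg_left (Complex.abs_im_le_norm z) (abs_nonneg _)
  have h3 : 0 ≤ β * ‖z‖ ^ 2 := by positivity
  linarith

lemma quadratic_pos_of_ends {c l k x₀ x₁ x : ℝ} (hk : 0 ≤ k) (h0 : 0 < c + l * x₀ - k * x₀ ^ 2)
    (h1 : 0 < c + l * x₁ - k * x₁ ^ 2) (hx : x ∈ Icc x₀ x₁) : 0 < c + l * x - k * x ^ 2 := by
  rcases eq_or_lt_of_le (hx.1.trans hx.2) with he | hlt
  · have : x = x₀ := le_antisymm (he ▸ hx.2) hx.1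
    rw [this]; exact h0
  · obtain ⟨θ, hθ⟩ : ∃ θ, θ = (x - x₀) / (x₁ - x₀) := ⟨_, rfl⟩
    have hd : 0 < x₁ - x₀ := by linarith
    have t0 : 0 ≤ θ := hθ ▸ div_nonneg (by linarith [hx.1]) hd.le
    have t1 : θ ≤ 1 := by rw [hθ, div_le_one hd]; linarith [hx.2]
    have hxe : x = (1 - θ) * x₀ + θ * x₁ := by rw [hθ]; field_simp; ring
    have e : c + l * x - k * x ^ 2 = (1 - θ) * (c + l * x₀ - k * x₀ ^ 2)
        + θ * (c + l * x₁ - k * x₁ ^ 2) + k * (θ * (1 - θ)) * (x₁ - x₀) ^ 2 := by rw [hxe]; ring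
    have h3 : 0 ≤ k * (θ * (1 - θ)) * (x₁ - x₀) ^ 2 := by
      have := mul_nonneg t0 (sub_nonneg.2 t1); positivity
    rcases eq_or_lt_of_le t0 with ht | ht
    · rw [e, ← ht]; rw [← ht] at h3; linarith
    · have := mul_nonneg (sub_nonneg.2 t1) h0.le
      have := mul_pos ht h1
      rw [e]; linarith

/-- The barrier condition is concave in each of `τ`, `β`, `B`, and increasing in `A`, so it needs to
be checked at the vertices of a box only. -/
lemma barrier_condition_of_vertices {A₀ τ₀ τ₁ β₀ β₁ B₀ B₁ dτ dβ : ℝ}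
    (h : ∀ τ ∈ ({τ₀, τ₁} : Set ℝ), ∀ β ∈ ({β₀, β₁} : Set ℝ), ∀ B ∈ ({B₀, B₁} : Set ℝ),
      (B * τ - 2 * β) ^ 2 + (dτ - B) ^ 2 < 3.96 * (β * A₀ - dβ))
    {A τ β B : ℝ} (hA : A₀ ≤ A) (hτ : τ ∈ Icc τ₀ τ₁) (hβ0 : 0 ≤ β₀) (hβ : β ∈ Icc β₀ β₁)
    (hB : B ∈ Icc B₀ B₁) : (B * τ - 2 * β) ^ 2 + (dτ - B) ^ 2 < 3.96 * (β * A - dβ) := by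
  have s1 : ∀ τ ∈ ({τ₀, τ₁} : Set ℝ), ∀ β ∈ ({β₀, β₁} : Set ℝ),
      (B * τ - 2 * β) ^ 2 + (dτ - B) ^ 2 < 3.96 * (β * A₀ - dβ) := by
    intro τ hτ β hβ
    have h0 := h τ hτ β hβ B₀ (by simp)
    have h1 := h τ hτ β hβ B₁ (by simp)
    have := quadratic_pos_of_ends (c := 3.96 * (β * A₀ - dβ) - 4 * β ^ 2 - dτ ^ 2)
      (l := 4 * τ * β + 2 * dτ) (k := τ ^ 2 + 1) (by positivity) (by linarith) (by linarith) hB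
    linarith
  have s2 : ∀ τ ∈ ({τ₀, τ₁} : Set ℝ),
      (B * τ - 2 * β) ^ 2 + (dτ - B) ^ 2 < 3.96 * (β * A₀ - dβ) := by
    intro τ hτ
    have h0 := s1 τ hτ β₀ (by simp)
    have h1 := s1 τ hτ β₁ (by simp)
    have := quadratic_pos_of_ends (c := -3.96 * dβ - (B * τ) ^ 2 - (dτ - B) ^ 2)
      (l := 4 * B * τ + 3.96 * A₀) (k := 4) (by norm_num) (by linarith) (by linarith) hβ
    linarith
  have h0 := s2 τ₀ (by simp)
  have h1 := s2 τ₁ (by simp)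
  have := quadratic_pos_of_ends (c := 3.96 * (β * A₀ - dβ) - 4 * β ^ 2 - (dτ - B) ^ 2)
      (l := 4 * B * β) (k := B ^ 2) (by positivity) (by linarith) (by linarith) hτ
  have h2 : β * A₀ ≤ β * A := mul_le_mul_of_nonneg_left hA (hβ0.trans hβ.1)
  linarith

/-- The tilt `τ` of the lens on `[-4, 4]` is piecewise linear with the knots `-4 + j / 4`, each
interval consisting of eight cells of the table; its values are given in tenths. -/
def tauKnot (j : ℕ) : ℤ :=
  [-3, -3, -3, -3, -3, -3, -3, -3, -3, -3, -3, -3, -3, -3, -3, -3, -3, -3, -3, -3, -2, -1, 0, 1, 2,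
    3, 5, 7, 8, 9, 10, 10, 10].getD j 0

/-- The curvature `β` of the lens is `β₀ + 0.3 κ`, up to rounding of `κ`, with `β₀` linear between the
knots `-4 + j / 4`. This is `100 β₀` to the right of the `j`-th knot. -/
def betaLeft (j : ℕ) : ℤ :=
  if j < 12 then 50 else if j < 25 then 28 else [28, 32, 38, 42, 48, 56, 60].getD (j - 25) 0

/-- The value of `100 β₀` to the left of the knot `j + 1`. At a knot `β₀` may jump down, which enlarges
the lens. -/
def betaRight (j : ℕ) : ℤ :=
  if j < 12 then 50 else if j < 25 then 28 else [32, 38, 42, 48, 56, 60, 66].getD (j - 25) 0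

/-- The barrier condition of `tilted_barrier` with `V = A + i B`, where `A`, `B`, `τ = t`, `β = b` are
in units of `10⁻⁵` and `τ' = 0.4 dt`, `β' = 0.04 db`. The factor `3.96 = 4 · 0.99` leaves room for
`δ = 0.001`. -/
def vertexOK (A b t B dt db : ℤ) : Bool :=
  decide (100 * ((B * t - 200000 * b) ^ 2 + (100000 * (40000 * dt - B)) ^ 2)
    < 3960000000000 * (b * A - 400000000 * db))

/-- The barrier condition on one cell of the table at the vertices of the boxes that contain `τ`, `β` and
`V = v + κ`, for `k1 / 100 ≤ κ ≤ k2 / 100`. Here `al / 100` is a damping rate for the comparison with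
the reference, whose real part is at least `a` and whose imaginary part lies in `[bl, bh]`. Since `v`
deviates from the reference by `deviation (al / 100) κ`, the quantity `dd` bounds the deviation from
above, and `inc` bounds `κ` minus the deviation from below. For `κ ≥ 0.3` the bound
`Re v ≥ √(κ² - a)` is used as well. -/
def kappaOK (al a bl bh t b dt db k1 k2 : ℤ) : Bool :=
  let inc := 1000 * al * k1 / (al + k1) - 100
  let dd := 1000 * k2 ^ 2 / (al + k2) + 101
  let A := max (a + inc) (if 30 ≤ k1 then 2000 * k1 - 200 else 0)
  let t' := t + 1250 * dt
  let b := b + 300 * k1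
  let b' := b + 125 * db
  vertexOK A b t (bl - dd) dt db && vertexOK A b t (bh + dd) dt db &&
  (dt == 0 || (vertexOK A b t' (bl - dd) dt db && vertexOK A b t' (bh + dd) dt db)) &&
  (db == 0 || (vertexOK A b' t (bl - dd) dt db && vertexOK A b' t (bh + dd) dt db)) &&
  (dt == 0 || db == 0 || (vertexOK A b' t' (bl - dd) dt db && vertexOK A b' t' (bh + dd) dt db))

/-- Increment of the tilt over the interval of eight cells that contains the cell `i`, in tenths. -/
def dTau (i : ℕ) : ℤ := tauKnot (i / 8 + 1) - tauKnot (i / 8)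

/-- Increment of `β₀` over the interval of eight cells that contains the cell `i`, in hundredths. -/
def dBeta (i : ℕ) : ℤ := betaRight (i / 8) - betaLeft (i / 8)

/-- The tilt at the left end of the cell `i`, in units of `10⁻⁵`. -/
def tauNode (i : ℕ) : ℤ := 10000 * tauKnot (i / 8) + 1250 * dTau i * (i % 8 : ℕ)

/-- The value of `β₀` at the left end of the cell `i`, in units of `10⁻⁵`. -/
def betaNode (i : ℕ) : ℤ := 1000 * betaLeft (i / 8) + 125 * dBeta i * (i % 8 : ℕ)

/-- The barrier condition on the cell `i` for all `κ ∈ [0, 0.65]`, split into eight intervals; the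
values of the reference are widened by its error bound `0.01215`. -/
def psiCell (i : ℕ) (x y x' y' : ℤ) : Bool :=
  let t := tauNode i
  let b := betaNode i
  let ch := fun k1 k2 => kappaOK (amLevel i) (min x x' - 1215) (min y y' - 1215)
    (max y y' + 1215) t b (dTau i) (dBeta i) k1 k2
  ch 0 5 && ch 5 10 && ch 10 15 && ch 15 20 && ch 20 30 && ch 30 40 && ch 40 50 && ch 50 65

/-- `psiCell` for all cells of a table whose first node has the index `i`; the recursion along the list
avoids repeated access by index. -/
def psiRun : ℕ → List (ℤ × ℤ) → Bool
  | i, p :: q :: l => psiCell i p.1 p.2 q.1 q.2 && psiRun (i + 1) (q :: l)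
  | _, _ => true

set_option maxRecDepth 10000 in
lemma psiRun_refTable : psiRun 0 refTable = true := by decide +kernel

lemma psiCell_of_run : ∀ (l : List (ℤ × ℤ)) (i₀ : ℕ), psiRun i₀ l = true → ∀ i, i + 1 < l.length →
    psiCell (i₀ + i) (l.getD i (0, 0)).1 (l.getD i (0, 0)).2 (l.getD (i + 1) (0, 0)).1
      (l.getD (i + 1) (0, 0)).2 = true
  | [], _, _, i, hi => by simp at hi
  | [_], _, _, i, hi => by simp at hi
  | p :: q :: l, i₀, h, i, hi => by
    simp only [psiRun, Bool.and_eq_true] at h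
    rcases i with _ | i
    · simpa using h.1
    · have := psiCell_of_run (q :: l) (i₀ + 1) h.2 i (by simpa using hi)
      have e : i₀ + (i + 1) = i₀ + 1 + i := by ring
      rw [e]
      simpa using this

lemma refTable_length : refTable.length = 257 := by decide +kernel

lemma psiCell_true {i : ℕ} (hi : i < 256) :
    psiCell i (refX i) (refY i) (refX (i + 1)) (refY (i + 1)) = true := by
  have := psiCell_of_run refTable 0 psiRun_refTable i (by rw [refTable_length]; omega)
  simpa [refX, refY] using this

lemma vertexOK_cast {A b t B dt db : ℤ} (h : vertexOK A b t B dt db = true) :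
    ((B : ℝ) / 100000 * (t / 100000) - 2 * (b / 100000)) ^ 2 + (0.4 * dt - B / 100000) ^ 2
      < 3.96 * (b / 100000 * (A / 100000) - 0.04 * db) := by
  simp only [vertexOK, decide_eq_true_eq] at h
  have h' : (100 : ℝ) * ((B * t - 200000 * b) ^ 2 + (100000 * (40000 * dt - B)) ^ 2)
    < 3960000000000 * (b * A - 400000000 * db) := by exact_mod_cast h
  have e1 : ((B : ℝ) / 100000 * (t / 100000) - 2 * (b / 100000)) ^ 2 + (0.4 * dt - B / 100000) ^ 2
    = (100 * ((B * t - 200000 * b) ^ 2 + (100000 * (40000 * dt - B)) ^ 2)) / 10 ^ 22 := by ring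
  have e2 : (3.96 : ℝ) * (b / 100000 * (A / 100000) - 0.04 * db)
    = 3960000000000 * (b * A - 400000000 * db) / 10 ^ 22 := by ring
  rw [e1, e2]
  gcongr

lemma schedule_facts : ∀ i < 256, 0 ≤ dTau i ∧ 0 ≤ dBeta i ∧ 0 ≤ betaNode i ∧
    (i < 255 → tauNode (i + 1) = tauNode i + 1250 * dTau i ∧
      betaNode (i + 1) ≤ betaNode i + 125 * dBeta i) := by
  decide +kernel

lemma schedule_ends : tauNode 0 = -30000 ∧ betaNode 0 = 50000 ∧
    tauNode 255 + 1250 * dTau 255 = 100000 ∧ betaNode 255 + 125 * dBeta 255 = 66000 := by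
  decide +kernel

/-- A subinterval `[k₁, k₂] / 100` of the range of `κ` on which the table has been verified. -/
def KappaInterval (k₁ k₂ : ℤ) : Prop :=
  0 ≤ k₁ ∧ k₁ ≤ k₂ ∧ 20 * k₂ ≤ 30 * k₁ + 230 ∧ ∀ i < 256, kappaOK (amLevel i)
    (min (refX i) (refX (i + 1)) - 1215) (min (refY i) (refY (i + 1)) - 1215)
    (max (refY i) (refY (i + 1)) + 1215) (tauNode i) (betaNode i) (dTau i) (dBeta i) k₁ k₂ = true

lemma exists_kappaInterval {κ : ℝ} (h0 : 0 ≤ κ) (h1 : κ ≤ 0.65) :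
    ∃ k₁ k₂ : ℤ, KappaInterval k₁ k₂ ∧ (k₁ : ℝ) / 100 ≤ κ ∧ κ ≤ (k₂ : ℝ) / 100 := by
  have hc := fun i (hi : i < 256) => psiCell_true hi
  simp only [psiCell, Bool.and_eq_true] at hc
  rcases le_total κ 0.05 with h | h
  · exact ⟨0, 5, ⟨by norm_num, by norm_num, by norm_num, fun i hi => (hc i hi).1.1.1.1.1.1.1⟩,
      by norm_num; linarith, by norm_num at h ⊢; linarith⟩
  rcases le_total κ 0.1 with h' | h'
  · exact ⟨5, 10, ⟨by norm_num, by norm_num, by norm_num, fun i hi => (hc i hi).1.1.1.1.1.1.2⟩,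
      by norm_num at h ⊢; linarith, by norm_num at h' ⊢; linarith⟩
  clear h
  rcases le_total κ 0.15 with h | h
  · exact ⟨10, 15, ⟨by norm_num, by norm_num, by norm_num, fun i hi => (hc i hi).1.1.1.1.1.2⟩,
      by norm_num at h' ⊢; linarith, by norm_num at h ⊢; linarith⟩
  clear h'
  rcases le_total κ 0.2 with h' | h'
  · exact ⟨15, 20, ⟨by norm_num, by norm_num, by norm_num, fun i hi => (hc i hi).1.1.1.1.2⟩,
      by norm_num at h ⊢; linarith, by norm_num at h' ⊢; linarith⟩
  clear h
  rcases le_total κ 0.3 with h | h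
  · exact ⟨20, 30, ⟨by norm_num, by norm_num, by norm_num, fun i hi => (hc i hi).1.1.1.2⟩,
      by norm_num at h' ⊢; linarith, by norm_num at h ⊢; linarith⟩
  clear h'
  rcases le_total κ 0.4 with h' | h'
  · exact ⟨30, 40, ⟨by norm_num, by norm_num, by norm_num, fun i hi => (hc i hi).1.1.2⟩,
      by norm_num at h ⊢; linarith, by norm_num at h' ⊢; linarith⟩
  clear h
  rcases le_total κ 0.5 with h | h
  · exact ⟨40, 50, ⟨by norm_num, by norm_num, by norm_num, fun i hi => (hc i hi).1.2⟩,
      by norm_num at h' ⊢; linarith, by norm_num at h ⊢; linarith⟩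
  · exact ⟨50, 65, ⟨by norm_num, by norm_num, by norm_num, fun i hi => (hc i hi).2⟩,
      by norm_num at h ⊢; linarith, by norm_num at h1 ⊢; linarith⟩

lemma deviation_le_of_kappa {al k₂ : ℤ} (hal : 0 < al) {κ : ℝ} (hκ : 0 ≤ κ)
    (h2 : κ ≤ (k₂ : ℝ) / 100) :
    deviation ((al : ℝ) / 100) κ ≤ ((1000 * k₂ ^ 2 / (al + k₂) + 101 : ℤ) : ℝ) / 100000 := by
  have hk0 : (0 : ℝ) ≤ k₂ := by linarith
  have hk0' : 0 ≤ k₂ := by exact_mod_cast hk0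
  have hal' : (0 : ℝ) < al := by exact_mod_cast hal
  have hq : 1000 * k₂ ^ 2 < (1000 * k₂ ^ 2 / (al + k₂) + 1) * (al + k₂) :=
    Int.lt_ediv_add_one_mul_self _ (by omega)
  obtain ⟨q, hqe⟩ : ∃ q, q = 1000 * k₂ ^ 2 / (al + k₂) := ⟨_, rfl⟩
  rw [← hqe] at hq ⊢
  have hq' : (1000 : ℝ) * k₂ ^ 2 < (q + 1) * (al + k₂) := by exact_mod_cast hq
  obtain ⟨w, hw⟩ : ∃ w : ℝ, w = k₂ / 100 := ⟨_, rfl⟩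
  have hw' : (k₂ : ℝ) = 100 * w := by rw [hw]; ring
  obtain ⟨α, hα⟩ : ∃ w : ℝ, w = al / 100 := ⟨_, rfl⟩
  have hα' : (al : ℝ) = 100 * α := by rw [hα]; ring
  rw [← hw] at h2
  rw [hw', hα'] at hq'
  have hα0 : 0 < α := by rw [hα]; positivity
  have h1 : κ ^ 2 / (α + κ) ≤ ((q : ℝ) + 1) / 100000 := by
    have h3 : κ ^ 2 / (α + κ) ≤ w ^ 2 / (α + w) := by
      rw [div_le_div_iff₀ (by linarith) (by linarith)]
      nlinarith [mul_nonneg hκ (sub_nonneg.2 h2), mul_nonneg (mul_nonneg hκ (hκ.trans h2))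
        (sub_nonneg.2 h2), mul_nonneg hα0.le (sub_nonneg.2 (pow_le_pow_left₀ hκ h2 2))]
    refine h3.trans ?_
    rw [div_le_div_iff₀ (by linarith) (by norm_num)]
    nlinarith
  unfold deviation
  rw [← hα]
  push_cast
  linarith

lemma kappa_sub_deviation_ge {al k₁ : ℤ} (hal : 0 < al) (hk : 0 ≤ k₁) {κ : ℝ}
    (h2 : (k₁ : ℝ) / 100 ≤ κ) :
    ((1000 * al * k₁ / (al + k₁) - 100 : ℤ) : ℝ) / 100000 ≤ κ - deviation ((al : ℝ) / 100) κ := by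
  have hk0 : (0 : ℝ) ≤ k₁ := by exact_mod_cast hk
  have hal' : (0 : ℝ) < al := by exact_mod_cast hal
  have hq : 1000 * al * k₁ / (al + k₁) * (al + k₁) ≤ 1000 * al * k₁ :=
    Int.ediv_mul_le _ (by omega)
  obtain ⟨q, hqe⟩ : ∃ q, q = 1000 * al * k₁ / (al + k₁) := ⟨_, rfl⟩
  rw [← hqe] at hq ⊢
  have hq' : (q : ℝ) * (al + k₁) ≤ 1000 * al * k₁ := by exact_mod_cast hq
  obtain ⟨w, hw⟩ : ∃ w : ℝ, w = k₁ / 100 := ⟨_, rfl⟩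
  have hw' : (k₁ : ℝ) = 100 * w := by rw [hw]; ring
  obtain ⟨α, hα⟩ : ∃ w : ℝ, w = al / 100 := ⟨_, rfl⟩
  have hα' : (al : ℝ) = 100 * α := by rw [hα]; ring
  rw [← hw] at h2
  rw [hw', hα'] at hq'
  have hα0 : 0 < α := by rw [hα]; positivity
  have hw0 : 0 ≤ w := by rw [hw]; positivity
  have h1 : (q : ℝ) / 100000 ≤ κ - κ ^ 2 / (α + κ) := by
    have e : κ - κ ^ 2 / (α + κ) = α * κ / (α + κ) := by
      have : α + κ ≠ 0 := by linarith
      field_simp; ring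
    have h3 : α * w / (α + w) ≤ α * κ / (α + κ) := by
      rw [div_le_div_iff₀ (by linarith) (by linarith)]
      nlinarith [mul_nonneg (mul_nonneg hα0.le hα0.le) (sub_nonneg.2 h2)]
    rw [e]
    refine le_trans ?_ h3
    rw [div_le_div_iff₀ (by norm_num) (by linarith)]
    nlinarith
  unfold deviation
  rw [← hα]
  push_cast
  linarith

lemma sqrt_discrepancy_ge {κ a : ℝ} (ha : a ≤ 0.0005) (hκ : 0.3 ≤ κ) :
    κ - 0.002 ≤ √(κ ^ 2 - a) := by
  apply Real.le_sqrt_of_sq_le; nlinarith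

/-- The barrier condition on the `i`-th cell. -/
lemma SmallLayer.cell_condition {κ a R : ℝ} {f₀ g₀ f g : ℝ → ℂ} (h : SmallLayer κ a R f₀ g₀ f g)
    (hκ : 0 ≤ κ) (ha : a ≤ 0.0005) (hR : 4 ≤ R) {k₁ k₂ : ℤ} (hk : KappaInterval k₁ k₂)
    (h1 : (k₁ : ℝ) / 100 ≤ κ) (h2 : κ ≤ (k₂ : ℝ) / 100) {i : ℕ} (hi : i < 256) {s : ℝ}
    (hs : s ∈ Icc (nodeS i) (nodeS (i + 1))) {τ β : ℝ}
    (hτ : τ ∈ Icc ((tauNode i : ℝ) / 100000) ((tauNode i + 1250 * dTau i : ℤ) / 100000 : ℝ))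
    (hβ : β ∈ Icc ((betaNode i + 300 * k₁ : ℤ) / 100000 : ℝ)
      ((betaNode i + 300 * k₁ + 125 * dBeta i : ℤ) / 100000 : ℝ)) :
    ((g s / f s).im * τ - 2 * β) ^ 2 + (0.4 * dTau i - (g s / f s).im) ^ 2
      < 3.96 * (β * ((g s / f s).re + κ) - 0.04 * dBeta i) := by
  obtain ⟨hk0, hk12, -, hok⟩ := hk
  have hok := hok i hi
  have hal := amLevel_ge i
  have hsR : -R ≤ s := by
    have : -4 ≤ nodeS i := by simp [nodeS]; positivity
    linarith [hs.1]
  obtain ⟨mx, -, my, my'⟩ := h.ref.mid i hi s hs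
  have hd := h.dev_node i hi s hsR hs.2
  have d1 := abs_le.1 ((Complex.abs_re_le_norm _).trans hd)
  have d2 := abs_le.1 ((Complex.abs_im_le_norm _).trans hd)
  rw [Complex.sub_re] at d1
  rw [Complex.sub_im] at d2
  have e1 := deviation_le_of_kappa (al := amLevel i) (by omega) hκ h2
  have e2 := kappa_sub_deviation_ge (al := amLevel i) (by omega) hk0 h1
  have hre := h.re_ge s hsR
  simp only [kappaOK, Bool.and_eq_true, Bool.or_eq_true, beq_iff_eq] at hok
  obtain ⟨⟨⟨⟨v1, v2⟩, v3⟩, v4⟩, v5⟩ := hok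
  obtain ⟨dd, hdd⟩ : ∃ dd, dd = 1000 * k₂ ^ 2 / (amLevel i + k₂) + 101 := ⟨_, rfl⟩
  obtain ⟨inc, hinc⟩ : ∃ dd, dd = 1000 * amLevel i * k₁ / (amLevel i + k₁) - 100 := ⟨_, rfl⟩
  obtain ⟨A₀, hA₀⟩ : ∃ A₀, A₀ = max (min (refX i) (refX (i + 1)) - 1215 + inc)
    (if 30 ≤ k₁ then 2000 * k₁ - 200 else 0) := ⟨_, rfl⟩
  rw [← hinc, ← hdd, ← hA₀] at v1 v2 v3 v4 v5
  rw [← hdd] at e1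
  rw [← hinc] at e2
  have hmin : ∀ x y : ℤ, ((min x y : ℤ) : ℝ) / 100000 = min ((x : ℝ) / 100000) (y / 100000) := by
    intro x y; rw [Int.cast_min, min_div_div_right (by norm_num)]
  have hmax : ∀ x y : ℤ, ((max x y : ℤ) : ℝ) / 100000 = max ((x : ℝ) / 100000) (y / 100000) := by
    intro x y; rw [Int.cast_max, max_div_div_right (by norm_num)]
  have hmx : min (nodeX i) (nodeX (i + 1)) = ((min (refX i) (refX (i + 1)) : ℤ) : ℝ) / 100000 :=
    (hmin _ _).symm
  have hmy : min (nodeY i) (nodeY (i + 1)) = ((min (refY i) (refY (i + 1)) : ℤ) : ℝ) / 100000 :=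
    (hmin _ _).symm
  have hmy' : max (nodeY i) (nodeY (i + 1)) = ((max (refY i) (refY (i + 1)) : ℤ) : ℝ) / 100000 :=
    (hmax _ _).symm
  rw [hmx] at mx
  rw [hmy] at my
  rw [hmy'] at my'
  obtain ⟨-, -, hb0, -⟩ := schedule_facts i hi
  refine barrier_condition_of_vertices (A₀ := (A₀ : ℝ) / 100000)
    (B₀ := ((min (refY i) (refY (i + 1)) - 1215 - dd : ℤ) : ℝ) / 100000)
    (B₁ := ((max (refY i) (refY (i + 1)) + 1215 + dd : ℤ) : ℝ) / 100000) ?_ ?_ hτ ?_ hβ ?_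
  · intro τ hτ β hβ B hB
    rcases hτ with rfl | rfl <;> rcases hβ with rfl | rfl <;> rcases hB with rfl | rfl
    · exact vertexOK_cast v1
    · exact vertexOK_cast v2
    · rcases v4 with h0 | v4
      · rw [show betaNode i + 300 * k₁ + 125 * dBeta i = betaNode i + 300 * k₁ by rw [h0]; ring]
        exact vertexOK_cast v1
      · exact vertexOK_cast v4.1
    · rcases v4 with h0 | v4
      · rw [show betaNode i + 300 * k₁ + 125 * dBeta i = betaNode i + 300 * k₁ by rw [h0]; ring]
        exact vertexOK_cast v2
      · exact vertexOK_cast v4.2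
    · rcases v3 with h0 | v3
      · rw [show tauNode i + 1250 * dTau i = tauNode i by rw [h0]; ring]
        exact vertexOK_cast v1
      · exact vertexOK_cast v3.1
    · rcases v3 with h0 | v3
      · rw [show tauNode i + 1250 * dTau i = tauNode i by rw [h0]; ring]
        exact vertexOK_cast v2
      · exact vertexOK_cast v3.2
    · rcases v5 with (h0 | h0) | v5
      · rw [show tauNode i + 1250 * dTau i = tauNode i by rw [h0]; ring]
        rcases v4 with h0 | v4
        · rw [show betaNode i + 300 * k₁ + 125 * dBeta i = betaNode i + 300 * k₁ by rw [h0]; ring]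
          exact vertexOK_cast v1
        · exact vertexOK_cast v4.1
      · rw [show betaNode i + 300 * k₁ + 125 * dBeta i = betaNode i + 300 * k₁ by rw [h0]; ring]
        rcases v3 with h0 | v3
        · rw [show tauNode i + 1250 * dTau i = tauNode i by rw [h0]; ring]
          exact vertexOK_cast v1
        · exact vertexOK_cast v3.1
      · exact vertexOK_cast v5.1
    · rcases v5 with (h0 | h0) | v5
      · rw [show tauNode i + 1250 * dTau i = tauNode i by rw [h0]; ring]
        rcases v4 with h0 | v4
        · rw [show betaNode i + 300 * k₁ + 125 * dBeta i = betaNode i + 300 * k₁ by rw [h0]; ring]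
          exact vertexOK_cast v2
        · exact vertexOK_cast v4.2
      · rw [show betaNode i + 300 * k₁ + 125 * dBeta i = betaNode i + 300 * k₁ by rw [h0]; ring]
        rcases v3 with h0 | v3
        · rw [show tauNode i + 1250 * dTau i = tauNode i by rw [h0]; ring]
          exact vertexOK_cast v2
        · exact vertexOK_cast v3.2
      · exact vertexOK_cast v5.2
  · rw [hA₀, hmax]
    refine max_le ?_ ?_
    · push_cast at e2 mx ⊢; linarith
    · split_ifs with h30
      · have h30' : (30 : ℝ) ≤ k₁ := by exact_mod_cast h30
        have := sqrt_discrepancy_ge ha (κ := κ) (by linarith)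
        push_cast; linarith
      · have := Real.sqrt_nonneg (κ ^ 2 - a)
        push_cast; linarith
  · have : 0 ≤ betaNode i + 300 * k₁ := by omega
    have : (0 : ℝ) ≤ (betaNode i + 300 * k₁ : ℤ) := by exact_mod_cast this
    positivity
  · constructor
    · push_cast at e1 my ⊢; linarith [d2.1]
    · push_cast at e1 my' ⊢; linarith [d2.2]

/-! ### The barrier condition far from the critical point -/

/-- The ratio `m = G / f` of the damped primitive of the layer to the layer itself. -/
structure IsWeightRatio (κ s₀ : ℝ) (f g m : ℝ → ℂ) : Prop where
  deriv : ∀ s, s₀ ≤ s → HasDerivAt m (1 - (g s / f s + κ) * m s) s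
  init : m s₀ = 1 / (g s₀ / f s₀ + κ)

/-- The lens condition of `tilted_barrier` at one point. -/
def InLens (τ β δ : ℝ) (z : ℂ) : Prop := δ ≤ z.re - τ * z.im - β * ‖z‖ ^ 2

lemma InLens.mono {τ β β' δ δ' : ℝ} {z : ℂ} (h : InLens τ β δ z) (hβ : β' ≤ β) (hδ : δ' ≤ δ) :
    InLens τ β' δ' z := by
  unfold InLens at *
  have : β' * ‖z‖ ^ 2 ≤ β * ‖z‖ ^ 2 := by gcongr
  linarith

lemma deviation_le_linear {α κ : ℝ} (hα : 0.38 ≤ α) (h0 : 0 ≤ κ) (h1 : κ ≤ 0.65) :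
    deviation α κ ≤ 0.65 / (α + 0.65) * κ + 0.001 := by
  unfold deviation
  have : κ ^ 2 / (α + κ) ≤ 0.65 / (α + 0.65) * κ := by
    rw [div_mul_eq_mul_div, div_le_div_iff₀ (by linarith) (by linarith)]
    nlinarith [mul_nonneg (mul_nonneg h0 (by linarith : (0:ℝ) ≤ α)) (sub_nonneg.2 h1)]
  linarith

section FarRegions

variable {κ a R : ℝ} {f₀ g₀ f g : ℝ → ℂ}

lemma SmallLayer.left_layer_bounds (h : SmallLayer κ a R f₀ g₀ f g) (hκ : 0 ≤ κ) (hκ1 : κ ≤ 0.65)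
    {s : ℝ} (hs : s ∈ Icc (-R) (-4)) :
    √(-s / 2) - 0.0082 + 0.56 * κ ≤ (g s / f s).re + κ ∧
    (g s / f s).re + κ ≤ √(-s / 2) + 0.08 + 1.44 * κ ∧
      |(g s / f s).im + √(-s / 2)| ≤ 0.0082 + 0.44 * κ := by
  obtain ⟨h1, h2, h3⟩ := h.ref.left_bounds hs
  have h4 := h.dev_node 0 (by norm_num) s hs.1 (hs.2.trans (by norm_num [nodeS]))
  have h5 := deviation_le_linear (α := (amLevel 0 : ℝ) / 100) (by norm_num [amLevel]) hκ hκ1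
  have h6 : (0.65 : ℝ) / ((amLevel 0 : ℝ) / 100 + 0.65) ≤ 0.44 := by norm_num [amLevel]
  have h7 : 0.65 / ((amLevel 0 : ℝ) / 100 + 0.65) * κ ≤ 0.44 * κ := by gcongr
  have h8 : ‖g s / f s - g₀ s / f₀ s‖ ≤ 0.44 * κ + 0.001 := by linarith
  have d1 := abs_le.1 ((Complex.abs_re_le_norm _).trans h8)
  have d2 := abs_le.1 ((Complex.abs_im_le_norm _).trans h8)
  rw [Complex.sub_re] at d1
  rw [Complex.sub_im] at d2
  have h9 := abs_le.1 h3
  refine ⟨by linarith [d1.1], by linarith [d1.2], abs_le.2 ⟨?_, ?_⟩⟩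
  · linarith [d2.1, h9.1]
  · linarith [d2.2, h9.2]

lemma SmallLayer.right_layer_bounds (h : SmallLayer κ a R f₀ g₀ f g) (hκ : 0 ≤ κ) (hκ1 : κ ≤ 0.65)
    (hR : 4 ≤ R) {s : ℝ} (hs : 4 ≤ s) :
    √(s / 2) - 0.0835 + 0.368 * κ ≤ (g s / f s).re + κ ∧
    (g s / f s).re + κ ≤ √(s / 2) + 0.021 + 1.632 * κ ∧
      |(g s / f s).im - √(s / 2)| ≤ 0.021 + 0.632 * κ := by
  obtain ⟨h1, h2, h3⟩ := h.ref.right_bounds hs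
  have h4 := h.dev s (by linarith)
  have h5 := deviation_le_linear (α := 0.38) le_rfl hκ hκ1
  have h6 : (0.65 : ℝ) / (0.38 + 0.65) ≤ 0.632 := by norm_num
  have h7 : 0.65 / (0.38 + 0.65) * κ ≤ 0.632 * κ := by gcongr
  have h8 : ‖g s / f s - g₀ s / f₀ s‖ ≤ 0.632 * κ + 0.001 := by linarith
  have d1 := abs_le.1 ((Complex.abs_re_le_norm _).trans h8)
  have d2 := abs_le.1 ((Complex.abs_im_le_norm _).trans h8)
  rw [Complex.sub_re] at d1
  rw [Complex.sub_im] at d2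
  have h9 := abs_le.1 h3
  refine ⟨by linarith [d1.1], by linarith [d1.2], abs_le.2 ⟨?_, ?_⟩⟩
  · linarith [d2.1, h9.1]
  · linarith [d2.2, h9.2]

end FarRegions

lemma hasDerivAt_sqrt_neg_half {s : ℝ} (hs : s < 0) :
    HasDerivAt (fun s : ℝ => √(-s / 2)) (-1 / (4 * √(-s / 2))) s := by
  have h0 : HasDerivAt (fun s : ℝ => -s / 2) (-1 / 2) s := (hasDerivAt_neg s).div_const 2
  refine (h0.sqrt (by linarith)).congr_deriv ?_
  field_simp; norm_num

lemma hasDerivAt_sqrt_half {s : ℝ} (hs : 0 < s) :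
    HasDerivAt (fun s : ℝ => √(s / 2)) (1 / (4 * √(s / 2))) s := by
  have h0 : HasDerivAt (fun s : ℝ => s / 2) (1 / 2) s := (hasDerivAt_id s).div_const 2
  refine (h0.sqrt (by positivity)).congr_deriv ?_
  field_simp; norm_num

/-- The barrier condition far to the left, with `τ = -0.3`, `β = σ / 2`, `σ = √(|s| / 2)`. -/
lemma left_condition {σ κ A B : ℝ} (hσ : 1.4142 ≤ σ) (hκ : 0 ≤ κ) (hκ1 : κ ≤ 0.65)
    (hA : σ - 0.0082 + 0.56 * κ ≤ A) (hA' : A ≤ σ + 0.08 + 1.44 * κ)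
    (hB : |B + σ| ≤ 0.0082 + 0.44 * κ) :
    0 < σ / 2 * A - -1 / (8 * σ) ∧
    (B * (-0.3) - 2 * (σ / 2)) ^ 2 + (0 - B) ^ 2
      < 4 * (σ / 2 * A - -1 / (8 * σ)) * (1 - A * (0.002 / σ) - 0.0005 / σ ^ 3) := by
  have hσ0 : 0 < σ := by linarith
  have hA0 : 0 < A := by linarith
  have h1 : 0 < 1 / (8 * σ) := by positivity
  have e1 : -1 / (8 * σ) = -(1 / (8 * σ)) := by ring
  have hP : σ / 2 * A ≤ σ / 2 * A - -1 / (8 * σ) := by rw [e1]; linarith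
  have hP0 : 0 < σ / 2 * A := by positivity
  refine ⟨by linarith, ?_⟩
  have he : 0.99 ≤ 1 - A * (0.002 / σ) - 0.0005 / σ ^ 3 := by
    have h2 : A * (0.002 / σ) ≤ 0.004 := by
      rw [← mul_div_assoc, div_le_iff₀ hσ0]; nlinarith
    have h3 : 0.0005 / σ ^ 3 ≤ 0.001 := by
      rw [div_le_iff₀ (by positivity)]
      have : (1 : ℝ) ≤ σ ^ 3 := one_le_pow₀ (by linarith)
      linarith
    linarith
  have h4 : (B * (-0.3) - 2 * (σ / 2)) ^ 2 + (0 - B) ^ 2 < 4 * (σ / 2 * A) * 0.99 := by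
    obtain ⟨θ, hθ⟩ : ∃ θ, θ = B + σ := ⟨_, rfl⟩
    rw [← hθ] at hB
    have hBe : B = θ - σ := by linarith
    have hb := abs_le.1 hB
    have hθ2 : θ ^ 2 ≤ (0.0082 + 0.44 * κ) ^ 2 := sq_le_sq' hb.1 hb.2
    have hAσ : σ * (σ - 0.0082 + 0.56 * κ) ≤ σ * A := mul_le_mul_of_nonneg_left hA hσ0.le
    have hlin : -(σ * (0.0082 + 0.44 * κ)) ≤ σ * θ := by nlinarith
    rw [hBe]
    nlinarith [mul_nonneg hκ (sub_nonneg.2 hκ1), mul_nonneg hκ hσ0.le]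
  calc _ < 4 * (σ / 2 * A) * 0.99 := h4
    _ ≤ _ := by
      have : 0 ≤ 4 * (σ / 2 * A - -1 / (8 * σ)) := by linarith
      gcongr

/-- The barrier condition far to the right, with `τ = 1`, `β = 0.45 σ + 0.2 κ`, `σ = √(s / 2)`. -/
lemma right_condition {σ κ A B : ℝ} (hσ : 1.4142 ≤ σ) (hκ : 0 ≤ κ) (hκ1 : κ ≤ 0.65)
    (hA : σ - 0.0835 + 0.368 * κ ≤ A) (hA' : A ≤ σ + 0.021 + 1.632 * κ)
    (hB : |B - σ| ≤ 0.021 + 0.632 * κ) :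
    0 < (0.45 * σ + 0.2 * κ) * A - 0.45 * (1 / (4 * σ)) ∧
    (B * 1 - 2 * (0.45 * σ + 0.2 * κ)) ^ 2 + (0 - B) ^ 2
      < 4 * ((0.45 * σ + 0.2 * κ) * A - 0.45 * (1 / (4 * σ)))
        * (1 - A * (0.0014 / σ) - -(0.00035 / σ ^ 3)) := by
  have hσ0 : 0 < σ := by linarith
  have hA0 : 0 < A := by linarith
  have h1 : 0.45 * (1 / (4 * σ)) ≤ 0.081 := by
    have : 1 / (4 * σ) ≤ 1 / 5.6 := one_div_le_one_div_of_le (by norm_num) (by linarith)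
    linarith
  have hP1 : (0.45 * σ + 0.2 * κ) * (σ - 0.0835 + 0.368 * κ) ≤ (0.45 * σ + 0.2 * κ) * A := by gcongr
  have hP0 : 0 < (0.45 * σ + 0.2 * κ) * A - 0.081 := by nlinarith
  refine ⟨by linarith, ?_⟩
  have he : 0.99 ≤ 1 - A * (0.0014 / σ) - -(0.00035 / σ ^ 3) := by
    have h2 : A * (0.0014 / σ) ≤ 0.004 := by
      rw [← mul_div_assoc, div_le_iff₀ hσ0]; nlinarith
    have h3 : 0 ≤ 0.00035 / σ ^ 3 := by positivity
    linarith
  have h4 : (B * 1 - 2 * (0.45 * σ + 0.2 * κ)) ^ 2 + (0 - B) ^ 2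
      < 4 * ((0.45 * σ + 0.2 * κ) * A - 0.081) * 0.99 := by
    obtain ⟨θ, hθ⟩ : ∃ θ, θ = B - σ := ⟨_, rfl⟩
    rw [← hθ] at hB
    have hBe : B = θ + σ := by linarith
    have hb := abs_le.1 hB
    have s1 : (θ + 0.1 * σ - 0.4 * κ) ^ 2 ≤ (0.1 * σ + 0.021 + 1.032 * κ) ^ 2 :=
      sq_le_sq' (by linarith) (by linarith)
    have s2 : (θ + σ) ^ 2 ≤ (σ + 0.021 + 0.632 * κ) ^ 2 :=
      sq_le_sq' (by linarith) (by linarith)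
    have e : (B * 1 - 2 * (0.45 * σ + 0.2 * κ)) ^ 2 + (0 - B) ^ 2
      = (θ + 0.1 * σ - 0.4 * κ) ^ 2 + (θ + σ) ^ 2 := by rw [hBe]; ring
    rw [e]
    have k1 : κ ^ 2 ≤ 0.65 ^ 2 := pow_le_pow_left₀ hκ hκ1 2
    have k2 : σ * κ ≤ σ * 0.65 := mul_le_mul_of_nonneg_left hκ1 hσ0.le
    have k3 : 1.4142 * σ ≤ σ * σ := mul_le_mul_of_nonneg_right hσ hσ0.le
    linarith
  calc _ < 4 * ((0.45 * σ + 0.2 * κ) * A - 0.081) * 0.99 := h4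
    _ ≤ _ := by
      have : (0.45 * σ + 0.2 * κ) * A - 0.081 ≤ (0.45 * σ + 0.2 * κ) * A - 0.45 * (1 / (4 * σ)) := by
        linarith
      gcongr
      linarith

/-! ### The weighted integral of the layer does not vanish -/

lemma schedule_bounds : ∀ i < 256, -30000 ≤ tauNode i ∧ tauNode i + 1250 * dTau i ≤ 100000 := by
  decide +kernel

lemma hasDerivAt_const_div_sqrt_half {c s : ℝ} (hs : 0 < s) :
    HasDerivAt (fun s : ℝ => c / √(s / 2)) (-(c / 4 / √(s / 2) ^ 3)) s := by
  have hσ : 0 < √(s / 2) := Real.sqrt_pos.2 (by positivity)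
  refine ((hasDerivAt_const s c).div (hasDerivAt_sqrt_half hs) hσ.ne').congr_deriv ?_
  field_simp; ring

lemma hasDerivAt_const_div_sqrt_neg_half {c s : ℝ} (hs : s < 0) :
    HasDerivAt (fun s : ℝ => c / √(-s / 2)) (c / 4 / √(-s / 2) ^ 3) s := by
  have hσ : 0 < √(-s / 2) := Real.sqrt_pos.2 (by linarith)
  refine ((hasDerivAt_const s c).div (hasDerivAt_sqrt_neg_half hs) hσ.ne').congr_deriv ?_
  field_simp; ring

section WeightRatio

variable {κ a R : ℝ} {f₀ g₀ f g m : ℝ → ℂ}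

/-- The initial value `m = 1 / V` lies in the lens because `Im V ≈ -Re V` there. -/
lemma SmallLayer.inLens_left (h : SmallLayer κ a R f₀ g₀ f g) (hκ : 0 ≤ κ) (hκ1 : κ ≤ 0.65)
    (hR : 4 ≤ R) (hm : IsWeightRatio κ (-R) f g m) {s : ℝ} (hs : s ∈ Icc (-R) (-4)) :
    InLens (-0.3) (√(-s / 2) / 2) (0.002 / √(-s / 2)) (m s) := by
  have hσ : ∀ t ∈ Icc (-R) (-4), 1.4142 ≤ √(-t / 2) := fun t ht => sqrt_half_ge (by linarith [ht.2])
  have hV : ∀ t, (g t / f t + κ).re = (g t / f t).re + κ := fun t => by simp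
  have hV' : ∀ t, (g t / f t + κ).im = (g t / f t).im := fun t => by simp
  have hcond := fun t (ht : t ∈ Icc (-R) (-4)) =>
    left_condition (hσ t ht) hκ hκ1 (h.left_layer_bounds hκ hκ1 ht).1
      (h.left_layer_bounds hκ hκ1 ht).2.1 (h.left_layer_bounds hκ hκ1 ht).2.2
  refine tilted_barrier (V := fun s => g s / f s + κ) (τ := fun _ => -0.3) (τ' := fun _ => 0)
    (β := fun s => √(-s / 2) / 2) (β' := fun s => -1 / (8 * √(-s / 2)))
    (δ := fun s => 0.002 / √(-s / 2)) (δ' := fun s => 0.0005 / √(-s / 2) ^ 3)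
    (fun t ht => hm.deriv t ht.1) (fun t _ => hasDerivAt_const t _)
    (fun t ht => ?_) (fun t ht => ?_) ?_ (fun t ht => ?_) (fun t ht => ?_) s hs
  · refine ((hasDerivAt_sqrt_neg_half (by linarith [ht.2])).div_const 2).congr_deriv ?_
    rw [div_div]; ring
  · exact (hasDerivAt_const_div_sqrt_neg_half (by linarith [ht.2])).congr_deriv (by norm_num)
  · have hR' : -R ∈ Icc (-R) (-4) := ⟨le_rfl, by linarith⟩
    obtain ⟨σ, hσe⟩ : ∃ σ, σ = √(-(-R) / 2) := ⟨_, rfl⟩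
    have hσ1 : 1.4142 ≤ σ := hσe ▸ hσ _ hR'
    obtain ⟨V, hVe⟩ : ∃ V, V = g (-R) / f (-R) + κ := ⟨_, rfl⟩
    have hv : g (-R) / f (-R) = asymMinus (-R) := by rw [h.init.1, h.init.2, div_one]
    have hre : V.re = σ + 1 / (4 * R) + κ := by
      rw [hVe, hv, Complex.add_re, asymMinus_re, ← hσe, Complex.ofReal_re, mul_neg,
        one_div_neg_eq_neg_one_div]
      ring
    have him : V.im = -σ := by
      rw [hVe, hv, Complex.add_im, asymMinus_im, ← hσe, Complex.ofReal_im, add_zero]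
    have hRs : 1 / (4 * R) ≤ 1 / 16 := one_div_le_one_div_of_le (by norm_num) (by linarith)
    have hRp : 0 < 1 / (4 * R) := by positivity
    have hN : 0 < ‖V‖ ^ 2 := by
      have : V ≠ 0 := by intro h0; rw [h0] at him; simp at him; linarith
      have := norm_pos_iff.2 this
      positivity
    have hN' : ‖V‖ ^ 2 = (σ + 1 / (4 * R) + κ) ^ 2 + σ ^ 2 := by
      rw [← Complex.normSq_eq_norm_sq, Complex.normSq_apply, hre, him]; ring
    rw [hm.init, ← hVe, ← hσe]
    have e : (1 / V).re - -0.3 * (1 / V).im - σ / 2 * ‖1 / V‖ ^ 2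
        = (V.re - 0.3 * V.im - σ / 2) / ‖V‖ ^ 2 := by
      rw [one_div, Complex.inv_re, Complex.inv_im, norm_inv, Complex.normSq_eq_norm_sq]
      field_simp
    rw [e, div_le_div_iff₀ (by linarith) hN, hN', hre, him]
    generalize 1 / (4 * R) = w at *
    have h1 : (σ + w + κ) ^ 2 ≤ (2 * σ) ^ 2 := pow_le_pow_left₀ (by linarith) (by linarith) 2
    nlinarith
  · simp only [hV]; exact (hcond t (Ico_subset_Icc_self ht)).1
  · simp only [hV, hV']; exact (hcond t (Ico_subset_Icc_self ht)).2

/-- The lens is passed on over one cell of the table. Along the cell its tilt is at most `1`, whence the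
factor `2` in the lower bound for `m`. -/
lemma SmallLayer.inLens_cell (h : SmallLayer κ a R f₀ g₀ f g) (hκ : 0 ≤ κ) (hκ1 : κ ≤ 0.65)
    (ha : a ≤ 0.0005) (hR : 4 ≤ R) (hm : IsWeightRatio κ (-R) f g m)
    {k₁ k₂ : ℤ} (hk : KappaInterval k₁ k₂) (h1 : (k₁ : ℝ) / 100 ≤ κ) (h2 : κ ≤ (k₂ : ℝ) / 100)
    {i : ℕ} (hi : i < 256)
    (hs : InLens ((tauNode i : ℝ) / 100000) ((betaNode i + 300 * k₁ : ℤ) / 100000 : ℝ) 0.001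
      (m (nodeS i))) :
    (∀ s ∈ Icc (nodeS i) (nodeS (i + 1)), 0.001 ≤ 2 * ‖m s‖) ∧
    InLens ((tauNode i + 1250 * dTau i : ℤ) / 100000 : ℝ)
      ((betaNode i + 300 * k₁ + 125 * dBeta i : ℤ) / 100000 : ℝ) 0.001 (m (nodeS (i + 1))) := by
  obtain ⟨hT, hB, hb0, -⟩ := schedule_facts i hi
  obtain ⟨ht1, ht2⟩ := schedule_bounds i hi
  have hT' : (0 : ℝ) ≤ dTau i := by exact_mod_cast hT
  have hB' : (0 : ℝ) ≤ dBeta i := by exact_mod_cast hB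
  have hb0' : (0 : ℝ) ≤ betaNode i := by exact_mod_cast hb0
  have hk0 : (0 : ℝ) ≤ k₁ := by exact_mod_cast hk.1
  have ht1' : (-30000 : ℝ) ≤ tauNode i := by exact_mod_cast ht1
  have ht2' : (tauNode i : ℝ) + 1250 * dTau i ≤ 100000 := by exact_mod_cast ht2
  have hnS : nodeS (i + 1) = nodeS i + 1 / 32 := by simp only [nodeS]; push_cast; ring
  obtain ⟨τ, hτ⟩ : ∃ τ : ℝ → ℝ, τ = fun s =>
    (tauNode i : ℝ) / 100000 + 0.4 * dTau i * (s - nodeS i) := ⟨_, rfl⟩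
  obtain ⟨β, hβ⟩ : ∃ β : ℝ → ℝ, β = fun s =>
    ((betaNode i + 300 * k₁ : ℤ) / 100000 : ℝ) + 0.04 * dBeta i * (s - nodeS i) := ⟨_, rfl⟩
  have hτm : ∀ s ∈ Icc (nodeS i) (nodeS (i + 1)), τ s ∈ Icc ((tauNode i : ℝ) / 100000)
      ((tauNode i + 1250 * dTau i : ℤ) / 100000 : ℝ) := by
    intro s hs
    have h3 : 0 ≤ s - nodeS i := by linarith [hs.1]
    have h4 : s - nodeS i ≤ 1 / 32 := by linarith [hs.2]
    have h5 : 0.4 * dTau i * (s - nodeS i) ≤ 0.4 * dTau i * (1 / 32) := by gcongr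
    rw [hτ]
    constructor
    · have : 0 ≤ 0.4 * dTau i * (s - nodeS i) := by positivity
      simp only; linarith
    · push_cast; linarith
  have hβm : ∀ s ∈ Icc (nodeS i) (nodeS (i + 1)),
      β s ∈ Icc ((betaNode i + 300 * k₁ : ℤ) / 100000 : ℝ)
      ((betaNode i + 300 * k₁ + 125 * dBeta i : ℤ) / 100000 : ℝ) := by
    intro s hs
    have h3 : 0 ≤ s - nodeS i := by linarith [hs.1]
    have h4 : s - nodeS i ≤ 1 / 32 := by linarith [hs.2]
    have h5 : 0.04 * dBeta i * (s - nodeS i) ≤ 0.04 * dBeta i * (1 / 32) := by gcongr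
    rw [hβ]
    constructor
    · have : 0 ≤ 0.04 * dBeta i * (s - nodeS i) := by positivity
      simp only; linarith
    · push_cast; linarith
  have hV : ∀ t, (g t / f t + κ).re = (g t / f t).re + κ := fun t => by simp
  have hV' : ∀ t, (g t / f t + κ).im = (g t / f t).im := fun t => by simp
  have hnR : -R ≤ nodeS i := by
    have : -4 ≤ nodeS i := by simp [nodeS]; positivity
    linarith
  have hcond := fun t (ht : t ∈ Icc (nodeS i) (nodeS (i + 1))) =>
    h.cell_condition hκ ha hR hk h1 h2 hi ht (hτm t ht) (hβm t ht)
  have hA : ∀ t ∈ Icc (nodeS i) (nodeS (i + 1)), (g t / f t).re + κ ≤ 4 := by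
    intro t ht
    have e1 := h.ref.re_mid_le hi ht
    have e2 := h.dev t (by linarith [ht.1])
    have e3 := deviation_le_linear (α := 0.38) le_rfl hκ hκ1
    have e4 : 0.65 / (0.38 + 0.65) * κ ≤ 0.7 := by norm_num; linarith
    have d1 := (abs_le.1 ((Complex.abs_re_le_norm _).trans (e2.trans e3))).2
    rw [Complex.sub_re] at d1
    linarith
  have hder : ∀ c d t : ℝ, HasDerivAt (fun s => c + d * (s - nodeS i)) d t := fun c d t => by
    simpa using (((hasDerivAt_id t).sub_const (nodeS i)).const_mul d).const_add c
  have hPpos : ∀ t ∈ Icc (nodeS i) (nodeS (i + 1)),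
      0 < β t * ((g t / f t).re + κ) - 0.04 * dBeta i := by
    intro t ht
    have := hcond t ht
    have h3 : 0 ≤ ((g t / f t).im * τ t - 2 * β t) ^ 2 + (0.4 * dTau i - (g t / f t).im) ^ 2 := by
      positivity
    linarith
  have key := tilted_barrier (m := m) (V := fun s => g s / f s + κ) (τ := τ)
    (τ' := fun _ => 0.4 * dTau i) (β := β) (β' := fun _ => 0.04 * dBeta i)
    (δ := fun s => 0.001) (δ' := fun s => 0) (a := nodeS i) (b := nodeS (i + 1))
    (fun t ht => hm.deriv t (by linarith [ht.1])) (fun t _ => by rw [hτ]; exact hder _ _ t)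
    (fun t ht => by rw [hβ]; exact hder _ _ t) (fun t ht => hasDerivAt_const t _)
    (by rw [hτ, hβ]; simpa [InLens] using hs)
    (fun t ht => by simp only [hV]; exact hPpos t (Ico_subset_Icc_self ht))
    (fun t ht => by
      have ht' := Ico_subset_Icc_self ht
      simp only [hV, hV']
      have h3 := hcond t ht'
      have h4 := hPpos t ht'
      have h5 := hA t ht'
      nlinarith)
  refine ⟨fun s hs => ?_, ?_⟩
  · have hτs := hτm s hs
    have hβs := hβm s hs
    push_cast at hτs hβs
    have hβ0 : 0 ≤ β s := le_trans (by positivity) hβs.1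
    have h3 := norm_ge_of_tilted hβ0 (key s hs)
    have h4 : |τ s| ≤ 1 := abs_le.2 ⟨by linarith [hτs.1], by linarith [hτs.2]⟩
    have h5 : (1 + |τ s|) * ‖m s‖ ≤ 2 * ‖m s‖ := by gcongr; linarith
    linarith
  · have h3 := key (nodeS (i + 1)) ⟨by linarith, le_rfl⟩
    have e1 : τ (nodeS (i + 1)) = ((tauNode i + 1250 * dTau i : ℤ) / 100000 : ℝ) := by
      rw [hτ, hnS]; push_cast; ring
    have e2 : β (nodeS (i + 1)) = ((betaNode i + 300 * k₁ + 125 * dBeta i : ℤ) / 100000 : ℝ) := by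
      rw [hβ, hnS]; push_cast; ring
    rw [e1, e2] at h3
    exact h3

lemma SmallLayer.inLens_right (h : SmallLayer κ a R f₀ g₀ f g) (hκ : 0 ≤ κ) (hκ1 : κ ≤ 0.65)
    (hR : 4 ≤ R) (hm : IsWeightRatio κ (-R) f g m)
    (h4 : InLens 1 (0.45 * √(4 / 2) + 0.2 * κ) (0.0014 / √(4 / 2)) (m 4)) {s : ℝ} (hs : 4 ≤ s) :
    InLens 1 (0.45 * √(s / 2) + 0.2 * κ) (0.0014 / √(s / 2)) (m s) := by
  have hV : ∀ t, (g t / f t + κ).re = (g t / f t).re + κ := fun t => by simp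
  have hV' : ∀ t, (g t / f t + κ).im = (g t / f t).im := fun t => by simp
  have hcond := fun t (ht : 4 ≤ t) =>
    right_condition (sqrt_half_ge ht) hκ hκ1 (h.right_layer_bounds hκ hκ1 hR ht).1
      (h.right_layer_bounds hκ hκ1 hR ht).2.1 (h.right_layer_bounds hκ hκ1 hR ht).2.2
  refine tilted_barrier (V := fun s => g s / f s + κ) (τ := fun _ => 1) (τ' := fun _ => 0)
    (β := fun s => 0.45 * √(s / 2) + 0.2 * κ) (β' := fun s => 0.45 * (1 / (4 * √(s / 2))))
    (δ := fun s => 0.0014 / √(s / 2)) (δ' := fun s => -(0.00035 / √(s / 2) ^ 3)) (a := 4) (b := s)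
    (fun t ht => hm.deriv t (by linarith [ht.1])) (fun t _ => hasDerivAt_const t _)
    (fun t ht => ((hasDerivAt_sqrt_half (by linarith [ht.1])).const_mul 0.45).add_const _)
    (fun t ht => (hasDerivAt_const_div_sqrt_half (by linarith [ht.1])).congr_deriv (by norm_num))
    h4 (fun t ht => ?_) (fun t ht => ?_) s ⟨hs, le_rfl⟩
  · simp only [hV]; exact (hcond t ht.1).1
  · simp only [hV, hV']; exact (hcond t ht.1).2

/-- The damped primitive of the layer does not vanish: the lens is carried from the far left, cell by
cell through `[-4, 4]`, and on to the far right. -/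
theorem SmallLayer.weight_ratio_ge (h : SmallLayer κ a R f₀ g₀ f g) (hκ : 0 ≤ κ) (hκ1 : κ ≤ 0.65)
    (ha : a ≤ 0.0005) (hR : 4 ≤ R) (hm : IsWeightRatio κ (-R) f g m) {s : ℝ} (hs : -R ≤ s) :
    0.0004 / (1 + √|s|) ≤ ‖m s‖ := by
  obtain ⟨k₁, k₂, hk, h1, h2⟩ := exists_kappaInterval hκ hκ1
  obtain ⟨se1, se2, se3, se4⟩ := schedule_ends
  obtain ⟨b1, b2⟩ := sqrt_two_bounds
  have hk0 : (0 : ℝ) ≤ k₁ := by exact_mod_cast hk.1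
  have hk3 : (20 : ℝ) * k₂ ≤ 30 * k₁ + 230 := by exact_mod_cast hk.2.2.1
  have hsq : ∀ t : ℝ, 0 ≤ t → √(t / 2) ≤ √t := fun t ht => Real.sqrt_le_sqrt (by linarith)
  have hnode : ∀ i < 256, InLens ((tauNode i : ℝ) / 100000)
      ((betaNode i + 300 * k₁ : ℤ) / 100000 : ℝ) 0.001 (m (nodeS i)) := by
    intro i
    induction i with
    | zero =>
      intro _
      have h3 := h.inLens_left hκ hκ1 hR hm (s := -4) ⟨by linarith, le_rfl⟩
      have e : nodeS 0 = -4 := by simp [nodeS]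
      have e2 : (-(-4 : ℝ) / 2) = 2 := by norm_num
      rw [e2] at h3
      rw [e, se1, se2]
      have e3 : ((-30000 : ℤ) : ℝ) / 100000 = -0.3 := by norm_num
      rw [e3]
      refine h3.mono ?_ ?_
      · push_cast; linarith
      · rw [le_div_iff₀ (by linarith)]; linarith
    | succ i ih =>
      intro hi
      have h3 := (h.inLens_cell hκ hκ1 ha hR hm hk h1 h2 (by omega) (ih (by omega))).2
      obtain ⟨-, -, -, h4⟩ := schedule_facts i (by omega)
      obtain ⟨h5, h6⟩ := h4 (by omega)
      rw [h5]
      have h6' : (betaNode (i + 1) : ℝ) ≤ betaNode i + 125 * dBeta i := by exact_mod_cast h6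
      refine h3.mono ?_ le_rfl
      push_cast
      linarith
  rcases le_or_gt s (-4) with hl | hl
  · have h3 := norm_ge_of_tilted (by positivity) (h.inLens_left hκ hκ1 hR hm ⟨hs, hl⟩)
    have h4 := hsq (-s) (by linarith)
    have h5 := sqrt_half_ge (s := -s) (by linarith)
    rw [abs_of_neg (by linarith : s < 0)]
    have h6 : 0.002 / (1 + √(-s)) ≤ 0.002 / √(-s / 2) := by gcongr; linarith
    have e : (1 + |(-0.3 : ℝ)|) = 1.3 := by rw [abs_neg, abs_of_pos] <;> norm_num
    rw [e] at h3
    have e2 : 0.0004 / (1 + √(-s)) = 0.2 * (0.002 / (1 + √(-s))) := by ring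
    rw [e2]
    have := norm_nonneg (m s)
    linarith
  rcases le_or_gt s 4 with hr | hr
  · obtain ⟨i, hi, hc⟩ := exists_cell hl.le 256 (by norm_num) (by norm_num [nodeS]; linarith)
    have h3 := (h.inLens_cell hκ hκ1 ha hR hm hk h1 h2 hi (hnode i hi)).1 s hc
    have h4 : 0.0004 / (1 + √|s|) ≤ 0.0004 := by
      rw [div_le_iff₀ (by positivity)]
      have := Real.sqrt_nonneg |s|
      linarith
    linarith
  · have h3 := (h.inLens_cell hκ hκ1 ha hR hm hk h1 h2 (i := 255) (by norm_num)
      (hnode 255 (by norm_num))).2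
    have e : nodeS (255 + 1) = 4 := by norm_num [nodeS]
    have e5 : betaNode 255 + 300 * k₁ + 125 * dBeta 255 = 66000 + 300 * k₁ := by linarith
    rw [se3, e5, e] at h3
    have e3 : ((100000 : ℤ) : ℝ) / 100000 = 1 := by norm_num
    rw [e3] at h3
    have e4 : (4 : ℝ) / 2 = 2 := by norm_num
    have h4 := h.inLens_right hκ hκ1 hR hm (by
      rw [e4]
      refine h3.mono ?_ ?_
      · push_cast; linarith
      · rw [div_le_iff₀ (by linarith)]; linarith) hr.le
    have h5 := norm_ge_of_tilted (by positivity) h4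
    have h6 := hsq s (by linarith)
    have h7 := sqrt_half_ge hr.le
    rw [abs_of_pos (by linarith : 0 < s)]
    have h8 : 0.0014 / (1 + √s) ≤ 0.0014 / √(s / 2) := by gcongr; linarith
    rw [abs_one] at h5
    have e2 : 0.0004 / (1 + √s) = 2 / 7 * (0.0014 / (1 + √s)) := by ring
    rw [e2]
    have := norm_nonneg (m s)
    linarith

end WeightRatio

/-! ### The boundary layer for all wave numbers -/

/-- A disc barrier for `z' = p - Q z`: at the boundary of the disc of radius `r` the damping
`Re Q` has to beat the forcing `p`, which may depend on `z` itself. -/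
lemma damped_norm_le {z p Q : ℝ → ℂ} {r a b : ℝ} (hr : 0 < r)
    (hz : ∀ s ∈ Icc a b, HasDerivAt z (p s - Q s * z s) s) (ha : ‖z a‖ ≤ r)
    (h : ∀ s ∈ Icc a b, ‖z s‖ = r → ‖p s‖ < r * (Q s).re) : ∀ s ∈ Icc a b, ‖z s‖ ≤ r := by
  intro s hs
  have key := nonneg_of_barrier (φ := fun s => r ^ 2 - ‖z s‖ ^ 2)
    (φ' := fun s => 0 - 2 * ((starRingEnd ℂ) (z s) * (p s - Q s * z s)).re) (a := a) (b := b)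
    (fun t ht => (hasDerivAt_const t (r ^ 2)).sub (hasDerivAt_normSq' (hz t ht)))
    (by have := norm_nonneg (z a); nlinarith) ?_ s hs
  · exact abs_le_of_sq_le_sq' (by simpa using key) hr.le |>.2
  · intro t ht h0
    have hzr : ‖z t‖ = r := by
      have : ‖z t‖ ^ 2 = r ^ 2 := by linarith
      exact (pow_left_inj₀ (norm_nonneg _) hr.le two_ne_zero).1 this
    have h1 := h t (Ico_subset_Icc_self ht) hzr
    have e : ((starRingEnd ℂ) (z t) * (p t - Q t * z t)).re
        = ((starRingEnd ℂ) (z t) * p t).re - (Q t).re * r ^ 2 := by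
      have : (starRingEnd ℂ) (z t) * (p t - Q t * z t)
          = (starRingEnd ℂ) (z t) * p t - Q t * ((r ^ 2 : ℝ) : ℂ) := by
        have e2 : (starRingEnd ℂ) (z t) * z t = ((r ^ 2 : ℝ) : ℂ) := by
          rw [Complex.conj_mul', hzr]; push_cast; ring
        rw [← e2]; ring
      rw [this, Complex.sub_re, Complex.re_mul_ofReal]
    have h2 : ((starRingEnd ℂ) (z t) * p t).re ≤ r * ‖p t‖ := by
      refine (Complex.re_le_norm _).trans ?_
      rw [norm_mul, RCLike.norm_conj, hzr]
    rw [e]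
    nlinarith

/-- The layer `f`, with derivative `g`, on `[s₀, ∞)`, solving `f'' = (κ² - a + i s) f`, together with a damped primitive
`G` of it, `G' = f - κ G`, which is comparable to `f` up to the factor `1 + κ + √|s|`. -/
structure BoundaryLayer (κ a s₀ : ℝ) (f g G : ℝ → ℂ) : Prop where
  pair : IsLayerPair (κ ^ 2 - a) f g
  prim : ∀ s, HasDerivAt G (f s - κ * G s) s
  ne_zero : ∀ s, s₀ ≤ s → f s ≠ 0
  re_ge : ∀ s, s₀ ≤ s → 0.04 * (1 + κ + √|s|) ≤ (g s / f s).re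
  prim_ge : ∀ s, s₀ ≤ s → 0.0004 / (1 + κ + √|s|) * ‖f s‖ ≤ ‖G s‖
  prim_le : ∀ s, s₀ ≤ s → ‖G s‖ ≤ 5 * ‖f s‖

/-- The derivative of the logarithmic derivative `v = g / f` stays bounded, because it solves
`u' = i - 2 v u`. -/
lemma IsLayerPair.curvature_le {D s₀ r α : ℝ} {f g : ℝ → ℂ} (h : IsLayerPair D f g) (hr : 0 < r)
    (hf : ∀ s, s₀ ≤ s → f s ≠ 0) (hv : ∀ s, s₀ ≤ s → α ≤ (g s / f s).re)
    (hα : 1 < r * (2 * α)) (h0 : ‖(D : ℂ) + s₀ * Complex.I - (g s₀ / f s₀) ^ 2‖ ≤ r) {s : ℝ}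
    (hs : s₀ ≤ s) : ‖(D : ℂ) + s * Complex.I - (g s / f s) ^ 2‖ ≤ r := by
  refine damped_norm_le (z := fun s : ℝ => (D : ℂ) + s * Complex.I - (g s / f s) ^ 2)
    (p := fun _ => Complex.I) (Q := fun s => 2 * (g s / f s)) (a := s₀) (b := s) hr ?_ h0 ?_ s
    ⟨hs, le_rfl⟩
  · intro t ht
    have h1 := (h.hasDerivAt_div (hf t ht.1)).pow 2
    have h2 : HasDerivAt (fun s : ℝ => (D : ℂ) + s * Complex.I) Complex.I t := by
      have := ((Complex.ofRealCLM.hasDerivAt (x := t)).mul_const Complex.I).const_add (D : ℂ)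
      simpa using this
    refine (h2.sub h1).congr_deriv ?_
    push_cast; ring
  · intro t ht _
    rw [Complex.norm_I]
    have := hv t ht.1
    have e : (2 * (g t / f t)).re = 2 * (g t / f t).re := by simp
    rw [e]
    nlinarith

/-- If `v² = κ² - a + i s - u` with `u` bounded, then `Re v` is of size `1 + κ + √|s|`. -/
lemma re_ge_of_curvature {κ a s : ℝ} {v : ℂ} (ha : a ≤ 0.0005)
    (hv : 0.26 ≤ v.re) (hu : ‖((κ ^ 2 - a : ℝ) : ℂ) + s * Complex.I - v ^ 2‖ ≤ 2) :
    0.04 * (1 + κ + √|s|) ≤ v.re := by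
  set q : ℂ := ((κ ^ 2 - a : ℝ) : ℂ) + s * Complex.I with hq
  have h1 : v.re ^ 2 = (‖v ^ 2‖ + (v ^ 2).re) / 2 := by
    rw [norm_pow, ← Complex.normSq_eq_norm_sq, Complex.normSq_apply, pow_two v, Complex.mul_re]
    ring
  have h2 := norm_sub_norm_le q (v ^ 2)
  have h3 := (Complex.abs_re_le_norm _).trans hu
  have hqr : q.re = κ ^ 2 - a := by simp [hq, -Complex.ofReal_sub]
  have hqi : q.im = s := by simp [hq, -Complex.ofReal_sub]
  have h4 := Complex.abs_im_le_norm q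
  rw [Complex.sub_re, hqr] at h3
  rw [hqi] at h4
  have h5 := (abs_le.1 h3).2
  have hs := Real.sq_sqrt (abs_nonneg s)
  have hs0 := Real.sqrt_nonneg |s|
  generalize √|s| = t at *
  have h6 : (κ ^ 2 + t ^ 2 - 4.0005) / 2 ≤ v.re ^ 2 := by linarith
  have h7 : 0.005 * (1 + κ ^ 2 + t ^ 2) ≤ v.re ^ 2 := by
    rcases le_or_gt (κ ^ 2 + t ^ 2) 9 with h | h <;> nlinarith
  refine abs_le_of_sq_le_sq' ?_ (by linarith) |>.2
  nlinarith [sq_nonneg (κ - t), sq_nonneg (1 - t), sq_nonneg (1 - κ)]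

lemma norm_le_of_curvature {κ a s : ℝ} {v : ℂ} (hκ : 0 ≤ κ) (ha0 : 0 ≤ a) (ha : a ≤ 0.0005)
    (hu : ‖((κ ^ 2 - a : ℝ) : ℂ) + s * Complex.I - v ^ 2‖ ≤ 0.775) :
    ‖v‖ ≤ 1 + κ + √|s| := by
  set q : ℂ := ((κ ^ 2 - a : ℝ) : ℂ) + s * Complex.I with hq
  have h2 : ‖v ^ 2‖ ≤ ‖q‖ + 0.775 := by
    have := norm_sub_norm_le (v ^ 2) q
    rw [norm_sub_rev] at this
    linarith
  have h3 : ‖q‖ ≤ κ ^ 2 + a + |s| := by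
    refine norm_le_of_abs ?_ ?_
    · simp only [hq, Complex.add_re, Complex.ofReal_re, Complex.mul_re, Complex.I_re,
        Complex.ofReal_im, Complex.I_im]
      rw [abs_le]
      constructor <;> nlinarith
    · simp [hq, -Complex.ofReal_sub]
  rw [norm_pow] at h2
  have hs := Real.sq_sqrt (abs_nonneg s)
  have hs0 := Real.sqrt_nonneg |s|
  generalize √|s| = t at *
  refine abs_le_of_sq_le_sq' ?_ (by positivity) |>.2
  nlinarith [mul_nonneg hκ hs0]

/-- The square root with nonnegative real part, the fixed point of the Riccati equation with frozen
coefficients. -/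
lemma exists_sqrt_re_ge (D s : ℝ) : ∃ w : ℂ, w ^ 2 = (D : ℂ) + s * Complex.I ∧ √D ≤ w.re := by
  obtain ⟨w, hw⟩ := IsAlgClosed.exists_pow_nat_eq ((D : ℂ) + s * Complex.I) two_pos
  have key : ∀ w : ℂ, w ^ 2 = (D : ℂ) + s * Complex.I → 0 ≤ w.re → √D ≤ w.re := by
    intro w hw h0
    rw [Real.sqrt_le_left h0]
    have h1 := congrArg Complex.re hw
    rw [pow_two, Complex.mul_re] at h1
    simp at h1
    nlinarith [mul_self_nonneg w.im]
  rcases le_total 0 w.re with h | h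
  · exact ⟨w, hw, key w hw h⟩
  · exact ⟨-w, by rw [neg_sq, hw], key (-w) (by rw [neg_sq, hw]) (by simpa using h)⟩

lemma HasDerivAt.weightRatio {κ s : ℝ} {f g G : ℝ → ℂ} (hf : HasDerivAt f (g s) s)
    (hG : HasDerivAt G (f s - κ * G s) s) (h0 : f s ≠ 0) :
    HasDerivAt (fun s => G s / f s) (1 - (g s / f s + κ) * (G s / f s)) s := by
  refine (hG.div hf h0).congr_deriv ?_
  field_simp
  ring

/-- Upper bound for the weight ratio, from the damping `Re (v + κ) ≥ α` alone. -/
lemma weightRatio_norm_le {κ s₀ α r : ℝ} {f g m : ℝ → ℂ} (hm : IsWeightRatio κ s₀ f g m)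
    (hκ : 0 ≤ κ) (hα : 0 < α) (hr : 1 < r * α) (hv : ∀ s, s₀ ≤ s → α ≤ (g s / f s).re) {s : ℝ}
    (hs : s₀ ≤ s) : ‖m s‖ ≤ r := by
  have hr0 : 0 < r := by by_contra! h; nlinarith
  have hre : ∀ t, s₀ ≤ t → α ≤ (g t / f t + κ).re := fun t ht => by
    have := hv t ht
    rw [Complex.add_re, Complex.ofReal_re]; linarith
  refine damped_norm_le (p := fun _ => 1) (Q := fun s => g s / f s + κ) (a := s₀) (b := s) hr0
    (fun t ht => hm.deriv t ht.1) ?_ ?_ s ⟨hs, le_rfl⟩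
  · rw [hm.init, norm_div, norm_one]
    have h1 := (hre s₀ le_rfl).trans (Complex.re_le_norm _)
    rw [div_le_iff₀ (by linarith)]
    nlinarith
  · intro t ht _
    rw [norm_one]
    nlinarith [hre t ht.1]

lemma SmallLayer.re_ge' {κ a R : ℝ} {f₀ g₀ f g : ℝ → ℂ} (h : SmallLayer κ a R f₀ g₀ f g)
    (hκ : 0 ≤ κ) (ha : a ≤ 0.0005) {s : ℝ} (hs : -R ≤ s) : 0.26 ≤ (g s / f s).re := by
  rcases le_total κ 0.27 with h1 | h1
  · have h2 := (abs_le.1 ((Complex.abs_re_le_norm _).trans (h.dev s hs))).1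
    rw [Complex.sub_re] at h2
    have h3 := h.ref.re_ge hs
    have h4 : deviation 0.38 κ ≤ 0.114 := by
      unfold deviation
      have : κ ^ 2 / (0.38 + κ) ≤ 0.113 := by
        rw [div_le_iff₀ (by linarith)]; nlinarith
      linarith
    linarith
  · refine le_trans ?_ (h.re_ge s hs)
    refine Real.le_sqrt_of_sq_le ?_
    nlinarith

lemma SmallLayer.curvature_init {κ a R : ℝ} {f₀ g₀ f g : ℝ → ℂ} (h : SmallLayer κ a R f₀ g₀ f g)
    (hκ : 0 ≤ κ) (hκ1 : κ ≤ 0.65) (ha0 : 0 ≤ a) (ha : a ≤ 0.0005) (hR : 4 ≤ R) :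
    ‖((κ ^ 2 - a : ℝ) : ℂ) + (-R : ℝ) * Complex.I - (g (-R) / f (-R)) ^ 2‖ ≤ 2 := by
  rw [h.init.1, h.init.2, div_one]
  have h1 := asymMinus_residual (s := -R) (by linarith)
  have e : ((κ ^ 2 - a : ℝ) : ℂ) + (-R : ℝ) * Complex.I - asymMinus (-R) ^ 2
      = ((κ ^ 2 - a : ℝ) : ℂ) + ((((-1 / (4 * √(-(-R) / 2)) : ℝ) : ℂ) * (1 - Complex.I)
      + ((1 / (4 * (-R) ^ 2) : ℝ) : ℂ)) + ((-(5 / (16 * (-R) ^ 2)) : ℝ) : ℂ)) := by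
    rw [← h1]; push_cast; ring
  rw [e, neg_neg]
  have h2 := sqrt_half_ge hR
  have hR2 : 0 < (-R) ^ 2 := by nlinarith
  have h3 : |(-1 / (4 * √(R / 2)))| ≤ 0.25 := by
    rw [abs_div, abs_neg, abs_one, abs_of_pos (by linarith), div_le_iff₀ (by linarith)]
    linarith
  have h4 : 1 / (4 * (-R) ^ 2) ≤ 0.02 := by
    rw [div_le_iff₀ (by positivity)]; nlinarith
  have h5 : (5 / (16 * (-R) ^ 2)) ≤ 0.02 := by
    rw [div_le_iff₀ (by positivity)]; nlinarith
  have h6 : 0 < 1 / (4 * (-R) ^ 2) := by positivity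
  have h7 : 0 < (5 / (16 * (-R) ^ 2)) := by positivity
  generalize -1 / (4 * √(R / 2)) = x at *
  generalize 1 / (4 * (-R) ^ 2) = y at *
  generalize 5 / (16 * (-R) ^ 2) = z at *
  have h8 := abs_le.1 h3
  refine (norm_le_of_abs (u := 1) (v := 0.3) ?_ ?_).trans (by norm_num)
  · simp [-Complex.ofReal_sub]
    rw [abs_le]
    constructor <;> nlinarith
  · simp [-Complex.ofReal_sub]
    rw [abs_le]
    constructor <;> linarith

/-- For small `κ` the layer starts on the asymptotics of the reference, far to the left of `s₀`. -/
lemma exists_boundaryLayer_small {κ a : ℝ} (hκ : 0 ≤ κ) (hκ1 : κ ≤ 0.65) (ha0 : 0 ≤ a)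
    (ha : a ≤ 0.0005) (s₀ : ℝ) : ∃ f g G, BoundaryLayer κ a s₀ f g G := by
  obtain ⟨R, hR, hRs⟩ : ∃ R, 4 ≤ R ∧ -R ≤ s₀ :=
    ⟨max 4 (-s₀), le_max_left _ _, by linarith [le_max_right 4 (-s₀)]⟩
  obtain ⟨f₀, g₀, f, g, h⟩ := exists_smallLayer hκ hκ1 ha0 ha hR
  have hcf : Continuous f := continuous_iff_continuousAt.2 fun s => (h.pair.1 s).continuousAt
  obtain ⟨G, hG0, hG⟩ := exists_damped_primitive hcf κ (-R) (1 / (g (-R) / f (-R) + κ) * f (-R))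
  have hm : IsWeightRatio κ (-R) f g (fun s => G s / f s) :=
    ⟨fun s hs => (h.pair.1 s).weightRatio (hG s) (h.ne_zero s hs), by
      simp only [hG0, mul_div_assoc, div_self (h.ne_zero _ le_rfl), mul_one]⟩
  refine ⟨f, g, G, h.pair, hG, fun s hs => h.ne_zero s (hRs.trans hs), ?_, ?_, ?_⟩
  · intro s hs
    have hs' := hRs.trans hs
    refine re_ge_of_curvature ha (h.re_ge' hκ ha hs') ?_
    exact h.pair.curvature_le two_pos h.ne_zero (fun t ht => h.re_ge' hκ ha ht) (by norm_num)
      (h.curvature_init hκ hκ1 ha0 ha hR) hs'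
  · intro s hs
    have hs' := hRs.trans hs
    have h1 := h.weight_ratio_ge hκ hκ1 ha hR hm hs'
    rw [norm_div, le_div_iff₀ (norm_pos_iff.2 (h.ne_zero s hs'))] at h1
    refine le_trans ?_ h1
    gcongr
    linarith
  · intro s hs
    have hs' := hRs.trans hs
    have h1 := weightRatio_norm_le hm hκ (α := 0.26) (r := 5) (by norm_num) (by norm_num)
      (fun t ht => h.re_ge' hκ ha ht) hs'
    rwa [norm_div, div_le_iff₀ (norm_pos_iff.2 (h.ne_zero s hs'))] at h1

/-- For large `κ` the layer starts at `s₀` with the logarithmic derivative `√(κ² - a + i s₀)`. Then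
`V = v + κ` satisfies `Re V ≥ 1.299` and `|V'| ≤ 0.775`, and `z = V m - 1` solves `z' = V' m - V z`,
so that `|z| ≤ 0.9` persists because of `0.775 · 1.9 < 0.9 · 1.299²`. -/
lemma exists_boundaryLayer_large {κ a : ℝ} (hκ1 : 0.65 ≤ κ) (ha0 : 0 ≤ a)
    (ha : a ≤ 0.0005) (s₀ : ℝ) : ∃ f g G, BoundaryLayer κ a s₀ f g G := by
  have hκ : 0 ≤ κ := by linarith
  have hD : 0 ≤ κ ^ 2 - a := by nlinarith
  have hsq : 0.649 ≤ √(κ ^ 2 - a) := Real.le_sqrt_of_sq_le (by nlinarith)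
  obtain ⟨w, hw, hwre⟩ := exists_sqrt_re_ge (κ ^ 2 - a) s₀
  obtain ⟨f, g, h, hf0, hg0⟩ := exists_layerPair (κ ^ 2 - a) s₀ 1 w
  have hpos := fun {s : ℝ} (hs : s₀ ≤ s) => h.nonzero_of_re_pos hD (s₀ := s₀)
    (by rw [hf0, hg0, map_one, one_mul]; linarith)
    (by rw [hf0, hg0, map_one, one_mul, norm_one]; linarith) hs
  have hne : ∀ s, s₀ ≤ s → f s ≠ 0 := fun s hs => (hpos hs).1
  have hre : ∀ s, s₀ ≤ s → 0.649 ≤ (g s / f s).re := by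
    intro s hs
    have h1 := (hpos hs).2
    have h2 : 0 < ‖f s‖ ^ 2 := by have := norm_pos_iff.2 (hne s hs); positivity
    have e : (g s / f s).re = ((starRingEnd ℂ) (f s) * g s).re / ‖f s‖ ^ 2 := by
      rw [Complex.div_re, ← Complex.normSq_eq_norm_sq]; simp; ring
    rw [e]
    exact hsq.trans ((le_div_iff₀ h2).2 h1)
  -- `0.775` exceeds `1 / (2 · 0.649)`, the forcing of `v'` over its damping
  have hu : ∀ s, s₀ ≤ s → ‖((κ ^ 2 - a : ℝ) : ℂ) + s * Complex.I - (g s / f s) ^ 2‖ ≤ 0.775 :=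
    fun s hs => h.curvature_le (by norm_num) hne hre (by norm_num)
      (by rw [hf0, hg0, div_one, hw, sub_self, norm_zero]; norm_num) hs
  have hcf : Continuous f := continuous_iff_continuousAt.2 fun s => (h.1 s).continuousAt
  obtain ⟨G, hG0, hG⟩ := exists_damped_primitive hcf κ s₀ (1 / (g s₀ / f s₀ + κ) * f s₀)
  have hm : IsWeightRatio κ s₀ f g (fun s => G s / f s) :=
    ⟨fun s hs => (h.1 s).weightRatio (hG s) (hne s hs), by
      simp only [hG0, mul_div_assoc, div_self (hne _ le_rfl), mul_one]⟩
  have hV : ∀ s, s₀ ≤ s → 1.299 ≤ (g s / f s + κ).re := fun s hs => by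
    have := hre s hs
    rw [Complex.add_re, Complex.ofReal_re]; linarith
  refine ⟨f, g, G, h, hG, hne, ?_, ?_, ?_⟩
  · intro s hs
    exact re_ge_of_curvature ha (by linarith [hre s hs]) ((hu s hs).trans (by norm_num))
  · intro s hs
    have key : ‖(g s / f s + κ) * (G s / f s) - 1‖ ≤ 0.9 := by
      refine damped_norm_le (z := fun s => (g s / f s + κ) * (G s / f s) - 1)
        (p := fun s : ℝ => (((κ ^ 2 - a : ℝ) : ℂ) + s * Complex.I - (g s / f s) ^ 2) * (G s / f s))
        (Q := fun s => g s / f s + κ) (a := s₀) (b := s) (by norm_num) ?_ ?_ ?_ s ⟨hs, le_rfl⟩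
      · intro t ht
        refine (((h.hasDerivAt_div (hne t ht.1)).add_const (κ : ℂ)).mul
          (hm.deriv t ht.1) |>.sub_const 1).congr_deriv ?_
        ring
      · have h0 : g s₀ / f s₀ + κ ≠ 0 := fun h0 => by
          have := hV s₀ le_rfl
          rw [h0] at this; norm_num at this
        have := hm.init
        simp only [this, mul_one_div, div_self h0, sub_self, norm_zero]
        norm_num
      · intro t ht hz
        have h1 := hV t ht.1
        have h2 := h1.trans (Complex.re_le_norm _)
        have h3 : ‖(g t / f t + κ) * (G t / f t)‖ ≤ 1.9 := by
          have := norm_add_le ((g t / f t + κ) * (G t / f t) - 1) 1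
          rw [sub_add_cancel, norm_one] at this
          linarith
        rw [norm_mul] at h3
        have h4 : ‖G t / f t‖ ≤ 1.4627 := by
          have := norm_nonneg (G t / f t)
          nlinarith
        rw [norm_mul]
        have h5 := hu t ht.1
        have : ‖((κ ^ 2 - a : ℝ) : ℂ) + t * Complex.I - (g t / f t) ^ 2‖ * ‖G t / f t‖
          ≤ 0.775 * 1.4627 := by gcongr
        linarith
    have h1 : 0.1 ≤ ‖(g s / f s + κ) * (G s / f s)‖ := by
      have := norm_sub_norm_le (1 : ℂ) ((g s / f s + κ) * (G s / f s))
      rw [norm_sub_rev, norm_one] at this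
      linarith
    have h2 : ‖g s / f s + κ‖ ≤ 2 * (1 + κ + √|s|) := by
      refine (norm_add_le _ _).trans ?_
      have h3 := norm_le_of_curvature hκ ha0 ha (hu s hs)
      rw [Complex.norm_real, Real.norm_of_nonneg hκ]
      have := Real.sqrt_nonneg |s|
      linarith
    have h3 := norm_pos_iff.2 (hne s hs)
    have hp : 0 < 1 + κ + √|s| := by positivity
    rw [norm_mul, norm_div (G s), ← mul_div_assoc, le_div_iff₀ h3] at h1
    have h4 : ‖g s / f s + κ‖ * ‖G s‖ ≤ 2 * (1 + κ + √|s|) * ‖G s‖ := by gcongr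
    rw [div_mul_eq_mul_div, div_le_iff₀ hp]
    linarith
  · intro s hs
    have h1 := weightRatio_norm_le hm hκ (α := 0.649) (r := 5) (by norm_num) (by norm_num) hre hs
    rwa [norm_div, div_le_iff₀ (norm_pos_iff.2 (hne s hs))] at h1

theorem exists_boundaryLayer {κ a : ℝ} (hκ : 0 ≤ κ) (ha0 : 0 ≤ a) (ha : a ≤ 0.0005) (s₀ : ℝ) :
    ∃ f g G, BoundaryLayer κ a s₀ f g G := by
  rcases le_total κ 0.65 with h | h
  · exact exists_boundaryLayer_small hκ h ha0 ha s₀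
  · exact exists_boundaryLayer_large h ha0 ha s₀

/-! ### The boundary layer in the channel -/

/-- An odd primitive of `√|s|`; the real powers vanish at negative arguments. -/
noncomputable def sqrtPrimitive (s : ℝ) : ℝ := 2 / 3 * (s ^ (3 / 2 : ℝ) - (-s) ^ (3 / 2 : ℝ))

lemma rpow_three_halves_of_nonneg {s : ℝ} (hs : 0 ≤ s) : s ^ (3 / 2 : ℝ) = s * √s := by
  rw [Real.sqrt_eq_rpow, show (3 / 2 : ℝ) = 1 + 1 / 2 by norm_num,
    Real.rpow_add_of_nonneg hs (by norm_num) (by norm_num), Real.rpow_one]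

lemma rpow_three_halves_of_nonpos {s : ℝ} (hs : s ≤ 0) : s ^ (3 / 2 : ℝ) = 0 := by
  rcases hs.eq_or_lt with rfl | hs
  · exact Real.zero_rpow (by norm_num)
  rw [Real.rpow_def_of_neg hs]
  refine mul_eq_zero_of_right _ ?_
  rw [show (3 / 2 : ℝ) * Real.pi = Real.pi / 2 + Real.pi by ring, Real.cos_add_pi,
    Real.cos_pi_div_two, neg_zero]

lemma hasDerivAt_sqrtPrimitive (s : ℝ) : HasDerivAt sqrtPrimitive √|s| s := by
  have h1 : ∀ t : ℝ, HasDerivAt (fun s : ℝ => s ^ (3 / 2 : ℝ)) (3 / 2 * √t) t := fun t => by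
    have := Real.hasDerivAt_rpow_const (x := t) (p := 3 / 2) (Or.inr (by norm_num))
    rw [Real.sqrt_eq_rpow]
    norm_num at this ⊢
    exact this
  have h2 := ((h1 s).sub ((h1 (-s)).comp s (hasDerivAt_neg s))).const_mul (2 / 3 : ℝ)
  refine h2.congr_deriv ?_
  rcases le_total 0 s with h | h
  · rw [abs_of_nonneg h, Real.sqrt_eq_zero_of_nonpos (neg_nonpos.2 h)]; ring
  · rw [abs_of_nonpos h, Real.sqrt_eq_zero_of_nonpos h]; ring

lemma sqrtPrimitive_sub_ge {s b : ℝ} (h : s ≤ b) :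
    1 / 3 * (b - s) * √|b| ≤ sqrtPrimitive b - sqrtPrimitive s := by
  unfold sqrtPrimitive
  rcases le_total 0 b with hb | hb
  · rw [rpow_three_halves_of_nonneg hb, rpow_three_halves_of_nonpos (neg_nonpos.2 hb),
      abs_of_nonneg hb]
    have hb0 := Real.sqrt_nonneg b
    rcases le_total 0 s with hs | hs
    · rw [rpow_three_halves_of_nonneg hs, rpow_three_halves_of_nonpos (neg_nonpos.2 hs)]
      have := Real.sqrt_le_sqrt h
      have : s * √s ≤ s * √b := by gcongr
      nlinarith [mul_nonneg (sub_nonneg.2 h) hb0]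
    · rw [rpow_three_halves_of_nonpos hs, rpow_three_halves_of_nonneg (neg_nonneg.2 hs)]
      have hs0 := Real.sqrt_nonneg (-s)
      rcases le_total (-s) b with h1 | h1
      · nlinarith [mul_nonneg (neg_nonneg.2 hs) hs0]
      · have := Real.sqrt_le_sqrt h1
        have : -s * √b ≤ -s * √(-s) := by gcongr; linarith
        nlinarith [mul_nonneg hb hb0, mul_nonneg (neg_nonneg.2 hs) hb0]
  · have hs := h.trans hb
    rw [rpow_three_halves_of_nonpos hb, rpow_three_halves_of_nonneg (neg_nonneg.2 hb),
      rpow_three_halves_of_nonpos hs, rpow_three_halves_of_nonneg (neg_nonneg.2 hs),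
      abs_of_nonpos hb]
    have h1 := Real.sqrt_le_sqrt (neg_le_neg h)
    have h2 : -s * √(-b) ≤ -s * √(-s) := by gcongr; linarith
    nlinarith [mul_nonneg (sub_nonneg.2 h) (Real.sqrt_nonneg (-b))]

/-- The layer grows at the rate `1 + κ + √|b|` up to any point `b`. -/
lemma BoundaryLayer.norm_le {κ a s₀ : ℝ} {f g G : ℝ → ℂ} (h : BoundaryLayer κ a s₀ f g G)
    (hκ : 0 ≤ κ) {s b : ℝ} (hs : s₀ ≤ s) (hb : s ≤ b) :
    ‖f s‖ ≤ ‖f b‖ * Real.exp (-(0.01 * (1 + κ + √|b|) * (b - s))) := by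
  set Ψ : ℝ → ℝ := fun t => 0.04 * ((1 + κ) * t + sqrtPrimitive t) with hΨ
  have hΨ' : ∀ t, HasDerivAt Ψ (0.04 * (1 + κ + √|t|)) t := fun t => by
    have := (((hasDerivAt_id t).const_mul (1 + κ)).add (hasDerivAt_sqrtPrimitive t)).const_mul
      (0.04 : ℝ)
    refine this.congr_deriv (by ring)
  have hd : ∀ t, HasDerivAt (fun t => ‖f t‖ ^ 2 * Real.exp (-(2 * Ψ t)))
      (2 * ((starRingEnd ℂ) (f t) * g t).re * Real.exp (-(2 * Ψ t)) + ‖f t‖ ^ 2 *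
        (Real.exp (-(2 * Ψ t)) * -(2 * (0.04 * (1 + κ + √|t|))))) t := fun t =>
    (hasDerivAt_normSq' (h.pair.1 t)).mul (((hΨ' t).const_mul 2).neg.exp)
  have hmono : MonotoneOn (fun t => ‖f t‖ ^ 2 * Real.exp (-(2 * Ψ t))) (Icc s b) := by
    refine monotoneOn_of_deriv_nonneg (convex_Icc _ _)
      (fun t _ => (hd t).continuousAt.continuousWithinAt)
      (fun t _ => (hd t).differentiableAt.differentiableWithinAt) ?_
    intro t ht
    rw [interior_Icc] at ht
    rw [(hd t).deriv]
    have ht0 : s₀ ≤ t := by linarith [ht.1]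
    have h1 := h.re_ge t ht0
    have h2 : 0 < ‖f t‖ ^ 2 := by have := norm_pos_iff.2 (h.ne_zero t ht0); positivity
    have e : (g t / f t).re = ((starRingEnd ℂ) (f t) * g t).re / ‖f t‖ ^ 2 := by
      rw [Complex.div_re, ← Complex.normSq_eq_norm_sq]; simp; ring
    rw [e, le_div_iff₀ h2] at h1
    have h3 := Real.exp_pos (-(2 * Ψ t))
    nlinarith
  have h1 := hmono ⟨le_rfl, hb⟩ ⟨hb, le_rfl⟩ hb
  have h2 : 0.01 * (1 + κ + √|b|) * (b - s) ≤ Ψ b - Ψ s := by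
    have := sqrtPrimitive_sub_ge hb
    have h3 : 0 ≤ (b - s) * √|b| := mul_nonneg (by linarith) (Real.sqrt_nonneg _)
    have h4 : 0 ≤ (b - s) * (1 + κ) := mul_nonneg (by linarith) (by linarith)
    simp only [hΨ]
    nlinarith
  have h3 : ‖f s‖ ≤ ‖f b‖ * Real.exp (-(Ψ b - Ψ s)) := by
    refine abs_le_of_sq_le_sq' ?_ (by positivity) |>.2
    have e1 : (‖f b‖ * Real.exp (-(Ψ b - Ψ s))) ^ 2
        = ‖f b‖ ^ 2 * Real.exp (-(2 * Ψ b)) * Real.exp (2 * Ψ s) := by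
      rw [mul_pow, mul_assoc, ← Real.exp_add, ← Real.exp_nat_mul]
      congr 2; push_cast; ring
    have e2 : ‖f s‖ ^ 2 = ‖f s‖ ^ 2 * Real.exp (-(2 * Ψ s)) * Real.exp (2 * Ψ s) := by
      rw [mul_assoc, ← Real.exp_add, neg_add_cancel, Real.exp_zero, mul_one]
    rw [e1, e2]
    gcongr
  refine h3.trans ?_
  gcongr

/-- The inverse width `L + η + (L³ |x|)^{1/2}` of a boundary layer whose wall is at the distance
`x` from the critical point. -/
noncomputable def edgeRate (η L x : ℝ) : ℝ := L + η + √(L ^ 3 * |x|)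

/-- The coefficient `η² - a L² + i L³ (y - lam)` of the vorticity equation `w'' = q w`. -/
noncomputable def orrPotential (η a L lam y : ℝ) : ℂ :=
  ((η ^ 2 - a * L ^ 2 : ℝ) : ℂ) + ((L ^ 3 * (y - lam) : ℝ) : ℂ) * Complex.I

/-- A solution `φ` of `φ'' = q φ` concentrated at the wall `y = 1` in a layer of width `1 / M`,
whose pairing with `exp (-η (1 - y))` is as large as this width permits. -/
structure EdgeLayer (η M : ℝ) (q φ φ' : ℝ → ℂ) : Prop where
  deriv : ∀ y, HasDerivAt φ (φ' y) y
  deriv_deriv : ∀ y, HasDerivAt φ' (q y * φ y) y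
  decay : ∀ y ∈ Icc (-1 : ℝ) 1, ‖φ y‖ ≤ Real.exp (-(0.01 * M * (1 - y)))
  ne_zero : ∀ y ∈ Icc (-1 : ℝ) 1, φ y ≠ 0
  re_pos : ∀ y ∈ Icc (-1 : ℝ) 1, 0 < (φ' y / φ y).re
  mass : 3e-4 / M ≤ ‖∫ y in (-1 : ℝ)..1, (Real.exp (-(η * (1 - y))) : ℂ) * φ y‖

lemma exp_neg_le_two_div_sq {x : ℝ} (hx : 0 < x) : Real.exp (-x) ≤ 2 / x ^ 2 := by
  rw [Real.exp_neg, ← one_div, div_le_div_iff₀ (Real.exp_pos x) (by positivity)]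
  have := Real.quadratic_le_exp_of_nonneg hx.le
  nlinarith

theorem exists_edgeLayer {η a L : ℝ} (hη : 0 ≤ η) (ha0 : 0 ≤ a) (ha : a ≤ 0.0005)
    (hL : 10 ^ 6 ≤ L) (lam : ℝ) :
    ∃ φ φ', EdgeLayer η (edgeRate η L (1 - lam)) (orrPotential η a L lam) φ φ' := by
  have hL0 : 0 < L := by linarith
  have hLc : (L : ℂ) ≠ 0 := by exact_mod_cast hL0.ne'
  have hκ : 0 ≤ η / L := by positivity
  obtain ⟨f, g, G, h⟩ := exists_boundaryLayer hκ ha0 ha (L * (-1 - lam))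
  set b := L * (1 - lam) with hb
  set N := 1 + η / L + √|b| with hN
  have hN1 : 1 ≤ N := by have := Real.sqrt_nonneg |b|; linarith
  have hM : edgeRate η L (1 - lam) = L * N := by
    rw [edgeRate, hN, mul_add, mul_add, mul_div_cancel₀ _ hL0.ne', mul_one, hb, abs_mul,
      abs_of_pos hL0, show L ^ 3 * |1 - lam| = L ^ 2 * (L * |1 - lam|) by ring,
      Real.sqrt_mul (by positivity), Real.sqrt_sq hL0.le]
  have hab : L * (-1 - lam) ≤ b := by rw [hb]; gcongr; norm_num
  have hfb : f b ≠ 0 := h.ne_zero b hab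
  have hfb' := norm_pos_iff.2 hfb
  have hmem : ∀ y, -1 ≤ y → L * (-1 - lam) ≤ L * (y - lam) := fun y hy => by gcongr
  have haff : ∀ y, HasDerivAt (fun y : ℝ => L * (y - lam)) L y := fun y => by
    simpa using ((hasDerivAt_id y).sub_const lam).const_mul L
  have hφ : ∀ y, HasDerivAt (fun y => f (L * (y - lam)) / f b)
      (L * g (L * (y - lam)) / f b) y := fun y => by
    have := ((h.pair.1 (L * (y - lam))).scomp y (haff y)).div_const (f b)
    rwa [Complex.real_smul] at this
  have hφ' : ∀ y, HasDerivAt (fun y => L * g (L * (y - lam)) / f b)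
      (orrPotential η a L lam y * (f (L * (y - lam)) / f b)) y := fun y => by
    have := (((h.pair.2 (L * (y - lam))).scomp y (haff y)).const_mul (L : ℂ)).div_const (f b)
    refine this.congr_deriv ?_
    rw [Complex.real_smul, orrPotential]
    push_cast
    field_simp
  have hdecay : ∀ y ∈ Icc (-1 : ℝ) 1,
      ‖f (L * (y - lam)) / f b‖ ≤ Real.exp (-(0.01 * (L * N) * (1 - y))) := by
    intro y hy
    have h1 := h.norm_le hκ (hmem y hy.1) (b := b) (by rw [hb]; gcongr; exact hy.2)
    rw [norm_div, div_le_iff₀ hfb', mul_comm (Real.exp _)]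
    refine h1.trans_eq ?_
    congr 3
    rw [hb, hN]; ring
  refine ⟨fun y => f (L * (y - lam)) / f b, fun y => L * g (L * (y - lam)) / f b,
    hφ, hφ', by rw [hM]; exact hdecay, fun y hy => div_ne_zero (h.ne_zero _ (hmem y hy.1)) hfb,
    ?_, ?_⟩
  · intro y hy
    have h0 := h.ne_zero _ (hmem y hy.1)
    have e : L * g (L * (y - lam)) / f b / (f (L * (y - lam)) / f b)
        = (L : ℂ) * (g (L * (y - lam)) / f (L * (y - lam))) := by field_simp
    rw [e, Complex.re_ofReal_mul]
    have h1 := h.re_ge _ (hmem y hy.1)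
    have h2 : 0 < 0.04 * (1 + η / L + √|L * (y - lam)|) := by positivity
    exact mul_pos hL0 (h2.trans_le h1)
  · rw [hM]
    have hΓ : ∀ y, HasDerivAt (fun y : ℝ => (Real.exp (-(η * (1 - y))) : ℂ) *
        (G (L * (y - lam)) / (L * f b)))
        ((Real.exp (-(η * (1 - y))) : ℂ) * (f (L * (y - lam)) / f b)) y := fun y => by
      have h1 := ((h.prim (L * (y - lam))).scomp y (haff y)).div_const (L * f b)
      have h2 : HasDerivAt (fun y : ℝ => Real.exp (-(η * (1 - y))))
          (Real.exp (-(η * (1 - y))) * η) y := by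
        have := (((hasDerivAt_id y).const_sub 1).const_mul η).neg.exp
        simpa using this
      refine (h2.ofReal_comp.mul h1).congr_deriv ?_
      rw [Complex.real_smul]
      push_cast
      simp only [Function.comp]
      field_simp
      ring
    have hcont : Continuous fun y : ℝ =>
        (Real.exp (-(η * (1 - y))) : ℂ) * (f (L * (y - lam)) / f b) := by
      have hf : Continuous fun y => f (L * (y - lam)) / f b :=
        continuous_iff_continuousAt.2 fun y => (hφ y).continuousAt
      exact (Complex.continuous_ofReal.comp (by fun_prop)).mul hf
    rw [intervalIntegral.integral_eq_sub_of_hasDerivAt (fun y _ => hΓ y)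
      (hcont.intervalIntegrable _ _)]
    have e1 : (Real.exp (-(η * (1 - 1))) : ℂ) = 1 := by simp
    rw [e1, one_mul, ← hb]
    have h1 : 4e-4 / (L * N) ≤ ‖G b / (L * f b)‖ := by
      have := h.prim_ge b hab
      rw [norm_div, norm_mul, Complex.norm_real, Real.norm_of_nonneg hL0.le,
        div_le_div_iff₀ (by positivity) (by positivity)]
      rw [← hN, div_mul_eq_mul_div, div_le_iff₀ (by linarith)] at this
      nlinarith
    have h2 : ‖(Real.exp (-(η * (1 - -1))) : ℂ) * (G (L * (-1 - lam)) / (L * f b))‖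
        ≤ 1e-4 / (L * N) := by
      have h3 := h.prim_le _ (le_refl (L * (-1 - lam)))
      have h4 := hdecay (-1) ⟨le_rfl, by norm_num⟩
      rw [norm_div, div_le_iff₀ hfb'] at h4
      have h5 := exp_neg_le_two_div_sq (x := 0.01 * (L * N) * (1 - -1)) (by positivity)
      have h6 : 2 / (0.01 * (L * N) * (1 - -1)) ^ 2 ≤ 2e-5 / N := by
        rw [div_le_div_iff₀ (by positivity) (by linarith)]
        have : 10 ^ 12 ≤ L ^ 2 := by nlinarith
        nlinarith [mul_le_mul this hN1 (by norm_num) (by positivity)]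
      have h7 : Real.exp (-(η * (1 - -1))) ≤ 1 := Real.exp_le_one_iff.2 (by nlinarith)
      rw [norm_mul, norm_div, norm_mul, Complex.norm_real, Complex.norm_real,
        Real.norm_of_nonneg hL0.le, Real.norm_of_nonneg (Real.exp_pos _).le]
      have h8 : ‖G (L * (-1 - lam))‖ ≤ 1e-4 / N * ‖f b‖ := by
        refine h3.trans ?_
        have h9 := h4.trans (mul_le_mul_of_nonneg_right (h5.trans h6) hfb'.le)
        have e : 1e-4 / N * ‖f b‖ = 5 * (2e-5 / N * ‖f b‖) := by ring
        rw [e]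
        linarith
      have h9 : ‖G (L * (-1 - lam))‖ / (L * ‖f b‖) ≤ 1e-4 / (L * N) := by
        rw [div_le_div_iff₀ (by positivity) (by positivity)]
        rw [div_mul_eq_mul_div, le_div_iff₀ (by linarith)] at h8
        nlinarith
      have h10 : 0 ≤ ‖G (L * (-1 - lam))‖ / (L * ‖f b‖) := by positivity
      exact (mul_le_of_le_one_left h10 h7).trans h9
    have h3 := norm_sub_norm_le (G b / (L * f b))
      ((Real.exp (-(η * (1 - -1))) : ℂ) * (G (L * (-1 - lam)) / (L * f b)))
    have e : (3e-4 : ℝ) / (L * N) = 4e-4 / (L * N) - 1e-4 / (L * N) := by ring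
    rw [e]
    linarith

/-! ### The two layers span the solutions of the vorticity equation -/

/-- The mirror image of `EdgeLayer`: a solution of `φ'' = q φ` concentrated at `y = -1`. -/
structure LeftEdgeLayer (η M : ℝ) (q φ φ' : ℝ → ℂ) : Prop where
  deriv : ∀ y, HasDerivAt φ (φ' y) y
  deriv_deriv : ∀ y, HasDerivAt φ' (q y * φ y) y
  decay : ∀ y ∈ Icc (-1 : ℝ) 1, ‖φ y‖ ≤ Real.exp (-(0.01 * M * (1 + y)))
  ne_zero : ∀ y ∈ Icc (-1 : ℝ) 1, φ y ≠ 0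
  re_neg : ∀ y ∈ Icc (-1 : ℝ) 1, (φ' y / φ y).re < 0
  mass : 3e-4 / M ≤ ‖∫ y in (-1 : ℝ)..1, (Real.exp (-(η * (1 + y))) : ℂ) * φ y‖

open ComplexConjugate in
/-- Conjugation and reflection `y ↦ -y` together move the layer to the other wall. -/
lemma EdgeLayer.mirror {η M : ℝ} {q φ φ' : ℝ → ℂ} (h : EdgeLayer η M q φ φ') :
    LeftEdgeLayer η M (fun y => conj (q (-y))) (fun y => conj (φ (-y)))
      (fun y => -conj (φ' (-y))) := by
  have hmem : ∀ y ∈ Icc (-1 : ℝ) 1, -y ∈ Icc (-1 : ℝ) 1 := fun y hy =>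
    ⟨by linarith [hy.2], by linarith [hy.1]⟩
  have hconj : ∀ {u : ℝ → ℂ} {u' : ℂ} {y : ℝ}, HasDerivAt u u' (-y) →
      HasDerivAt (fun y => conj (u (-y))) (-conj u') y := fun {u u' y} hu => by
    have := Complex.conjCLE.toContinuousLinearMap.hasFDerivAt.comp_hasDerivAt y
      (hu.scomp y (hasDerivAt_neg y))
    exact this.congr_deriv (by simp)
  refine ⟨fun y => hconj (h.deriv (-y)), fun y => ?_, fun y hy => ?_, fun y hy => ?_,
    fun y hy => ?_, ?_⟩
  · exact (hconj (h.deriv_deriv (-y))).neg.congr_deriv (by simp)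
  · have := h.decay (-y) (hmem y hy)
    simpa using this
  · simpa using h.ne_zero (-y) (hmem y hy)
  · have := h.re_pos (-y) (hmem y hy)
    rw [neg_div, Complex.neg_re, neg_lt_zero, ← map_div₀, Complex.conj_re]
    exact this
  · refine h.mass.trans_eq ?_
    have e : (fun y : ℝ => (Real.exp (-(η * (1 + y))) : ℂ) * conj (φ (-y)))
        = fun y => (fun x : ℝ => conj ((Real.exp (-(η * (1 - x))) : ℂ) * φ x)) (-y) := by
      ext y
      simp only [map_mul, Complex.conj_ofReal, sub_neg_eq_add]
    rw [e, intervalIntegral.integral_comp_neg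
      (fun x : ℝ => conj ((Real.exp (-(η * (1 - x))) : ℂ) * φ x)), neg_neg,
      intervalIntegral.integral_of_le (by norm_num), intervalIntegral.integral_of_le (by norm_num),
      integral_conj, RCLike.norm_conj]

lemma conj_orrPotential_neg (η a L lam y : ℝ) :
    (starRingEnd ℂ) (orrPotential η a L (-lam) (-y)) = orrPotential η a L lam y := by
  simp only [orrPotential, map_add, map_mul, Complex.conj_ofReal, Complex.conj_I]
  push_cast
  ring

theorem exists_leftEdgeLayer {η a L : ℝ} (hη : 0 ≤ η) (ha0 : 0 ≤ a) (ha : a ≤ 0.0005)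
    (hL : 10 ^ 6 ≤ L) (lam : ℝ) :
    ∃ φ φ', LeftEdgeLayer η (edgeRate η L (1 + lam)) (orrPotential η a L lam) φ φ' := by
  obtain ⟨r, r', h⟩ := exists_edgeLayer hη ha0 ha hL (-lam)
  have := h.mirror
  simp only [conj_orrPotential_neg, sub_neg_eq_add] at this
  exact ⟨_, _, this⟩

/-- The fundamental theorem of calculus on a subinterval of `[-1, 1]`, for one-sided
derivatives. -/
lemma integral_eq_sub_of_hasDerivWithinAt_channel {E : Type*} [NormedAddCommGroup E]
    [NormedSpace ℝ E] [CompleteSpace E] {f f' : ℝ → E}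
    (h : ∀ y ∈ closedChannel, HasDerivWithinAt f (f' y) closedChannel y)
    (hc : ContinuousOn f' closedChannel) {a b : ℝ} (ha : -1 ≤ a) (hab : a ≤ b) (hb : b ≤ 1) :
    ∫ y in a..b, f' y = f b - f a := by
  have hsub : Icc a b ⊆ closedChannel := Icc_subset_Icc ha hb
  refine intervalIntegral.integral_eq_sub_of_hasDerivAt_of_le hab
    (fun y hy => ((h y (hsub hy)).continuousWithinAt).mono hsub) ?_ ?_
  · intro y hy
    exact (h y (hsub (Ioo_subset_Icc_self hy))).hasDerivAt
      (Icc_mem_nhds (by linarith [hy.1]) (by linarith [hy.2]))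
  · exact (hc.mono (by rw [uIcc_of_le hab]; exact hsub)).intervalIntegrable

lemma eq_of_hasDerivWithinAt_zero {f : ℝ → ℂ}
    (h : ∀ y ∈ closedChannel, HasDerivWithinAt f 0 closedChannel y) {y : ℝ}
    (hy : y ∈ closedChannel) : f y = f (-1) := by
  have := integral_eq_sub_of_hasDerivWithinAt_channel (f' := fun _ => 0) h continuousOn_const
    le_rfl hy.1 hy.2
  simp at this
  exact (sub_eq_zero.1 this.symm)

/-- The constancy of the Wronskians expresses any solution through two independent ones. -/
lemma exists_layer_coefficients {η Mp Mm : ℝ} {q p p' m m' w w' : ℝ → ℂ}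
    (hp : EdgeLayer η Mp q p p') (hm : LeftEdgeLayer η Mm q m m')
    (hw : ∀ y ∈ closedChannel, HasDerivWithinAt w (w' y) closedChannel y)
    (hw' : ∀ y ∈ closedChannel, HasDerivWithinAt w' (q y * w y) closedChannel y) :
    ∃ cp cm : ℂ, ∀ y ∈ closedChannel, w y = cp * p y + cm * m y := by
  have hwr : ∀ {u u' v v' : ℝ → ℂ},
      (∀ y ∈ closedChannel, HasDerivWithinAt u (u' y) closedChannel y) →
      (∀ y ∈ closedChannel, HasDerivWithinAt u' (q y * u y) closedChannel y) →
      (∀ y ∈ closedChannel, HasDerivWithinAt v (v' y) closedChannel y) →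
      (∀ y ∈ closedChannel, HasDerivWithinAt v' (q y * v y) closedChannel y) →
      ∀ y ∈ closedChannel, u y * v' y - u' y * v y = u (-1) * v' (-1) - u' (-1) * v (-1) := by
    intro u u' v v' h1 h2 h3 h4 y hy
    refine eq_of_hasDerivWithinAt_zero (f := fun y => u y * v' y - u' y * v y) ?_ hy
    intro t ht
    exact (((h1 t ht).mul (h4 t ht)).sub ((h2 t ht).mul (h3 t ht))).congr_deriv (by ring)
  have p1 := fun y (_ : y ∈ closedChannel) => (hp.deriv y).hasDerivWithinAt (s := closedChannel)
  have p2 := fun y (_ : y ∈ closedChannel) =>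
    (hp.deriv_deriv y).hasDerivWithinAt (s := closedChannel)
  have m1 := fun y (_ : y ∈ closedChannel) => (hm.deriv y).hasDerivWithinAt (s := closedChannel)
  have m2 := fun y (_ : y ∈ closedChannel) =>
    (hm.deriv_deriv y).hasDerivWithinAt (s := closedChannel)
  have h1 := hwr p1 p2 m1 m2
  have h2 := hwr hw hw' m1 m2
  have h3 := hwr p1 p2 hw hw'
  have hΔ : p (-1) * m' (-1) - p' (-1) * m (-1) ≠ 0 := by
    intro h0
    have hI : (-1 : ℝ) ∈ Icc (-1 : ℝ) 1 := ⟨le_rfl, by norm_num⟩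
    have e : p' (-1) / p (-1) = m' (-1) / m (-1) := by
      rw [div_eq_div_iff (hp.ne_zero _ hI) (hm.ne_zero _ hI)]
      linear_combination -h0
    have := hp.re_pos _ hI
    rw [e] at this
    exact absurd this (hm.re_neg _ hI).le.not_gt
  refine ⟨(w (-1) * m' (-1) - w' (-1) * m (-1)) / (p (-1) * m' (-1) - p' (-1) * m (-1)),
    (p (-1) * w' (-1) - p' (-1) * w (-1)) / (p (-1) * m' (-1) - p' (-1) * m (-1)), ?_⟩
  intro y hy
  rw [← h1 y hy] at hΔ ⊢
  rw [← h2 y hy, ← h3 y hy, div_mul_eq_mul_div, div_mul_eq_mul_div, ← add_div, eq_div_iff hΔ]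
  ring

/-! ### The pairings of the layers with the boundary kernels -/

/-- The solution `S` of `S'' = η² S` with `S (-1) = 0` which is of size one at `y = 1`. -/
noncomputable def wallKernel (η y : ℝ) : ℝ := Real.exp (-(η * (1 - y))) - Real.exp (-(η * (3 + y)))

/-- The derivative of `wallKernel`. -/
noncomputable def wallKernelDeriv (η y : ℝ) : ℝ :=
  η * (Real.exp (-(η * (1 - y))) + Real.exp (-(η * (3 + y))))

lemma hasDerivAt_wallKernel (η y : ℝ) : HasDerivAt (wallKernel η) (wallKernelDeriv η y) y := by
  have h1 := (((hasDerivAt_id y).const_sub 1).const_mul η).neg.exp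
  have h2 := (((hasDerivAt_id y).const_add 3).const_mul η).neg.exp
  refine (h1.sub h2).congr_deriv ?_
  simp [wallKernelDeriv]
  ring

lemma hasDerivAt_wallKernelDeriv (η y : ℝ) :
    HasDerivAt (wallKernelDeriv η) (η ^ 2 * wallKernel η y) y := by
  have h1 := (((hasDerivAt_id y).const_sub 1).const_mul η).neg.exp
  have h2 := (((hasDerivAt_id y).const_add 3).const_mul η).neg.exp
  refine ((h1.add h2).const_mul η).congr_deriv ?_
  simp [wallKernel]
  ring

lemma continuous_wallKernel (η : ℝ) : Continuous (wallKernel η) := by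
  unfold wallKernel; fun_prop

lemma wallKernel_nonneg {η y : ℝ} (hη : 0 ≤ η) (hy : -1 ≤ y) : 0 ≤ wallKernel η y := by
  rw [wallKernel, sub_nonneg]
  gcongr
  linarith

lemma wallKernel_le_one {η y : ℝ} (hη : 0 ≤ η) (hy : y ≤ 1) : wallKernel η y ≤ 1 := by
  rw [wallKernel]
  have h1 : Real.exp (-(η * (1 - y))) ≤ 1 := Real.exp_le_one_iff.2 (by nlinarith)
  have h2 := Real.exp_pos (-(η * (3 + y)))
  linarith

lemma mul_exp_neg_le_one (x : ℝ) : x * Real.exp (-x) ≤ 1 := by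
  rw [Real.exp_neg, ← div_eq_mul_inv, div_le_one (Real.exp_pos x)]
  linarith [Real.add_one_le_exp x]

/-- `exp x - exp (-x) ≤ 2 x exp x`. -/
lemma exp_sub_exp_neg_le (x : ℝ) : Real.exp x - Real.exp (-x) ≤ 2 * x * Real.exp x := by
  have h1 := Real.add_one_le_exp (-(2 * x))
  have h2 : Real.exp (-x) = Real.exp x * Real.exp (-(2 * x)) := by
    rw [← Real.exp_add]; congr 1; ring
  rw [h2]
  nlinarith [Real.exp_pos x]

/-- The kernel vanishes linearly at `y = -1`, uniformly in `η`. -/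
lemma wallKernel_le {η y : ℝ} (hη : 0 ≤ η) (hy : y ∈ Icc (-1 : ℝ) 1) :
    wallKernel η y ≤ 2 * (1 + y) := by
  rcases le_total 0 y with h | h
  · linarith [wallKernel_le_one hη hy.2]
  · have h1 := exp_sub_exp_neg_le (η * (1 + y))
    have e : wallKernel η y = Real.exp (-(2 * η)) *
        (Real.exp (η * (1 + y)) - Real.exp (-(η * (1 + y)))) := by
      rw [wallKernel, mul_sub (Real.exp _), ← Real.exp_add, ← Real.exp_add]
      congr 2 <;> ring
    have h2 : Real.exp (-(2 * η)) * Real.exp (η * (1 + y)) ≤ Real.exp (-η) := by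
      rw [← Real.exp_add]
      gcongr
      nlinarith
    have h3 := mul_exp_neg_le_one η
    have h4 := Real.exp_pos (-(2 * η))
    have hy1 : 0 ≤ 1 + y := by linarith [hy.1]
    rw [e]
    calc _ ≤ Real.exp (-(2 * η)) * (2 * (η * (1 + y)) * Real.exp (η * (1 + y))) := by gcongr
      _ = 2 * (1 + y) * (η * (Real.exp (-(2 * η)) * Real.exp (η * (1 + y)))) := by ring
      _ ≤ 2 * (1 + y) * (η * Real.exp (-η)) := by gcongr
      _ ≤ 2 * (1 + y) * 1 := by gcongr
      _ = _ := mul_one _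

/-- Near `y = 1` the kernel is `(1 - exp (-4 η)) exp (-η (1 - y))` up to a linear error. -/
lemma abs_wallKernel_sub_le {η y : ℝ} (hη : 0 ≤ η) (hy : y ∈ Icc (-1 : ℝ) 1) :
    |wallKernel η y - (1 - Real.exp (-(4 * η))) * Real.exp (-(η * (1 - y)))| ≤ 2 * (1 - y) := by
  have h1 := exp_sub_exp_neg_le (η * (1 - y))
  have hy1 : 0 ≤ 1 - y := by linarith [hy.2]
  have e : wallKernel η y - (1 - Real.exp (-(4 * η))) * Real.exp (-(η * (1 - y)))
      = -(Real.exp (-(4 * η)) * (Real.exp (η * (1 - y)) - Real.exp (-(η * (1 - y))))) := by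
    have e1 : Real.exp (-(η * (3 + y))) = Real.exp (-(4 * η)) * Real.exp (η * (1 - y)) := by
      rw [← Real.exp_add]; congr 1; ring
    rw [wallKernel, e1]; ring
  have h0 : 0 ≤ Real.exp (η * (1 - y)) - Real.exp (-(η * (1 - y))) := by
    rw [sub_nonneg]; gcongr; nlinarith [mul_nonneg hη hy1]
  have h2 : Real.exp (-(4 * η)) * Real.exp (η * (1 - y)) ≤ Real.exp (-η) := by
    rw [← Real.exp_add]
    gcongr
    nlinarith [mul_nonneg hη (by linarith [hy.1] : 0 ≤ 1 + y)]
  have h3 := mul_exp_neg_le_one η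
  rw [e, abs_neg, abs_of_nonneg (by positivity)]
  calc _ ≤ Real.exp (-(4 * η)) * (2 * (η * (1 - y)) * Real.exp (η * (1 - y))) := by gcongr
    _ = 2 * (1 - y) * (η * (Real.exp (-(4 * η)) * Real.exp (η * (1 - y)))) := by ring
    _ ≤ 2 * (1 - y) * (η * Real.exp (-η)) := by gcongr
    _ ≤ 2 * (1 - y) * 1 := by gcongr
    _ = _ := mul_one _

lemma integral_exp_le {μ : ℝ} (hμ : 0 < μ) :
    ∫ y in (-1 : ℝ)..1, Real.exp (-(μ * (1 - y))) ≤ 1 / μ := by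
  have hd : ∀ y, HasDerivAt (fun y : ℝ => Real.exp (-(μ * (1 - y))) / μ)
      (Real.exp (-(μ * (1 - y)))) y := fun y => by
    have h1 := (((hasDerivAt_id y).const_sub 1).const_mul μ).neg.exp.div_const μ
    refine h1.congr_deriv ?_
    simp
    field_simp
  rw [intervalIntegral.integral_eq_sub_of_hasDerivAt (fun y _ => hd y)
    (Continuous.intervalIntegrable (by fun_prop) _ _)]
  have : 0 < Real.exp (-(μ * (1 - -1))) / μ := by positivity
  simp only [sub_self, mul_zero, neg_zero, Real.exp_zero]
  linarith

lemma mul_exp_neg_le_half {t μ : ℝ} (hμ : 0 < μ) :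
    t * Real.exp (-(μ * t)) ≤ 2 / μ * Real.exp (-(μ / 2 * t)) := by
  have h1 := mul_exp_neg_le_one (μ / 2 * t)
  have e : Real.exp (-(μ * t)) = Real.exp (-(μ / 2 * t)) * Real.exp (-(μ / 2 * t)) := by
    rw [← Real.exp_add]; congr 1; ring
  have h2 := Real.exp_pos (-(μ / 2 * t))
  rw [e]
  generalize Real.exp (-(μ / 2 * t)) = x at *
  rw [div_mul_eq_mul_div, le_div_iff₀ hμ]
  nlinarith

lemma integral_mul_exp_le {μ : ℝ} (hμ : 0 < μ) :
    ∫ y in (-1 : ℝ)..1, (1 - y) * Real.exp (-(μ * (1 - y))) ≤ 4 / μ ^ 2 := by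
  calc _ ≤ ∫ y in (-1 : ℝ)..1, 2 / μ * Real.exp (-(μ / 2 * (1 - y))) := by
        refine intervalIntegral.integral_mono_on (by norm_num)
          (Continuous.intervalIntegrable (by fun_prop) _ _)
          (Continuous.intervalIntegrable (by fun_prop) _ _) fun y _ => mul_exp_neg_le_half hμ
    _ = 2 / μ * ∫ y in (-1 : ℝ)..1, Real.exp (-(μ / 2 * (1 - y))) :=
        intervalIntegral.integral_const_mul _ _
    _ ≤ 2 / μ * (1 / (μ / 2)) := by gcongr; exact integral_exp_le (by positivity)
    _ = 4 / μ ^ 2 := by field_simp; norm_num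

lemma EdgeLayer.continuous {η M : ℝ} {q φ φ' : ℝ → ℂ} (h : EdgeLayer η M q φ φ') :
    Continuous φ := continuous_iff_continuousAt.2 fun y => (h.deriv y).continuousAt

lemma EdgeLayer.integral_mul_le {η M r : ℝ} {q φ φ' : ℝ → ℂ} (h : EdgeLayer η M q φ φ')
    (hM : 0 < M) (hr : 0 ≤ r) {K : ℝ → ℝ}
    (hK : ∀ y ∈ Icc (-1 : ℝ) 1, |K y| ≤ r * (1 - y)) :
    ‖∫ y in (-1 : ℝ)..1, (K y : ℂ) * φ y‖ ≤ r * (4e4 / M ^ 2) := by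
  calc _ ≤ ∫ y in (-1 : ℝ)..1, r * ((1 - y) * Real.exp (-(0.01 * M * (1 - y)))) := by
        refine intervalIntegral.norm_integral_le_of_norm_le (by norm_num)
          (Filter.Eventually.of_forall fun y hy => ?_)
          (Continuous.intervalIntegrable (by fun_prop) _ _)
        have hy' := Ioc_subset_Icc_self hy
        rw [norm_mul, Complex.norm_real, Real.norm_eq_abs, ← mul_assoc]
        exact mul_le_mul (hK y hy') (h.decay y hy') (norm_nonneg _)
          (mul_nonneg hr (by linarith [hy.2]))
    _ = r * ∫ y in (-1 : ℝ)..1, (1 - y) * Real.exp (-(0.01 * M * (1 - y))) :=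
        intervalIntegral.integral_const_mul _ _
    _ ≤ r * (4 / (0.01 * M) ^ 2) := by gcongr; exact integral_mul_exp_le (by positivity)
    _ = _ := by field_simp; ring

/-- The kernel of the opposite wall vanishes linearly at `y = 1`, so its pairing with the layer is of
second order in the width. -/
lemma EdgeLayer.pairing_far_le {η M : ℝ} {q φ φ' : ℝ → ℂ} (h : EdgeLayer η M q φ φ')
    (hη : 0 ≤ η) (hM : 0 < M) :
    ‖∫ y in (-1 : ℝ)..1, (wallKernel η (-y) : ℂ) * φ y‖ ≤ 8e4 / M ^ 2 := by
  refine (h.integral_mul_le hM zero_le_two (K := fun y => wallKernel η (-y)) ?_).trans_eq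
    (by ring)
  intro y hy
  rw [abs_of_nonneg (wallKernel_nonneg hη (by linarith [hy.2]))]
  have := wallKernel_le hη (y := -y) ⟨by linarith [hy.2], by linarith [hy.1]⟩
  linarith

lemma EdgeLayer.pairing_near_le {η M : ℝ} {q φ φ' : ℝ → ℂ} (h : EdgeLayer η M q φ φ')
    (hη : 0 ≤ η) (hM : 0 < M) :
    ‖∫ y in (-1 : ℝ)..1, (wallKernel η y : ℂ) * φ y‖ ≤ 100 / M := by
  calc _ ≤ ∫ y in (-1 : ℝ)..1, Real.exp (-(0.01 * M * (1 - y))) := by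
        refine intervalIntegral.norm_integral_le_of_norm_le (by norm_num)
          (Filter.Eventually.of_forall fun y hy => ?_)
          (Continuous.intervalIntegrable (by fun_prop) _ _)
        have hy' := Ioc_subset_Icc_self hy
        rw [norm_mul, Complex.norm_real, Real.norm_of_nonneg (wallKernel_nonneg hη hy'.1)]
        exact (mul_le_of_le_one_left (norm_nonneg _) (wallKernel_le_one hη hy'.2)).trans
          (h.decay y hy')
    _ ≤ 1 / (0.01 * M) := integral_exp_le (by positivity)
    _ = _ := by field_simp; norm_num

/-- The kernel of the own wall differs from `(1 - exp (-4 η)) exp (-η (1 - y))` by a term that vanishes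
linearly at `y = 1`, so the mass of the layer carries over. -/
lemma EdgeLayer.pairing_near_ge {η M : ℝ} {q φ φ' : ℝ → ℂ} (h : EdgeLayer η M q φ φ')
    (hη : 1 ≤ η) (hM : 10 ^ 10 ≤ M) :
    2e-4 / M ≤ ‖∫ y in (-1 : ℝ)..1, (wallKernel η y : ℂ) * φ y‖ := by
  have hM0 : 0 < M := by linarith
  set δ := 1 - Real.exp (-(4 * η)) with hδ
  have hδ1 : 0.9 ≤ δ := by
    have h1 := exp_neg_le_two_div_sq (x := 4 * η) (by linarith)
    have h2 := Real.exp_le_exp.2 (by linarith : -(4 * η) ≤ -4)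
    have h3 : Real.exp (-4) ≤ 0.1 := by
      have h4 := Real.exp_one_gt_d9
      rw [show (-4 : ℝ) = -(1 + 1 + 1 + 1) by norm_num, Real.exp_neg, Real.exp_add, Real.exp_add,
        Real.exp_add, inv_le_comm₀ (by positivity) (by norm_num)]
      have h5 : (2 : ℝ) ≤ Real.exp 1 := by linarith
      calc (0.1 : ℝ)⁻¹ ≤ 2 * 2 * 2 * 2 := by norm_num
        _ ≤ _ := by gcongr
    linarith
  have hc := h.continuous
  have hk := continuous_wallKernel η
  have h1 := h.integral_mul_le hM0 zero_le_two
    (K := fun y => wallKernel η y - δ * Real.exp (-(η * (1 - y)))) fun y hy =>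
      abs_wallKernel_sub_le (by linarith) hy
  have e : ∫ y in (-1 : ℝ)..1,
      ((wallKernel η y - δ * Real.exp (-(η * (1 - y))) : ℝ) : ℂ) * φ y
      = (∫ y in (-1 : ℝ)..1, (wallKernel η y : ℂ) * φ y)
        - δ * ∫ y in (-1 : ℝ)..1, (Real.exp (-(η * (1 - y))) : ℂ) * φ y := by
    rw [← intervalIntegral.integral_const_mul, ← intervalIntegral.integral_sub]
    · refine intervalIntegral.integral_congr fun y _ => ?_
      push_cast; ring
    · exact Continuous.intervalIntegrable
        ((Complex.continuous_ofReal.comp hk).mul hc) _ _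
    · exact Continuous.intervalIntegrable
        (continuous_const.mul ((Complex.continuous_ofReal.comp (by fun_prop)).mul hc)) _ _
  rw [e] at h1
  have h2 := norm_sub_norm_le (δ * ∫ y in (-1 : ℝ)..1, (Real.exp (-(η * (1 - y))) : ℂ) * φ y)
    (∫ y in (-1 : ℝ)..1, (wallKernel η y : ℂ) * φ y)
  rw [norm_sub_rev, norm_mul, Complex.norm_real, Real.norm_of_nonneg (by linarith)] at h2
  have h3 : 2.7e-4 / M ≤ δ * ‖∫ y in (-1 : ℝ)..1, (Real.exp (-(η * (1 - y))) : ℂ) * φ y‖ := by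
    calc 2.7e-4 / M = 0.9 * (3e-4 / M) := by ring
      _ ≤ _ := by gcongr; exact h.mass
  have h4 : 2 * (4e4 / M ^ 2) ≤ 0.7e-4 / M := by
    rw [← mul_div_assoc, div_le_div_iff₀ (by positivity) hM0]
    nlinarith
  have e2 : 2e-4 / M = 2.7e-4 / M - 0.7e-4 / M := by ring
  rw [e2]
  linarith

open ComplexConjugate in
lemma norm_integral_mirror (K : ℝ → ℝ) (φ : ℝ → ℂ) :
    ‖∫ y in (-1 : ℝ)..1, (K y : ℂ) * conj (φ (-y))‖ = ‖∫ y in (-1 : ℝ)..1, (K (-y) : ℂ) * φ y‖ := by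
  have e : (fun y : ℝ => (K y : ℂ) * conj (φ (-y)))
      = fun y => (fun x : ℝ => conj ((K (-x) : ℂ) * φ x)) (-y) := by
    ext y
    simp only [map_mul, Complex.conj_ofReal, neg_neg]
  rw [e, intervalIntegral.integral_comp_neg (fun x : ℝ => conj ((K (-x) : ℂ) * φ x)), neg_neg,
    intervalIntegral.integral_of_le (by norm_num), intervalIntegral.integral_of_le (by norm_num),
    integral_conj, RCLike.norm_conj]

open ComplexConjugate in
/-- The converse of `EdgeLayer.mirror`; it transfers the pairings to the other wall. -/
lemma LeftEdgeLayer.mirror {η M : ℝ} {q φ φ' : ℝ → ℂ} (h : LeftEdgeLayer η M q φ φ') :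
    EdgeLayer η M (fun y => conj (q (-y))) (fun y => conj (φ (-y)))
      (fun y => -conj (φ' (-y))) := by
  have hmem : ∀ y ∈ Icc (-1 : ℝ) 1, -y ∈ Icc (-1 : ℝ) 1 := fun y hy =>
    ⟨by linarith [hy.2], by linarith [hy.1]⟩
  have hconj : ∀ {u : ℝ → ℂ} {u' : ℂ} {y : ℝ}, HasDerivAt u u' (-y) →
      HasDerivAt (fun y => conj (u (-y))) (-conj u') y := fun {u u' y} hu => by
    have := Complex.conjCLE.toContinuousLinearMap.hasFDerivAt.comp_hasDerivAt y
      (hu.scomp y (hasDerivAt_neg y))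
    exact this.congr_deriv (by simp)
  refine ⟨fun y => hconj (h.deriv (-y)), fun y => ?_, fun y hy => ?_, fun y hy => ?_,
    fun y hy => ?_, ?_⟩
  · exact (hconj (h.deriv_deriv (-y))).neg.congr_deriv (by simp)
  · have := h.decay (-y) (hmem y hy)
    simpa [← sub_eq_add_neg] using this
  · simpa using h.ne_zero (-y) (hmem y hy)
  · have := h.re_neg (-y) (hmem y hy)
    rw [neg_div, Complex.neg_re, neg_pos, ← map_div₀, Complex.conj_re]
    exact this
  · refine h.mass.trans_eq ?_
    rw [norm_integral_mirror]
    simp only [sub_neg_eq_add]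

lemma LeftEdgeLayer.pairing_far_le {η M : ℝ} {q φ φ' : ℝ → ℂ} (h : LeftEdgeLayer η M q φ φ')
    (hη : 0 ≤ η) (hM : 0 < M) :
    ‖∫ y in (-1 : ℝ)..1, (wallKernel η y : ℂ) * φ y‖ ≤ 8e4 / M ^ 2 := by
  have := h.mirror.pairing_far_le hη hM
  rw [norm_integral_mirror (fun y => wallKernel η (-y))] at this
  simpa only [neg_neg] using this

lemma LeftEdgeLayer.pairing_near_le {η M : ℝ} {q φ φ' : ℝ → ℂ} (h : LeftEdgeLayer η M q φ φ')
    (hη : 0 ≤ η) (hM : 0 < M) :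
    ‖∫ y in (-1 : ℝ)..1, (wallKernel η (-y) : ℂ) * φ y‖ ≤ 100 / M := by
  have := h.mirror.pairing_near_le hη hM
  rwa [norm_integral_mirror] at this

lemma LeftEdgeLayer.pairing_near_ge {η M : ℝ} {q φ φ' : ℝ → ℂ} (h : LeftEdgeLayer η M q φ φ')
    (hη : 1 ≤ η) (hM : 10 ^ 10 ≤ M) :
    2e-4 / M ≤ ‖∫ y in (-1 : ℝ)..1, (wallKernel η (-y) : ℂ) * φ y‖ := by
  have := h.mirror.pairing_near_ge hη hM
  rwa [norm_integral_mirror] at this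

lemma LeftEdgeLayer.continuous {η M : ℝ} {q φ φ' : ℝ → ℂ} (h : LeftEdgeLayer η M q φ φ') :
    Continuous φ := continuous_iff_continuousAt.2 fun y => (h.deriv y).continuousAt

/-! ### The stream function and the boundary conditions -/

/-- `W'' - η² W = w` on `[-1, 1]`, written as a first order system. -/
structure IsStream (η : ℝ) (w W W' : ℝ → ℂ) : Prop where
  deriv : ∀ y ∈ closedChannel, HasDerivWithinAt W (W' y) closedChannel y
  deriv_deriv : ∀ y ∈ closedChannel,
    HasDerivWithinAt W' ((η : ℂ) ^ 2 * W y + w y) closedChannel y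

lemma IsStream.continuousOn {η : ℝ} {w W W' : ℝ → ℂ} (h : IsStream η w W W') :
    ContinuousOn W closedChannel := fun y hy => (h.deriv y hy).continuousWithinAt

lemma IsStream.continuousOn_deriv {η : ℝ} {w W W' : ℝ → ℂ} (h : IsStream η w W W') :
    ContinuousOn W' closedChannel := fun y hy => (h.deriv_deriv y hy).continuousWithinAt

/-- Green's identity for two stream functions. -/
lemma IsStream.green {η : ℝ} {w W W' v V V' : ℝ → ℂ} (h : IsStream η w W W')
    (hV : IsStream η v V V') (hw : ContinuousOn w closedChannel)
    (hv : ContinuousOn v closedChannel) :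
    ∫ y in (-1 : ℝ)..1, (V y * w y - v y * W y)
      = (V 1 * W' 1 - V' 1 * W 1) - (V (-1) * W' (-1) - V' (-1) * W (-1)) := by
  refine integral_eq_sub_of_hasDerivWithinAt_channel
    (f := fun y => V y * W' y - V' y * W y) (fun y hy => ?_)
    ((hV.continuousOn.mul hw).sub (hv.mul h.continuousOn)) le_rfl (by norm_num) le_rfl
  exact (((hV.deriv y hy).mul (h.deriv_deriv y hy)).sub
    ((hV.deriv_deriv y hy).mul (h.deriv y hy))).congr_deriv
      (by simp only [Pi.sub_apply, Pi.mul_apply]; ring)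

lemma isStream_wallKernel (η : ℝ) : IsStream η 0 (fun y => (wallKernel η y : ℂ))
    (fun y => (wallKernelDeriv η y : ℂ)) :=
  ⟨fun y _ => (hasDerivAt_wallKernel η y).ofReal_comp.hasDerivWithinAt, fun y _ =>
    ((hasDerivAt_wallKernelDeriv η y).ofReal_comp.hasDerivWithinAt).congr_deriv
      (by simp)⟩

lemma isStream_wallKernel_neg (η : ℝ) : IsStream η 0 (fun y => (wallKernel η (-y) : ℂ))
    (fun y => -(wallKernelDeriv η (-y) : ℂ)) :=
  ⟨fun y _ => by
    have := ((hasDerivAt_wallKernel η (-y)).scomp y (hasDerivAt_neg y)).ofReal_comp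
    exact this.hasDerivWithinAt.congr_deriv (by simp),
   fun y _ => by
    have := ((hasDerivAt_wallKernelDeriv η (-y)).scomp y (hasDerivAt_neg y)).ofReal_comp.neg
    exact this.hasDerivWithinAt.congr_deriv (by simp)⟩

lemma wallKernel_neg_one (η : ℝ) : wallKernel η (-1) = 0 := by
  rw [wallKernel]; ring_nf

lemma wallKernel_one (η : ℝ) : wallKernel η 1 = 1 - Real.exp (-(4 * η)) := by
  rw [wallKernel, sub_self, mul_zero, neg_zero, Real.exp_zero]; ring_nf

lemma wallKernelDeriv_neg_one (η : ℝ) : wallKernelDeriv η (-1) = 2 * η * Real.exp (-(2 * η)) := by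
  rw [wallKernelDeriv]; ring_nf

lemma wallKernel_one_bounds {η : ℝ} (hη : 0 < η) : 0 < wallKernel η 1 ∧ wallKernel η 1 ≤ 1 := by
  refine ⟨?_, wallKernel_le_one hη.le le_rfl⟩
  rw [wallKernel_one, sub_pos, Real.exp_lt_one_iff]
  linarith

lemma IsStream.integral_wallKernel {η : ℝ} {w W W' : ℝ → ℂ} (h : IsStream η w W W')
    (hw : ContinuousOn w closedChannel) (h1 : W (-1) = 0) :
    ∫ y in (-1 : ℝ)..1, (wallKernel η y : ℂ) * w y
      = wallKernel η 1 * W' 1 - wallKernelDeriv η 1 * W 1 := by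
  have := h.green (isStream_wallKernel η) hw continuousOn_const
  simpa [wallKernel_neg_one, h1] using this

lemma IsStream.integral_wallKernel_neg {η : ℝ} {w W W' : ℝ → ℂ} (h : IsStream η w W W')
    (hw : ContinuousOn w closedChannel) (h1 : W (-1) = 0) (h2 : W' (-1) = 0) :
    ∫ y in (-1 : ℝ)..1, (wallKernel η (-y) : ℂ) * w y = wallKernelDeriv η (-1) * W 1 := by
  have := h.green (isStream_wallKernel_neg η) hw continuousOn_const
  simpa [wallKernel_neg_one, h1, h2] using this

/-- The initial value problem for the stream function, by factoring
`∂² - η² = (∂ - η) (∂ + η)`. -/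
lemma exists_isStream {w : ℝ → ℂ} (hw : Continuous w) (η : ℝ) (x0 x1 : ℂ) :
    ∃ W W', IsStream η w W W' ∧ W (-1) = x0 ∧ W' (-1) = x1 := by
  obtain ⟨Z, hZ0, hZ⟩ := exists_damped_primitive hw (-η) (-1) (x1 + η * x0)
  have hZc : Continuous Z := continuous_iff_continuousAt.2 fun s => (hZ s).continuousAt
  obtain ⟨W, hW0, hW⟩ := exists_damped_primitive hZc η (-1) x0
  refine ⟨W, fun y => Z y - η * W y, ⟨fun y _ => (hW y).hasDerivWithinAt, fun y _ => ?_⟩, hW0, ?_⟩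
  · refine ((hZ y).sub ((hW y).const_mul (η : ℂ))).hasDerivWithinAt.congr_deriv ?_
    push_cast; ring
  · simp only [hZ0, hW0]; ring

/-- The data of a corrector of the wall `y = 1` with Neumann datum `b`, for a general vorticity
equation `w'' = q w`. -/
structure IsCorrector (η : ℝ) (q : ℝ → ℂ) (b : ℂ) (w w' W W' : ℝ → ℂ) : Prop where
  deriv_w : ∀ y ∈ closedChannel, HasDerivWithinAt w (w' y) closedChannel y
  deriv_deriv_w : ∀ y ∈ closedChannel, HasDerivWithinAt w' (q y * w y) closedChannel y
  stream : IsStream η w W W'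
  W_neg_one : W (-1) = 0
  W_one : W 1 = 0
  W'_neg_one : W' (-1) = 0
  W'_one : W' 1 = b

lemma IsCorrector.continuousOn {η : ℝ} {q : ℝ → ℂ} {b : ℂ} {w w' W W' : ℝ → ℂ}
    (h : IsCorrector η q b w w' W W') : ContinuousOn w closedChannel :=
  fun y hy => (h.deriv_w y hy).continuousWithinAt

/-- The product of the diagonal entries dominates, because the layers are thin. -/
lemma det_ge {App Apm Amp Amm : ℂ} {Mp Mm : ℝ} (hMp : 10 ^ 10 ≤ Mp) (hMm : 10 ^ 10 ≤ Mm)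
    (hpp : 2e-4 / Mp ≤ ‖App‖) (hmm : 2e-4 / Mm ≤ ‖Amm‖)
    (hpm : ‖Apm‖ ≤ 8e4 / Mm ^ 2) (hmp : ‖Amp‖ ≤ 8e4 / Mp ^ 2) :
    2e-8 / (Mp * Mm) ≤ ‖App * Amm - Apm * Amp‖ := by
  have hMp0 : 0 < Mp := by linarith
  have hMm0 : 0 < Mm := by linarith
  have h1 : 4e-8 / (Mp * Mm) ≤ ‖App * Amm‖ := by
    rw [norm_mul]
    calc (4e-8 : ℝ) / (Mp * Mm) = 2e-4 / Mp * (2e-4 / Mm) := by field_simp; norm_num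
      _ ≤ _ := by gcongr
  have h2 : ‖Apm * Amp‖ ≤ 2e-8 / (Mp * Mm) := by
    rw [norm_mul]
    calc ‖Apm‖ * ‖Amp‖ ≤ 8e4 / Mm ^ 2 * (8e4 / Mp ^ 2) := by gcongr
      _ ≤ _ := by
        rw [div_mul_div_comm, div_le_div_iff₀ (by positivity) (by positivity)]
        have h3 : (10 : ℝ) ^ 20 ≤ Mp * Mm := by
          calc (10 : ℝ) ^ 20 = 10 ^ 10 * 10 ^ 10 := by norm_num
            _ ≤ _ := by gcongr
        have e : Mm ^ 2 * Mp ^ 2 = Mp * Mm * (Mp * Mm) := by ring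
        rw [e]
        nlinarith
  have h3 := norm_sub_norm_le (App * Amm) (Apm * Amp)
  have e : 2e-8 / (Mp * Mm) = 4e-8 / (Mp * Mm) - 2e-8 / (Mp * Mm) := by ring
  rw [e]
  linarith

lemma integral_mul_combination {K : ℝ → ℝ} (hK : Continuous K) {p m : ℝ → ℂ} (hp : Continuous p)
    (hm : Continuous m) (cp cm : ℂ) :
    ∫ y in (-1 : ℝ)..1, (K y : ℂ) * (cp * p y + cm * m y)
      = cp * (∫ y in (-1 : ℝ)..1, (K y : ℂ) * p y) + cm * ∫ y in (-1 : ℝ)..1, (K y : ℂ) * m y := by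
  rw [← intervalIntegral.integral_const_mul, ← intervalIntegral.integral_const_mul,
    ← intervalIntegral.integral_add]
  · exact intervalIntegral.integral_congr fun y _ => by ring
  · exact (continuous_const.mul ((Complex.continuous_ofReal.comp hK).mul hp)).intervalIntegrable _ _
  · exact (continuous_const.mul ((Complex.continuous_ofReal.comp hK).mul hm)).intervalIntegrable _ _

section System

variable {η Mp Mm : ℝ} {q p p' m m' : ℝ → ℂ}

/-- The 2 × 2 system for the coefficients of a corrector is diagonally dominant: each layer
pairs with the kernel of the opposite wall only to second order in its width. -/
lemma IsCorrector.exists_coefficients (hp : EdgeLayer η Mp q p p') (hm : LeftEdgeLayer η Mm q m m')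
    (hη : 1 ≤ η) (hMp : 10 ^ 10 ≤ Mp) (hMm : 10 ^ 10 ≤ Mm) {b : ℂ} {w w' W W' : ℝ → ℂ}
    (h : IsCorrector η q b w w' W W') :
    ∃ cp cm : ℂ, (∀ y ∈ closedChannel, w y = cp * p y + cm * m y) ∧
      ‖cp‖ ≤ 5e9 * Mp * ‖b‖ ∧ ‖cm‖ ≤ 4e12 * (Mm / Mp) * ‖b‖ := by
  have hη0 : 0 ≤ η := by linarith
  have hMp0 : 0 < Mp := by linarith
  have hMm0 : 0 < Mm := by linarith
  obtain ⟨cp, cm, hw⟩ := exists_layer_coefficients hp hm h.deriv_w h.deriv_deriv_w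
  have hk := continuous_wallKernel η
  have hk' : Continuous fun y => wallKernel η (-y) := hk.comp continuous_neg
  have e1 := h.stream.integral_wallKernel h.continuousOn h.W_neg_one
  have e2 := h.stream.integral_wallKernel_neg h.continuousOn h.W_neg_one h.W'_neg_one
  have hcongr : ∀ K : ℝ → ℝ, ∫ y in (-1 : ℝ)..1, (K y : ℂ) * w y
      = ∫ y in (-1 : ℝ)..1, (K y : ℂ) * (cp * p y + cm * m y) := fun K => by
    refine intervalIntegral.integral_congr fun y hy => ?_
    rw [uIcc_of_le (by norm_num)] at hy
    simp only [hw y hy]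
  rw [hcongr, integral_mul_combination hk hp.continuous hm.continuous, h.W_one, h.W'_one, mul_zero,
    sub_zero] at e1
  rw [hcongr (fun y => wallKernel η (-y)), integral_mul_combination hk' hp.continuous hm.continuous,
    h.W_one, mul_zero] at e2
  have b1 := hp.pairing_near_ge hη hMp
  have b2 := hm.pairing_near_ge hη hMm
  have b3 := hm.pairing_far_le hη0 hMm0
  have b4 := hp.pairing_far_le hη0 hMp0
  have b5 := hm.pairing_near_le hη0 hMm0
  have hdet := det_ge hMp hMm b1 b2 b3 b4
  obtain ⟨hδ0, hδ1⟩ := wallKernel_one_bounds (by linarith : 0 < η)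
  generalize (∫ y in (-1 : ℝ)..1, (wallKernel η y : ℂ) * p y) = App at *
  generalize (∫ y in (-1 : ℝ)..1, (wallKernel η y : ℂ) * m y) = Apm at *
  generalize (∫ y in (-1 : ℝ)..1, (wallKernel η (-y) : ℂ) * p y) = Amp at *
  generalize (∫ y in (-1 : ℝ)..1, (wallKernel η (-y) : ℂ) * m y) = Amm at *
  generalize wallKernel η 1 = δ at *
  have f1 : cp * (App * Amm - Apm * Amp) = δ * b * Amm := by linear_combination Amm * e1 - Apm * e2
  have f2 : cm * (App * Amm - Apm * Amp) = -(δ * b * Amp) := by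
    linear_combination App * e2 - Amp * e1
  have n1 := congrArg norm f1
  have n2 := congrArg norm f2
  rw [norm_neg] at n2
  simp only [norm_mul, Complex.norm_real, Real.norm_of_nonneg hδ0.le] at n1 n2
  have hb := norm_nonneg b
  have hδb : δ * ‖b‖ ≤ ‖b‖ := mul_le_of_le_one_left hb hδ1
  refine ⟨cp, cm, hw, ?_, ?_⟩
  · have h1 : ‖cp‖ * (2e-8 / (Mp * Mm)) ≤ ‖b‖ * (100 / Mm) := by
      calc _ ≤ ‖cp‖ * ‖App * Amm - Apm * Amp‖ := by gcongr
        _ = δ * ‖b‖ * ‖Amm‖ := by simpa using n1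
        _ ≤ _ := by gcongr
    rw [← mul_div_assoc, ← mul_div_assoc, div_le_div_iff₀ (by positivity) hMm0] at h1
    have h2 : ‖cp‖ * 2e-8 ≤ ‖b‖ * 100 * Mp := by
      refine le_of_mul_le_mul_right ?_ hMm0
      linarith
    linarith
  · have h1 : ‖cm‖ * (2e-8 / (Mp * Mm)) ≤ ‖b‖ * (8e4 / Mp ^ 2) := by
      calc _ ≤ ‖cm‖ * ‖App * Amm - Apm * Amp‖ := by gcongr
        _ = δ * ‖b‖ * ‖Amp‖ := by simpa using n2
        _ ≤ _ := by gcongr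
    rw [← mul_div_assoc, ← mul_div_assoc, div_le_div_iff₀ (by positivity) (by positivity)] at h1
    have h2 : ‖cm‖ * 2e-8 * Mp ≤ ‖b‖ * 8e4 * Mm := by
      refine le_of_mul_le_mul_right ?_ hMp0
      linarith
    have e : 4e12 * (Mm / Mp) * ‖b‖ = (4e12 * Mm * ‖b‖) / Mp := by ring
    rw [e, le_div_iff₀ hMp0]
    linarith

lemma exists_isCorrector (hp : EdgeLayer η Mp q p p') (hm : LeftEdgeLayer η Mm q m m')
    (hη : 1 ≤ η) (hMp : 10 ^ 10 ≤ Mp) (hMm : 10 ^ 10 ≤ Mm) (b : ℂ) :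
    ∃ w w' W W', IsCorrector η q b w w' W W' := by
  have hη0 : 0 ≤ η := by linarith
  have hMp0 : 0 < Mp := by linarith
  have hMm0 : 0 < Mm := by linarith
  have hk := continuous_wallKernel η
  have hk' : Continuous fun y => wallKernel η (-y) := hk.comp continuous_neg
  have b1 := hp.pairing_near_ge hη hMp
  have b2 := hm.pairing_near_ge hη hMm
  have b3 := hm.pairing_far_le hη0 hMm0
  have b4 := hp.pairing_far_le hη0 hMp0
  have hdet := det_ge hMp hMm b1 b2 b3 b4
  obtain ⟨hδ0, -⟩ := wallKernel_one_bounds (by linarith : 0 < η)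
  have hcomb := fun {K : ℝ → ℝ} (hK : Continuous K) (cp cm : ℂ) =>
    integral_mul_combination hK hp.continuous hm.continuous cp cm
  have hΔ : (∫ y in (-1 : ℝ)..1, (wallKernel η y : ℂ) * p y)
      * (∫ y in (-1 : ℝ)..1, (wallKernel η (-y) : ℂ) * m y)
      - (∫ y in (-1 : ℝ)..1, (wallKernel η y : ℂ) * m y)
      * (∫ y in (-1 : ℝ)..1, (wallKernel η (-y) : ℂ) * p y) ≠ 0 := by
    refine norm_pos_iff.1 (lt_of_lt_of_le ?_ hdet)
    positivity
  obtain ⟨cp, cm, h1, h2⟩ : ∃ cp cm : ℂ,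
      cp * (∫ y in (-1 : ℝ)..1, (wallKernel η y : ℂ) * p y)
        + cm * (∫ y in (-1 : ℝ)..1, (wallKernel η y : ℂ) * m y) = wallKernel η 1 * b ∧
      cp * (∫ y in (-1 : ℝ)..1, (wallKernel η (-y) : ℂ) * p y)
        + cm * (∫ y in (-1 : ℝ)..1, (wallKernel η (-y) : ℂ) * m y) = 0 := by
    generalize (∫ y in (-1 : ℝ)..1, (wallKernel η y : ℂ) * p y) = App at *
    generalize (∫ y in (-1 : ℝ)..1, (wallKernel η y : ℂ) * m y) = Apm at *
    generalize (∫ y in (-1 : ℝ)..1, (wallKernel η (-y) : ℂ) * p y) = Amp at *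
    generalize (∫ y in (-1 : ℝ)..1, (wallKernel η (-y) : ℂ) * m y) = Amm at *
    refine ⟨wallKernel η 1 * b * Amm / (App * Amm - Apm * Amp),
      -(wallKernel η 1 * b * Amp) / (App * Amm - Apm * Amp), ?_, ?_⟩
    · rw [div_mul_eq_mul_div, div_mul_eq_mul_div, ← add_div, div_eq_iff hΔ]; ring
    · rw [div_mul_eq_mul_div, div_mul_eq_mul_div, ← add_div, div_eq_iff hΔ]; ring
  have hwc : Continuous fun y => cp * p y + cm * m y :=
    (continuous_const.mul hp.continuous).add (continuous_const.mul hm.continuous)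
  obtain ⟨W, W', hW, hW0, hW'0⟩ := exists_isStream hwc η 0 0
  have e1 := hW.integral_wallKernel hwc.continuousOn hW0
  have e2 := hW.integral_wallKernel_neg hwc.continuousOn hW0 hW'0
  rw [hcomb hk, h1] at e1
  rw [hcomb hk', h2, wallKernelDeriv_neg_one] at e2
  have hW1 : W 1 = 0 := by
    have hne : ((2 * η * Real.exp (-(2 * η)) : ℝ) : ℂ) ≠ 0 := by
      rw [Complex.ofReal_ne_zero]; positivity
    exact (mul_eq_zero.1 e2.symm).resolve_left hne
  rw [hW1, mul_zero, sub_zero] at e1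
  have hδc : (wallKernel η 1 : ℂ) ≠ 0 := Complex.ofReal_ne_zero.2 hδ0.ne'
  refine ⟨_, fun y => cp * p' y + cm * m' y, W, W', ⟨fun y _ => ?_, fun y _ => ?_, hW, hW0, hW1,
    hW'0, (mul_left_cancel₀ hδc e1).symm⟩⟩
  · exact (((hp.deriv y).const_mul cp).add ((hm.deriv y).const_mul cm)).hasDerivWithinAt
  · refine (((hp.deriv_deriv y).const_mul cp).add
      ((hm.deriv_deriv y).const_mul cm)).hasDerivWithinAt.congr_deriv ?_
    ring

end System

/-! ### Energy and duality estimates for the stream function -/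

lemma ContinuousOn.intervalIntegrable_channel {E : Type*} [NormedAddCommGroup E] {f : ℝ → E}
    (hf : ContinuousOn f closedChannel) {a b : ℝ} (ha : -1 ≤ a) (hab : a ≤ b) (hb : b ≤ 1) :
    IntervalIntegrable f volume a b :=
  (hf.mono (by rw [uIcc_of_le hab]; exact Icc_subset_Icc ha hb)).intervalIntegrable

lemma integral_le_integral_channel {f : ℝ → ℝ} (hf : ContinuousOn f closedChannel)
    (h0 : ∀ y ∈ closedChannel, 0 ≤ f y) {a b : ℝ} (ha : -1 ≤ a) (hab : a ≤ b) (hb : b ≤ 1) :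
    ∫ y in a..b, f y ≤ ∫ y in (-1 : ℝ)..1, f y := by
  refine intervalIntegral.integral_mono_interval ha hab hb ?_
    (hf.intervalIntegrable_channel le_rfl (by norm_num) le_rfl)
  refine (ae_restrict_iff' measurableSet_Ioc).2 (Filter.Eventually.of_forall fun y hy => ?_)
  exact h0 y (Ioc_subset_Icc_self hy)

lemma sq_integral_le {f : ℝ → ℝ} {a b : ℝ} (hab : a ≤ b) (hf : ContinuousOn f (Icc a b)) :
    (∫ y in a..b, f y) ^ 2 ≤ (b - a) * ∫ y in a..b, f y ^ 2 := by
  rcases hab.eq_or_lt with rfl | h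
  · simp
  have hu : ContinuousOn f (uIcc a b) := by rwa [uIcc_of_le hab]
  set c := (∫ y in a..b, f y) / (b - a) with hc
  have h1 : 0 ≤ ∫ y in a..b, (f y - c) ^ 2 :=
    intervalIntegral.integral_nonneg hab fun y _ => sq_nonneg _
  have h2 : ∫ y in a..b, (f y - c) ^ 2
      = (∫ y in a..b, f y ^ 2) - 2 * c * (∫ y in a..b, f y) + c ^ 2 * (b - a) := by
    have e : ∀ y, (f y - c) ^ 2 = f y ^ 2 - 2 * c * f y + c ^ 2 := fun y => by ring
    simp only [e]
    rw [intervalIntegral.integral_add, intervalIntegral.integral_sub,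
      intervalIntegral.integral_const_mul, intervalIntegral.integral_const, smul_eq_mul]
    · ring
    · exact (hu.pow 2).intervalIntegrable
    · exact (continuousOn_const.mul hu).intervalIntegrable
    · exact ((hu.pow 2).sub (continuousOn_const.mul hu)).intervalIntegrable
    · exact continuousOn_const.intervalIntegrable
  have hba : 0 < b - a := sub_pos.2 h
  have hi : ∫ y in a..b, f y = c * (b - a) := by rw [hc, div_mul_cancel₀ _ hba.ne']
  rw [h2, hi] at h1
  rw [hi]
  nlinarith

lemma hasDerivWithinAt_re_conj_mul {u v : ℝ → ℂ} {u' v' : ℂ} {S : Set ℝ} {s : ℝ}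
    (hu : HasDerivWithinAt u u' S s) (hv : HasDerivWithinAt v v' S s) :
    HasDerivWithinAt (fun s => ((starRingEnd ℂ) (u s) * v s).re)
      (((starRingEnd ℂ) u' * v s).re + ((starRingEnd ℂ) (u s) * v').re) S s := by
  have h1 : HasDerivWithinAt (fun s => (starRingEnd ℂ) (u s)) ((starRingEnd ℂ) u') S s :=
    Complex.conjCLE.toContinuousLinearMap.hasFDerivAt.comp_hasDerivWithinAt s hu
  have h2 := Complex.reCLM.hasFDerivAt.comp_hasDerivWithinAt s (h1.mul hv)
  exact h2.congr_deriv (by simp)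

lemma re_conj_mul_self (z : ℂ) : ((starRingEnd ℂ) z * z).re = ‖z‖ ^ 2 := by
  rw [Complex.conj_mul', ← Complex.ofReal_pow, Complex.ofReal_re]

lemma abs_re_conj_mul_le (z u : ℂ) : |((starRingEnd ℂ) z * u).re| ≤ ‖z‖ * ‖u‖ := by
  refine (Complex.abs_re_le_norm _).trans ?_
  rw [norm_mul, RCLike.norm_conj]

lemma one_sub_abs_nonneg {y : ℝ} (hy : y ∈ closedChannel) : 0 ≤ 1 - |y| := by
  have := abs_le.2 ⟨hy.1, hy.2⟩
  linarith

/-- A function vanishing at both walls is controlled by the integral of its derivative over the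
shorter way to the boundary. -/
lemma exists_wall_interval {W W' : ℝ → ℂ}
    (hW : ∀ y ∈ closedChannel, HasDerivWithinAt W (W' y) closedChannel y)
    (hc : ContinuousOn W' closedChannel) (h1 : W (-1) = 0) (h2 : W 1 = 0) {y : ℝ}
    (hy : y ∈ closedChannel) :
    ∃ a b, -1 ≤ a ∧ a ≤ b ∧ b ≤ 1 ∧ b - a = 1 - |y| ∧ ‖W y‖ ≤ ∫ x in a..b, ‖W' x‖ := by
  rcases le_total 0 y with h | h
  · refine ⟨y, 1, hy.1, hy.2, le_rfl, by rw [abs_of_nonneg h], ?_⟩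
    have := integral_eq_sub_of_hasDerivWithinAt_channel hW hc hy.1 hy.2 le_rfl
    rw [h2, zero_sub] at this
    rw [← norm_neg, ← this]
    exact intervalIntegral.norm_integral_le_integral_norm hy.2
  · refine ⟨-1, y, le_rfl, hy.1, hy.2, by rw [abs_of_nonpos h]; ring, ?_⟩
    have := integral_eq_sub_of_hasDerivWithinAt_channel hW hc le_rfl hy.1 hy.2
    rw [h1, sub_zero] at this
    rw [← this]
    exact intervalIntegral.norm_integral_le_integral_norm hy.1

section Energy

variable {η : ℝ} {w W W' : ℝ → ℂ}

/-- The energy `‖(∂, η) W‖²` of a stream function. -/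
noncomputable def streamEnergy (η : ℝ) (W W' : ℝ → ℂ) : ℝ :=
  ∫ y in (-1 : ℝ)..1, (‖W' y‖ ^ 2 + η ^ 2 * ‖W y‖ ^ 2)

lemma IsStream.continuousOn_energy (h : IsStream η w W W') :
    ContinuousOn (fun y => ‖W' y‖ ^ 2 + η ^ 2 * ‖W y‖ ^ 2) closedChannel :=
  (h.continuousOn_deriv.norm.pow 2).add (continuousOn_const.mul (h.continuousOn.norm.pow 2))

lemma IsStream.energy_identity (h : IsStream η w W W') (hw : ContinuousOn w closedChannel)
    (h1 : W (-1) = 0) (h2 : W 1 = 0) :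
    streamEnergy η W W' = -∫ y in (-1 : ℝ)..1, ((starRingEnd ℂ) (W y) * w y).re := by
  have hcr : ContinuousOn (fun y => ((starRingEnd ℂ) (W y) * w y).re) closedChannel :=
    Complex.continuous_re.comp_continuousOn
      ((Complex.continuous_conj.comp_continuousOn h.continuousOn).mul hw)
  have key := integral_eq_sub_of_hasDerivWithinAt_channel
    (f := fun y => ((starRingEnd ℂ) (W y) * W' y).re)
    (f' := fun y => (‖W' y‖ ^ 2 + η ^ 2 * ‖W y‖ ^ 2) + ((starRingEnd ℂ) (W y) * w y).re)
    (fun y hy => ?_) (h.continuousOn_energy.add hcr) le_rfl (by norm_num) le_rfl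
  · rw [intervalIntegral.integral_add
      (h.continuousOn_energy.intervalIntegrable_channel le_rfl (by norm_num) le_rfl)
      (hcr.intervalIntegrable_channel le_rfl (by norm_num) le_rfl)] at key
    simp only [h1, h2, map_zero, zero_mul, Complex.zero_re, sub_zero] at key
    rw [streamEnergy]
    linarith
  · refine (hasDerivWithinAt_re_conj_mul (h.deriv y hy) (h.deriv_deriv y hy)).congr_deriv ?_
    rw [re_conj_mul_self, mul_add, Complex.add_re, ← add_assoc]
    congr 2
    rw [← re_conj_mul_self, ← Complex.re_ofReal_mul]
    congr 1
    push_cast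
    ring

lemma streamEnergy_nonneg (η : ℝ) (W W' : ℝ → ℂ) : 0 ≤ streamEnergy η W W' :=
  intervalIntegral.integral_nonneg (by norm_num) fun y _ => by positivity

lemma IsStream.integral_deriv_sq_le (h : IsStream η w W W') :
    ∫ y in (-1 : ℝ)..1, ‖W' y‖ ^ 2 ≤ streamEnergy η W W' := by
  refine intervalIntegral.integral_mono_on (by norm_num)
    ((h.continuousOn_deriv.norm.pow 2).intervalIntegrable_channel le_rfl (by norm_num) le_rfl)
    (h.continuousOn_energy.intervalIntegrable_channel le_rfl (by norm_num) le_rfl) fun y _ => ?_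
  have : 0 ≤ η ^ 2 * ‖W y‖ ^ 2 := by positivity
  linarith

lemma IsStream.norm_le_sqrt_energy (h : IsStream η w W W') (h1 : W (-1) = 0) (h2 : W 1 = 0)
    {y : ℝ} (hy : y ∈ closedChannel) :
    ‖W y‖ ≤ √(1 - |y|) * √(streamEnergy η W W') := by
  obtain ⟨a, b, ha, hab, hb, hl, hW⟩ := exists_wall_interval h.deriv h.continuousOn_deriv h1 h2 hy
  have hc := h.continuousOn_deriv.norm
  have h3 := sq_integral_le hab (hc.mono (Icc_subset_Icc ha hb))
  have h4 := integral_le_integral_channel (hc.pow 2) (fun y _ => sq_nonneg _) ha hab hb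
  have h5 := one_sub_abs_nonneg hy
  rw [← Real.sqrt_mul h5]
  refine Real.le_sqrt_of_sq_le ?_
  calc ‖W y‖ ^ 2 ≤ (∫ x in a..b, ‖W' x‖) ^ 2 := by gcongr
    _ ≤ (b - a) * ∫ x in a..b, ‖W' x‖ ^ 2 := h3
    _ ≤ (1 - |y|) * streamEnergy η W W' := by
      rw [hl]
      gcongr
      exact h4.trans h.integral_deriv_sq_le

lemma continuousOn_weight (hw : ContinuousOn w closedChannel) :
    ContinuousOn (fun y => √(1 - |y|) * ‖w y‖) closedChannel :=
  (Continuous.continuousOn (by fun_prop)).mul hw.norm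

/-- The energy is bounded through the pairing of `w` with `W`, since `W` vanishes like the square
root of the distance to the walls. -/
lemma IsStream.energy_le (h : IsStream η w W W') (hw : ContinuousOn w closedChannel)
    (h1 : W (-1) = 0) (h2 : W 1 = 0) :
    streamEnergy η W W' ≤ (∫ y in (-1 : ℝ)..1, √(1 - |y|) * ‖w y‖) ^ 2 := by
  set E := streamEnergy η W W' with hE
  set B := ∫ y in (-1 : ℝ)..1, √(1 - |y|) * ‖w y‖ with hB
  have hE0 : 0 ≤ E := streamEnergy_nonneg _ _ _
  have key : E ≤ √E * B := by
    rw [hB, ← intervalIntegral.integral_const_mul]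
    refine (hE.trans (h.energy_identity hw h1 h2)).trans_le ?_
    rw [← intervalIntegral.integral_neg]
    refine intervalIntegral.integral_mono_on (by norm_num) ?_
      ((continuousOn_const.mul (continuousOn_weight hw)).intervalIntegrable_channel le_rfl
        (by norm_num) le_rfl) fun y hy => ?_
    · refine ContinuousOn.intervalIntegrable_channel ?_ le_rfl (by norm_num) le_rfl
      exact (Complex.continuous_re.comp_continuousOn
        ((Complex.continuous_conj.comp_continuousOn h.continuousOn).mul hw)).neg
    · refine (neg_le_abs _).trans ((abs_re_conj_mul_le _ _).trans ?_)
      have := mul_le_mul_of_nonneg_right (h.norm_le_sqrt_energy h1 h2 hy) (norm_nonneg (w y))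
      linarith
  have hs := Real.sq_sqrt hE0
  have hs0 := Real.sqrt_nonneg E
  have hB0 : 0 ≤ B := intervalIntegral.integral_nonneg (by norm_num) fun y _ => by positivity
  rcases hs0.eq_or_lt with h0 | h0
  · rw [← h0] at hs
    nlinarith
  · have : √E ≤ B := by
      refine le_of_mul_le_mul_left ?_ h0
      nlinarith
    nlinarith

/-- For `W'' - η² W = w` with `W = 0` at the walls, `‖W'‖_∞² ≤ 6 ‖w‖² / η`: this interpolates
between the `L²` bounds of `W'` and `W''`. -/
lemma IsStream.norm_deriv_sq_le (h : IsStream η w W W') (hw : ContinuousOn w closedChannel)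
    (hη : 1 ≤ η) (h1 : W (-1) = 0) (h2 : W 1 = 0) {y : ℝ} (hy : y ∈ closedChannel) :
    ‖W' y‖ ^ 2 ≤ 6 / η * ∫ x in (-1 : ℝ)..1, ‖w x‖ ^ 2 := by
  have hη0 : 0 < η := by linarith
  set H := ∫ x in (-1 : ℝ)..1, ‖w x‖ ^ 2 with hH
  set I₁ := ∫ x in (-1 : ℝ)..1, ‖W' x‖ ^ 2 with hI₁
  set I₀ := ∫ x in (-1 : ℝ)..1, ‖W x‖ ^ 2 with hI₀
  have int : ∀ {f : ℝ → ℝ}, ContinuousOn f closedChannel → IntervalIntegrable f volume (-1) 1 :=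
    fun hf => hf.intervalIntegrable_channel le_rfl (by norm_num) le_rfl
  have cw : ContinuousOn (fun x => ‖w x‖ ^ 2) closedChannel := hw.norm.pow 2
  have c1 : ContinuousOn (fun x => ‖W' x‖ ^ 2) closedChannel := h.continuousOn_deriv.norm.pow 2
  have c0 : ContinuousOn (fun x => ‖W x‖ ^ 2) closedChannel := h.continuousOn.norm.pow 2
  have cmul : ∀ (c : ℝ) {f : ℝ → ℝ}, ContinuousOn f closedChannel →
      ContinuousOn (fun x => c * f x) closedChannel := fun c f hf => continuousOn_const.mul hf
  have hH0 : 0 ≤ H := intervalIntegral.integral_nonneg (by norm_num) fun y _ => by positivity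
  have hI00 : 0 ≤ I₀ := intervalIntegral.integral_nonneg (by norm_num) fun y _ => by positivity
  have hI10 : 0 ≤ I₁ := intervalIntegral.integral_nonneg (by norm_num) fun y _ => by positivity
  have hE : I₁ + η ^ 2 * I₀ ≤ 1 / 2 * (η ^ 2 * I₀ + H / η ^ 2) := by
    have e1 : I₁ + η ^ 2 * I₀ = streamEnergy η W W' := by
      rw [streamEnergy, intervalIntegral.integral_add (int c1) (int (cmul _ c0)),
        intervalIntegral.integral_const_mul]
    have e2 : 1 / 2 * (η ^ 2 * I₀ + H / η ^ 2)
        = ∫ y in (-1 : ℝ)..1, (η ^ 2 / 2 * ‖W y‖ ^ 2 + 1 / (2 * η ^ 2) * ‖w y‖ ^ 2) := by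
      rw [intervalIntegral.integral_add (int (cmul _ c0))
        (int (cmul _ cw)),
        intervalIntegral.integral_const_mul, intervalIntegral.integral_const_mul]
      ring
    rw [e1, e2, h.energy_identity hw h1 h2, ← intervalIntegral.integral_neg]
    refine intervalIntegral.integral_mono_on (by norm_num) (int ?_)
      (int ((cmul _ c0).add (cmul _ cw))) fun y _ => ?_
    · exact (Complex.continuous_re.comp_continuousOn
        ((Complex.continuous_conj.comp_continuousOn h.continuousOn).mul hw)).neg
    · refine (neg_le_abs _).trans ((abs_re_conj_mul_le _ _).trans ?_)
      have h3 := sq_nonneg (η * ‖W y‖ - ‖w y‖ / η)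
      have e3 : (η * ‖W y‖ - ‖w y‖ / η) ^ 2 = 2 * (η ^ 2 / 2 * ‖W y‖ ^ 2 +
          1 / (2 * η ^ 2) * ‖w y‖ ^ 2 - ‖W y‖ * ‖w y‖) := by field_simp; ring
      linarith
  have hI1 : I₁ ≤ H / (2 * η ^ 2) := by
    have : H / (2 * η ^ 2) = 1 / 2 * (H / η ^ 2) := by ring
    have : 0 ≤ η ^ 2 * I₀ := by positivity
    linarith
  have hI0 : η ^ 4 * I₀ ≤ H := by
    have h3 : η ^ 2 * I₀ ≤ H / η ^ 2 := by linarith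
    rw [le_div_iff₀ (by positivity)] at h3
    linarith
  have c2 : ContinuousOn (fun x => 2 * η ^ 4 * ‖W x‖ ^ 2 + 2 * ‖w x‖ ^ 2) closedChannel :=
    (cmul _ c0).add (cmul _ cw)
  have c3 : ContinuousOn (fun x => η * ‖W' x‖ ^ 2 + 1 / η *
      (2 * η ^ 4 * ‖W x‖ ^ 2 + 2 * ‖w x‖ ^ 2)) closedChannel :=
    (cmul _ c1).add (cmul _ c2)
  have hJ : ∫ x in (-1 : ℝ)..1, (η * ‖W' x‖ ^ 2 + 1 / η *
      (2 * η ^ 4 * ‖W x‖ ^ 2 + 2 * ‖w x‖ ^ 2)) ≤ 4.5 * (H / η) := by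
    rw [intervalIntegral.integral_add (int (cmul _ c1))
        (int (cmul _ c2)), intervalIntegral.integral_const_mul,
        intervalIntegral.integral_const_mul,
        intervalIntegral.integral_add (int (cmul _ c0))
        (int (cmul _ cw)), intervalIntegral.integral_const_mul,
        intervalIntegral.integral_const_mul]
    have h3 : η * I₁ ≤ 0.5 * (H / η) := by
      calc η * I₁ ≤ η * (H / (2 * η ^ 2)) := by gcongr
        _ = _ := by field_simp; ring
    have h4 : 1 / η * (2 * η ^ 4 * I₀ + 2 * H) ≤ 4 * (H / η) := by
      calc _ ≤ 1 / η * (4 * H) := by gcongr; linarith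
        _ = _ := by ring
    linarith
  have hosc : ∀ a b, -1 ≤ a → a ≤ b → b ≤ 1 → |‖W' b‖ ^ 2 - ‖W' a‖ ^ 2| ≤ 4.5 * (H / η) := by
    intro a b ha hab hb
    have cW'' : ContinuousOn (fun y => (η : ℂ) ^ 2 * W y + w y) closedChannel :=
      (continuousOn_const.mul h.continuousOn).add hw
    have hd := integral_eq_sub_of_hasDerivWithinAt_channel
      (f := fun y => ((starRingEnd ℂ) (W' y) * W' y).re)
      (fun y hy => hasDerivWithinAt_re_conj_mul (h.deriv_deriv y hy) (h.deriv_deriv y hy))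
      ((Complex.continuous_re.comp_continuousOn
        ((Complex.continuous_conj.comp_continuousOn cW'').mul h.continuousOn_deriv)).add
        (Complex.continuous_re.comp_continuousOn
        ((Complex.continuous_conj.comp_continuousOn h.continuousOn_deriv).mul cW''))) ha hab hb
    simp only [re_conj_mul_self] at hd
    rw [← hd, ← Real.norm_eq_abs]
    refine (intervalIntegral.norm_integral_le_of_norm_le hab
      (Filter.Eventually.of_forall fun x hx => ?_)
      (c3.intervalIntegrable_channel ha hab hb)).trans
      ((integral_le_integral_channel c3 (fun x _ => by positivity) ha hab hb).trans hJ)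
    have h3 := abs_re_conj_mul_le ((η : ℂ) ^ 2 * W x + w x) (W' x)
    have h4 := abs_re_conj_mul_le (W' x) ((η : ℂ) ^ 2 * W x + w x)
    have h5 : ‖(η : ℂ) ^ 2 * W x + w x‖ ≤ η ^ 2 * ‖W x‖ + ‖w x‖ := by
      refine (norm_add_le _ _).trans_eq ?_
      rw [norm_mul, norm_pow, Complex.norm_real, Real.norm_of_nonneg hη0.le]
    have h6 : ‖(η : ℂ) ^ 2 * W x + w x‖ ^ 2 ≤ 2 * η ^ 4 * ‖W x‖ ^ 2 + 2 * ‖w x‖ ^ 2 := by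
      have h7 := pow_le_pow_left₀ (norm_nonneg _) h5 2
      have h8 := sq_nonneg (η ^ 2 * ‖W x‖ - ‖w x‖)
      nlinarith
    rw [Real.norm_eq_abs]
    refine (abs_add_le _ _).trans ?_
    generalize ‖(η : ℂ) ^ 2 * W x + w x‖ = z at *
    have h9 : 2 * (‖W' x‖ * z) ≤ η * ‖W' x‖ ^ 2 + 1 / η * z ^ 2 := by
      have h10 : 0 ≤ 1 / η * (η * ‖W' x‖ - z) ^ 2 := by positivity
      have e : 1 / η * (η * ‖W' x‖ - z) ^ 2
        = η * ‖W' x‖ ^ 2 + 1 / η * z ^ 2 - 2 * (‖W' x‖ * z) := by field_simp; ring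
      linarith
    have h11 : 1 / η * z ^ 2 ≤ 1 / η * (2 * η ^ 4 * ‖W x‖ ^ 2 + 2 * ‖w x‖ ^ 2) := by gcongr
    rw [mul_comm z] at h3
    linarith
  have hall : ∀ x ∈ Icc (-1 : ℝ) 1, ‖W' y‖ ^ 2 ≤ ‖W' x‖ ^ 2 + 4.5 * (H / η) := by
    intro x hx
    rcases le_total x y with hxy | hxy
    · linarith [(abs_le.1 (hosc x y hx.1 hxy hy.2)).2]
    · linarith [(abs_le.1 (hosc y x hy.1 hxy hx.2)).1]
  have hint := intervalIntegral.integral_mono_on (by norm_num)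
    (continuousOn_const.intervalIntegrable) (int (show ContinuousOn
      (fun x => ‖W' x‖ ^ 2 + 4.5 * (H / η)) closedChannel from c1.add continuousOn_const)) hall
  rw [intervalIntegral.integral_const, smul_eq_mul, intervalIntegral.integral_add (int c1)
    (int continuousOn_const), intervalIntegral.integral_const, smul_eq_mul] at hint
  have h3 : H / (2 * η ^ 2) ≤ 0.5 * (H / η) := by
    have e : H / (2 * η ^ 2) = 0.5 * (H / η) * (1 / η) := by field_simp; ring
    rw [e]
    refine mul_le_of_le_one_right (by positivity) ?_
    rw [div_le_one hη0]; exact hη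
  have e : 6 / η * H = 6 * (H / η) := by ring
  have h4 : 0 ≤ H / η := by positivity
  rw [e]
  linarith

lemma IsStream.norm_le_of_deriv_le (h : IsStream η w W W') (h1 : W (-1) = 0) (h2 : W 1 = 0)
    {r : ℝ} (hr : ∀ y ∈ closedChannel, ‖W' y‖ ≤ r) {y : ℝ} (hy : y ∈ closedChannel) :
    ‖W y‖ ≤ (1 - |y|) * r := by
  obtain ⟨a, b, ha, hab, hb, hl, hW⟩ := exists_wall_interval h.deriv h.continuousOn_deriv h1 h2 hy
  refine hW.trans ?_
  calc _ ≤ ∫ _ in a..b, r := by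
        refine intervalIntegral.integral_mono_on hab
          (h.continuousOn_deriv.norm.intervalIntegrable_channel ha hab hb)
          intervalIntegrable_const fun x hx => hr x ⟨ha.trans hx.1, hx.2.trans hb⟩
    _ = _ := by rw [intervalIntegral.integral_const, smul_eq_mul, hl]

lemma exists_dirichlet_stream (hη : 0 < η) {v : ℝ → ℂ} (hv : ContinuousOn v closedChannel) :
    ∃ V V', IsStream η v V V' ∧ V (-1) = 0 ∧ V 1 = 0 := by
  have hle : (-1 : ℝ) ≤ 1 := by norm_num
  obtain ⟨Z, Z', hZ, hZ0, -⟩ := exists_isStream (w := IccExtend hle (closedChannel.domRestrict v))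
    (continuous_IccExtend_iff.2 (continuousOn_iff_continuous_domRestrict.1 hv)) η 0 0
  have hδ : (wallKernel η 1 : ℂ) ≠ 0 := Complex.ofReal_ne_zero.2 (wallKernel_one_bounds hη).1.ne'
  have hk := isStream_wallKernel η
  refine ⟨fun y => Z y - Z 1 / wallKernel η 1 * wallKernel η y,
    fun y => Z' y - Z 1 / wallKernel η 1 * wallKernelDeriv η y,
    ⟨fun y hy => (hZ.deriv y hy).sub ((hk.deriv y hy).const_mul _), fun y hy => ?_⟩, ?_, ?_⟩
  · refine ((hZ.deriv_deriv y hy).sub ((hk.deriv_deriv y hy).const_mul _)).congr_deriv ?_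
    rw [IccExtend_of_mem _ _ hy, domRestrict_apply]
    simp only [Pi.zero_apply]
    ring
  · simp only [hZ0, wallKernel_neg_one]; simp
  · simp only [div_mul_cancel₀ _ hδ, sub_self]

/-- The `L²` bound of the stream function, by pairing with the solution of the dual problem. -/
lemma IsStream.integral_sq_le (h : IsStream η w W W') (hw : ContinuousOn w closedChannel)
    (hη : 1 ≤ η) (h1 : W (-1) = 0) (h2 : W 1 = 0) :
    ∫ y in (-1 : ℝ)..1, ‖W y‖ ^ 2 ≤ 6 / η * (∫ y in (-1 : ℝ)..1, (1 - |y|) * ‖w y‖) ^ 2 := by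
  have hη0 : 0 < η := by linarith
  have hv := Complex.continuous_conj.comp_continuousOn h.continuousOn
  obtain ⟨V, V', hV, hV1, hV2⟩ := exists_dirichlet_stream hη0 hv
  set H := ∫ y in (-1 : ℝ)..1, ‖W y‖ ^ 2 with hH
  set B := ∫ y in (-1 : ℝ)..1, (1 - |y|) * ‖w y‖ with hB
  have hH0 : 0 ≤ H := intervalIntegral.integral_nonneg (by norm_num) fun y _ => by positivity
  have hB0 : 0 ≤ B := intervalIntegral.integral_nonneg (by norm_num) fun y hy =>
    mul_nonneg (one_sub_abs_nonneg hy) (norm_nonneg _)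
  have cB : ContinuousOn (fun y => (1 - |y|) * ‖w y‖) closedChannel :=
    (Continuous.continuousOn (by fun_prop)).mul hw.norm
  have hV' : ∀ y ∈ closedChannel, ‖V' y‖ ≤ √(6 / η * H) := fun y hy => by
    refine Real.le_sqrt_of_sq_le ?_
    have := hV.norm_deriv_sq_le hv hη hV1 hV2 hy
    simpa only [Function.comp, RCLike.norm_conj] using this
  have hVy := fun y (hy : y ∈ closedChannel) => hV.norm_le_of_deriv_le hV1 hV2 hV' hy
  have hg := h.green hV hw hv
  rw [h1, h2, hV1, hV2] at hg
  simp only [mul_zero, zero_mul, sub_zero] at hg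
  have cVw : ContinuousOn (fun y => V y * w y) closedChannel := hV.continuousOn.mul hw
  have cWW : ContinuousOn (fun y => ((starRingEnd ℂ) ∘ W) y * W y) closedChannel :=
    hv.mul h.continuousOn
  have int : ∀ {f : ℝ → ℂ}, ContinuousOn f closedChannel → IntervalIntegrable f volume (-1) 1 :=
    fun hf => hf.intervalIntegrable_channel le_rfl (by norm_num) le_rfl
  rw [intervalIntegral.integral_sub (int cVw) (int cWW), sub_eq_zero] at hg
  have e1 : ∫ y in (-1 : ℝ)..1, ((starRingEnd ℂ) ∘ W) y * W y = ((H : ℝ) : ℂ) := by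
    rw [hH, ← intervalIntegral.integral_ofReal]
    refine intervalIntegral.integral_congr fun y _ => ?_
    simp only [Function.comp, Complex.conj_mul']
    push_cast; rfl
  rw [e1] at hg
  have h3 : H ≤ √(6 / η * H) * B := by
    have hn : H = ‖∫ y in (-1 : ℝ)..1, V y * w y‖ := by
      rw [hg, Complex.norm_real, Real.norm_of_nonneg hH0]
    rw [hB, ← intervalIntegral.integral_const_mul]
    refine hn.trans_le ?_
    refine intervalIntegral.norm_integral_le_of_norm_le (by norm_num)
      (Filter.Eventually.of_forall fun y hy => ?_)
      ((continuousOn_const.mul cB).intervalIntegrable_channel le_rfl (by norm_num) le_rfl)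
    rw [norm_mul]
    have := mul_le_mul_of_nonneg_right (hVy y (Ioc_subset_Icc_self hy)) (norm_nonneg (w y))
    linarith
  rcases hH0.eq_or_lt with h0 | h0
  · rw [← h0]; positivity
  · have hs := Real.sq_sqrt (show 0 ≤ 6 / η * H by positivity)
    have h4 : H ^ 2 ≤ 6 / η * H * B ^ 2 := by
      calc H ^ 2 ≤ (√(6 / η * H) * B) ^ 2 := by gcongr
        _ = _ := by rw [mul_pow, hs]
    refine le_of_mul_le_mul_left ?_ h0
    linarith

end Energy

/-! ### Norms of functions with an exponential boundary layer profile -/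

lemma normLp_top_le {E : Type*} [NormedAddCommGroup E] {f : ℝ → E} {K : ℝ}
    (h : ∀ y ∈ closedChannel, ‖f y‖ ≤ K) : normLp ∞ f ≤ ENNReal.ofReal K := by
  rw [normLp, eLpNorm_exponent_top]
  refine eLpNormEssSup_le_of_ae_bound ?_
  exact (ae_restrict_iff' measurableSet_Ioo).2
    (Filter.Eventually.of_forall fun y hy => h y (Ioo_subset_Icc_self hy))

lemma lintegral_channel_le {g : ℝ → ℝ} {K : ℝ} (hg : ContinuousOn g closedChannel)
    (h0 : ∀ y ∈ closedChannel, 0 ≤ g y) (hK : ∫ y in (-1 : ℝ)..1, g y ≤ K) :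
    ∫⁻ y in Ioo (-1) 1, ENNReal.ofReal (g y) ≤ ENNReal.ofReal K := by
  have hi : IntegrableOn g (Ioo (-1) 1) :=
    (hg.integrableOn_compact isCompact_Icc).mono_set Ioo_subset_Icc_self
  rw [← ofReal_integral_eq_lintegral_ofReal hi ((ae_restrict_iff' measurableSet_Ioo).2
    (Filter.Eventually.of_forall fun y hy => h0 y (Ioo_subset_Icc_self hy)))]
  refine ENNReal.ofReal_le_ofReal ?_
  rwa [intervalIntegral.integral_of_le (by norm_num), integral_Ioc_eq_integral_Ioo] at hK

lemma normLp_one_le {E : Type*} [NormedAddCommGroup E] {f : ℝ → E} {g : ℝ → ℝ} {K : ℝ}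
    (hg : ContinuousOn g closedChannel) (h : ∀ y ∈ closedChannel, ‖f y‖ ≤ g y)
    (hK : ∫ y in (-1 : ℝ)..1, g y ≤ K) : normLp 1 f ≤ ENNReal.ofReal K := by
  rw [normLp, eLpNorm_one_eq_lintegral_enorm]
  refine le_trans ?_ (lintegral_channel_le hg (fun y hy => (norm_nonneg _).trans (h y hy)) hK)
  refine setLIntegral_mono' measurableSet_Ioo fun y hy => ?_
  rw [← ofReal_norm]
  exact ENNReal.ofReal_le_ofReal (h y (Ioo_subset_Icc_self hy))

lemma normLp_two_le {E : Type*} [NormedAddCommGroup E] {f : ℝ → E} {g : ℝ → ℝ} {K : ℝ}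
    (hK0 : 0 ≤ K) (hg : ContinuousOn g closedChannel) (h : ∀ y ∈ closedChannel, ‖f y‖ ^ 2 ≤ g y)
    (hK : ∫ y in (-1 : ℝ)..1, g y ≤ K ^ 2) : normLp 2 f ≤ ENNReal.ofReal K := by
  rw [normLp, eLpNorm_eq_lintegral_rpow_enorm_toReal (by norm_num) (by norm_num)]
  have h1 : ∫⁻ y in Ioo (-1) 1, ‖f y‖ₑ ^ (2 : ℝ≥0∞).toReal ≤ ENNReal.ofReal (K ^ 2) := by
    refine le_trans ?_ (lintegral_channel_le hg (fun y hy => (by positivity : (0 : ℝ) ≤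
      ‖f y‖ ^ 2).trans (h y hy)) hK)
    refine setLIntegral_mono' measurableSet_Ioo fun y hy => ?_
    rw [← ofReal_norm, ENNReal.toReal_ofNat,
      ENNReal.ofReal_rpow_of_nonneg (norm_nonneg _) (by norm_num)]
    refine ENNReal.ofReal_le_ofReal ?_
    have := h y (Ioo_subset_Icc_self hy)
    rwa [← Real.rpow_natCast] at this
  calc _ ≤ ENNReal.ofReal (K ^ 2) ^ (1 / (2 : ℝ≥0∞).toReal) := by gcongr
    _ = ENNReal.ofReal K := by
      rw [ENNReal.ofReal_rpow_of_nonneg (by positivity) (by norm_num), ENNReal.toReal_ofNat,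
        ← Real.sqrt_eq_rpow, Real.sqrt_sq hK0]

lemma integral_exp_abs_le {μ : ℝ} (hμ : 0 < μ) :
    ∫ y in (-1 : ℝ)..1, Real.exp (-(μ * (1 - |y|))) ≤ 2 / μ := by
  have h1 := integral_exp_le hμ
  have h2 : ∫ y in (-1 : ℝ)..1, Real.exp (-(μ * (1 + y))) ≤ 1 / μ := by
    have := intervalIntegral.integral_comp_neg (a := -1) (b := 1)
      (fun y : ℝ => Real.exp (-(μ * (1 - y))))
    simp only [sub_neg_eq_add, neg_neg] at this
    rw [this]; exact h1
  calc _ ≤ ∫ y in (-1 : ℝ)..1, (Real.exp (-(μ * (1 - y))) + Real.exp (-(μ * (1 + y)))) := by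
        refine intervalIntegral.integral_mono_on (by norm_num)
          (Continuous.intervalIntegrable (by fun_prop) _ _)
          (Continuous.intervalIntegrable (by fun_prop) _ _) fun y _ => ?_
        rcases abs_cases y with ⟨h, -⟩ | ⟨h, -⟩ <;> rw [h]
        · linarith [Real.exp_pos (-(μ * (1 + y)))]
        · rw [sub_neg_eq_add]; linarith [Real.exp_pos (-(μ * (1 - y)))]
    _ = (∫ y in (-1 : ℝ)..1, Real.exp (-(μ * (1 - y)))) +
        ∫ y in (-1 : ℝ)..1, Real.exp (-(μ * (1 + y))) :=
        intervalIntegral.integral_add (Continuous.intervalIntegrable (by fun_prop) _ _)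
          (Continuous.intervalIntegrable (by fun_prop) _ _)
    _ ≤ 1 / μ + 1 / μ := add_le_add h1 h2
    _ = _ := by ring

/-- The profile of a layer of unit mass and width `1 / M`, at the distance `t` from the wall. -/
noncomputable def layerProfile (M t : ℝ) : ℝ := M * Real.exp (-(0.01 * M * t))

/-- Weights cost a power of the layer width and half of the exponential decay. -/
lemma rpow_mul_layerProfile_le {M t α : ℝ} (hM : 0 < M) (ht : 0 ≤ t) (hα : 0 ≤ α) :
    t ^ α * layerProfile M t ≤ (200 * α) ^ α * (M ^ (1 - α) * Real.exp (-(0.005 * M * t))) := by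
  have e1 : Real.exp (-(0.01 * M * t)) = Real.exp (-(0.005 * M * t)) * Real.exp (-(0.005 * M * t)) := by
    rw [← Real.exp_add]; congr 1; ring
  have key : (t * M) ^ α * Real.exp (-(0.005 * M * t)) ≤ (200 * α) ^ α := by
    rcases hα.eq_or_lt with rfl | hα
    · simp only [Real.rpow_zero, one_mul]
      exact Real.exp_le_one_iff.2 (by nlinarith [mul_nonneg hM.le ht])
    · have h1 : t * M ≤ 200 * α * Real.exp (0.005 * M * t / α) := by
        have h2 := Real.add_one_le_exp (0.005 * M * t / α)
        have h3 : t * M = 200 * α * (0.005 * M * t / α) := by field_simp; ring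
        rw [h3]
        gcongr
        linarith
      have h2 := Real.rpow_le_rpow (by positivity) h1 hα.le
      rw [Real.mul_rpow (by positivity) (Real.exp_pos _).le, ← Real.exp_mul,
        div_mul_cancel₀ _ hα.ne'] at h2
      calc _ ≤ (200 * α) ^ α * Real.exp (0.005 * M * t) * Real.exp (-(0.005 * M * t)) := by gcongr
        _ = _ := by rw [mul_assoc, ← Real.exp_add, add_neg_cancel, Real.exp_zero, mul_one]
  have e2 : t ^ α * layerProfile M t
      = (t * M) ^ α * Real.exp (-(0.005 * M * t)) * (M ^ (1 - α) * Real.exp (-(0.005 * M * t))) := by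
    rw [layerProfile, e1, Real.mul_rpow ht hM.le, Real.rpow_sub hM, Real.rpow_one]
    have : M ^ α ≠ 0 := (Real.rpow_pos_of_pos hM α).ne'
    field_simp
  rw [e2]
  gcongr

lemma norm_weighted {s : ℝ} {f : ℝ → ℂ} {y : ℝ} (hy : y ∈ closedChannel) :
    ‖weighted s f y‖ = (1 - |y|) ^ s * ‖f y‖ := by
  rw [weighted, norm_mul, Complex.norm_real,
    Real.norm_of_nonneg (Real.rpow_nonneg (one_sub_abs_nonneg hy) s)]

/-- The pointwise bound of a corrector: a layer of unit mass and width `1 / Mp` at its own wall, and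
a weaker one at the opposite wall. The distances to both walls are at least `1 - |y|`. -/
structure LayerBound (A L Mp Mm : ℝ) (w : ℝ → ℂ) : Prop where
  one_le : 1 ≤ L
  nonneg : 0 ≤ A
  le_left : L ≤ Mm
  le_right : L ≤ Mp
  left_le : Mm ≤ 3 * Mp ^ 2
  bound : ∀ y ∈ closedChannel,
    ‖w y‖ ≤ A * (layerProfile Mp (1 - |y|) + 1 / Mp * layerProfile Mm (1 - |y|))

namespace LayerBound

variable {A L Mp Mm : ℝ} {w : ℝ → ℂ}

lemma weighted_le (h : LayerBound A L Mp Mm w) {α : ℝ} (hα : 0 ≤ α) {y : ℝ}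
    (hy : y ∈ closedChannel) :
    (1 - |y|) ^ α * ‖w y‖ ≤ A * (200 * α) ^ α *
      (Mp ^ (1 - α) * Real.exp (-(0.005 * Mp * (1 - |y|))) +
        Mm ^ (1 - α) * Real.exp (-(0.005 * Mm * (1 - |y|)))) := by
  have ht := one_sub_abs_nonneg hy
  have hL := h.one_le
  have hp : 0 < Mp := by linarith [h.le_right]
  have hm : 0 < Mm := by linarith [h.le_left]
  have h1 := rpow_mul_layerProfile_le hp ht hα
  have h2 := rpow_mul_layerProfile_le hm ht hα
  have h3 : 1 / Mp ≤ 1 := by rw [div_le_one hp]; linarith [h.le_right]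
  have hA := h.nonneg
  have hpf : 0 ≤ layerProfile Mm (1 - |y|) := by unfold layerProfile; positivity
  calc (1 - |y|) ^ α * ‖w y‖
      ≤ (1 - |y|) ^ α * (A * (layerProfile Mp (1 - |y|) + 1 * layerProfile Mm (1 - |y|))) := by
        have := h.bound y hy
        gcongr
        refine this.trans ?_
        gcongr
    _ = A * ((1 - |y|) ^ α * layerProfile Mp (1 - |y|) +
        (1 - |y|) ^ α * layerProfile Mm (1 - |y|)) := by ring
    _ ≤ A * ((200 * α) ^ α * (Mp ^ (1 - α) * Real.exp (-(0.005 * Mp * (1 - |y|)))) +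
        (200 * α) ^ α * (Mm ^ (1 - α) * Real.exp (-(0.005 * Mm * (1 - |y|))))) := by gcongr
    _ = _ := by ring

lemma integral_le {c M : ℝ} (hM : 0 < M) (hc : 0 < c) :
    ∫ y in (-1 : ℝ)..1, M * Real.exp (-(c * M * (1 - |y|))) ≤ 2 / c := by
  rw [intervalIntegral.integral_const_mul]
  calc _ ≤ M * (2 / (c * M)) := by gcongr; exact integral_exp_abs_le (by positivity)
    _ = _ := by field_simp

lemma integral_combination_le {r r' s s' c d K : ℝ} (hr : 0 < r) (hr' : 0 < r') (hs : 0 ≤ s)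
    (hs' : 0 ≤ s') (hd : 0 ≤ d) (hc : 0 < c) (hK : d * (s * (2 / c) + s' * (2 / c)) ≤ K) :
    ∫ y in (-1 : ℝ)..1, d * (s * (r * Real.exp (-(c * r * (1 - |y|)))) +
      s' * (r' * Real.exp (-(c * r' * (1 - |y|))))) ≤ K := by
  rw [intervalIntegral.integral_const_mul, intervalIntegral.integral_add
    (Continuous.intervalIntegrable (by fun_prop) _ _)
    (Continuous.intervalIntegrable (by fun_prop) _ _), intervalIntegral.integral_const_mul s,
    intervalIntegral.integral_const_mul s']
  refine le_trans ?_ hK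
  gcongr
  · exact integral_le hr hc
  · exact integral_le hr' hc

lemma weighted_le_one (h : LayerBound A L Mp Mm w) {α : ℝ} (hα : 0 ≤ α) {y : ℝ}
    (hy : y ∈ closedChannel) :
    (1 - |y|) ^ α * ‖w y‖ ≤ A * (200 * α) ^ α *
      (L ^ (-α) * (Mp * Real.exp (-(0.005 * Mp * (1 - |y|)))) +
        L ^ (-α) * (Mm * Real.exp (-(0.005 * Mm * (1 - |y|))))) := by
  have hL := h.one_le
  have hA := h.nonneg
  have key : ∀ {M : ℝ}, L ≤ M → M ^ (1 - α) ≤ L ^ (-α) * M := fun {M} hM => by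
    rw [sub_eq_add_neg, add_comm, Real.rpow_add (by linarith), Real.rpow_one]
    have := Real.rpow_le_rpow_of_nonpos (by linarith) hM (neg_nonpos.2 hα)
    gcongr
    linarith
  refine (h.weighted_le hα hy).trans ?_
  rw [← mul_assoc (L ^ (-α)), ← mul_assoc (L ^ (-α))]
  gcongr
  · exact key h.le_right
  · exact key h.le_left

/-- The weighted `L¹` bound. -/
lemma integral_weighted_le (h : LayerBound A L Mp Mm w) (hw : ContinuousOn w closedChannel) {α : ℝ}
    (hα : 0 ≤ α) :
    ∫ y in (-1 : ℝ)..1, (1 - |y|) ^ α * ‖w y‖ ≤ 800 * A * (200 * α) ^ α * L ^ (-α) := by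
  have hL := h.one_le
  have hA := h.nonneg
  have hp : 0 < Mp := by linarith [h.le_right]
  have hm : 0 < Mm := by linarith [h.le_left]
  refine (intervalIntegral.integral_mono_on (by norm_num) ?_
    (Continuous.intervalIntegrable (by fun_prop) _ _) fun y hy => h.weighted_le_one hα hy).trans
    (integral_combination_le hp hm (by positivity) (by positivity) (by positivity) (by norm_num)
      (le_of_eq (by ring)))
  refine ContinuousOn.intervalIntegrable_channel ?_ le_rfl (by norm_num) le_rfl
  exact (Continuous.continuousOn (Continuous.rpow_const (by fun_prop) fun _ => Or.inr hα)).mul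
    hw.norm

lemma normLp_one_weighted_le (h : LayerBound A L Mp Mm w) {α : ℝ} (hα : 0 ≤ α) :
    normLp 1 (weighted α w) ≤ ENNReal.ofReal (800 * A * (200 * α) ^ α * L ^ (-α)) := by
  have hL := h.one_le
  have hA := h.nonneg
  have hp : 0 < Mp := by linarith [h.le_right]
  have hm : 0 < Mm := by linarith [h.le_left]
  refine normLp_one_le (Continuous.continuousOn (by fun_prop)) (fun y hy => ?_)
    (integral_combination_le hp hm (s := L ^ (-α)) (s' := L ^ (-α)) (d := A * (200 * α) ^ α)
      (c := 0.005) (by positivity) (by positivity) (by positivity) (by norm_num)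
      (le_of_eq (by ring)))
  rw [norm_weighted hy]
  exact h.weighted_le_one hα hy

lemma normLp_top_weighted_le (h : LayerBound A L Mp Mm w) {β : ℝ} (hβ : 1 ≤ β) :
    normLp ∞ (weighted β w) ≤ ENNReal.ofReal (2 * A * (200 * β) ^ β * L ^ (1 - β)) := by
  have hL := h.one_le
  have hA := h.nonneg
  have hp : 0 < Mp := by linarith [h.le_right]
  have hm : 0 < Mm := by linarith [h.le_left]
  refine normLp_top_le fun y hy => ?_
  rw [norm_weighted hy]
  refine (h.weighted_le (by linarith) hy).trans ?_
  have ht := one_sub_abs_nonneg hy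
  have key : ∀ {M : ℝ}, L ≤ M →
      M ^ (1 - β) * Real.exp (-(0.005 * M * (1 - |y|))) ≤ L ^ (1 - β) := fun {M} hM => by
    have hM0 : 0 ≤ M := by linarith
    have h1 := Real.rpow_le_rpow_of_nonpos (by linarith) hM (by linarith : 1 - β ≤ 0)
    have h2 : Real.exp (-(0.005 * M * (1 - |y|))) ≤ 1 := by
      rw [Real.exp_le_one_iff, neg_nonpos]; positivity
    exact (mul_le_of_le_one_right (by positivity) h2).trans h1
  calc _ ≤ A * (200 * β) ^ β * (L ^ (1 - β) + L ^ (1 - β)) := by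
        gcongr
        · exact key h.le_right
        · exact key h.le_left
    _ = _ := by ring

lemma normLp_two_weighted_le (h : LayerBound A L Mp Mm w) {β : ℝ} (hβ : 1 / 2 ≤ β) :
    normLp 2 (weighted β w) ≤ ENNReal.ofReal (30 * A * (200 * β) ^ β * L ^ (1 / 2 - β)) := by
  have hL := h.one_le
  have hL0 : 0 < L := by linarith
  have hA := h.nonneg
  have hp : 0 < Mp := by linarith [h.le_right]
  have hm : 0 < Mm := by linarith [h.le_left]
  have key : ∀ {M t : ℝ}, L ≤ M → (M ^ (1 - β) * Real.exp (-(0.005 * M * t))) ^ 2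
      ≤ L ^ (1 - 2 * β) * (M * Real.exp (-(0.01 * M * t))) := fun {M t} hM => by
    have hM0 : 0 < M := by linarith
    have e1 : Real.exp (-(0.005 * M * t)) ^ 2 = Real.exp (-(0.01 * M * t)) := by
      rw [← Real.exp_nat_mul]; congr 1; push_cast; ring
    have e2 : (M ^ (1 - β)) ^ 2 = M ^ (1 - 2 * β) * M := by
      rw [← Real.rpow_natCast, ← Real.rpow_mul hM0.le, ← Real.rpow_add_one hM0.ne']
      congr 1; push_cast; ring
    have h1 := Real.rpow_le_rpow_of_nonpos hL0 hM (by linarith : 1 - 2 * β ≤ 0)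
    rw [mul_pow, e1, e2, mul_assoc]
    gcongr
  have e3 : (L ^ (1 / 2 - β)) ^ 2 = L ^ (1 - 2 * β) := by
    rw [← Real.rpow_natCast, ← Real.rpow_mul hL0.le]
    congr 1; push_cast; ring
  refine normLp_two_le (by positivity) (Continuous.continuousOn (by fun_prop)) (fun y hy => ?_)
    (integral_combination_le hp hm (s := L ^ (1 - 2 * β)) (s' := L ^ (1 - 2 * β))
      (d := 2 * (A * (200 * β) ^ β) ^ 2) (c := 0.01) (by positivity) (by positivity) (by positivity)
      (by norm_num) ?_)
  · rw [norm_weighted hy]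
    have ht := one_sub_abs_nonneg hy
    have h1 := h.weighted_le (by linarith : 0 ≤ β) hy
    have h2 := key (t := 1 - |y|) h.le_right
    have h3 := key (t := 1 - |y|) h.le_left
    generalize Mp ^ (1 - β) * Real.exp (-(0.005 * Mp * (1 - |y|))) = u at *
    generalize Mm ^ (1 - β) * Real.exp (-(0.005 * Mm * (1 - |y|))) = v at *
    calc ((1 - |y|) ^ β * ‖w y‖) ^ 2 ≤ (A * (200 * β) ^ β * (u + v)) ^ 2 := by gcongr
      _ = (A * (200 * β) ^ β) ^ 2 * (u + v) ^ 2 := by ring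
      _ ≤ (A * (200 * β) ^ β) ^ 2 * (2 * (u ^ 2 + v ^ 2)) := by
        gcongr; nlinarith [sq_nonneg (u - v)]
      _ ≤ (A * (200 * β) ^ β) ^ 2 * (2 * (L ^ (1 - 2 * β) * (Mp * Real.exp (-(0.01 * Mp * (1 - |y|))))
          + L ^ (1 - 2 * β) * (Mm * Real.exp (-(0.01 * Mm * (1 - |y|)))))) := by gcongr
      _ = _ := by ring
  · rw [mul_pow _ (L ^ (1 / 2 - β)), e3, ← sub_nonneg]
    have : 0 ≤ (A * (200 * β) ^ β) ^ 2 * L ^ (1 - 2 * β) := by positivity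
    nlinarith

lemma normLp_top_le (h : LayerBound A L Mp Mm w) :
    normLp ∞ w ≤ ENNReal.ofReal (4 * A * Mp) := by
  have hL := h.one_le
  have hA := h.nonneg
  have hp : 0 < Mp := by linarith [h.le_right]
  have hm : 0 < Mm := by linarith [h.le_left]
  refine _root_.normLp_top_le fun y hy => (h.bound y hy).trans ?_
  have ht := one_sub_abs_nonneg hy
  have key : ∀ {M : ℝ}, 0 < M → layerProfile M (1 - |y|) ≤ M := fun {M} hM => by
    refine mul_le_of_le_one_right hM.le ?_
    rw [Real.exp_le_one_iff, neg_nonpos]; positivity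
  calc _ ≤ A * (Mp + 1 / Mp * (3 * Mp ^ 2)) := by
        gcongr
        · exact key hp
        · exact (key hm).trans h.left_le
    _ = _ := by field_simp; ring

lemma normLp_two_le (h : LayerBound A L Mp Mm w) :
    normLp 2 w ≤ ENNReal.ofReal (30 * A * √Mp) := by
  have hL := h.one_le
  have hA := h.nonneg
  have hp1 : 1 ≤ Mp := by linarith [h.le_right]
  have hp : 0 < Mp := by linarith
  have hm : 0 < Mm := by linarith [h.le_left]
  refine _root_.normLp_two_le (by positivity) (Continuous.continuousOn (by fun_prop))
    (fun y hy => ?_)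
    (integral_combination_le hp hm (s := Mp) (s' := 1 / Mp ^ 2 * Mm)
      (d := 2 * A ^ 2) (c := 0.02) (by positivity) (by positivity) (by positivity)
      (by norm_num) ?_)
  · have h1 := h.bound y hy
    have e : ∀ M : ℝ, layerProfile M (1 - |y|) ^ 2
        = M * (M * Real.exp (-(0.02 * M * (1 - |y|)))) := fun M => by
      rw [layerProfile, mul_pow, ← Real.exp_nat_mul, pow_two, mul_assoc]
      congr 4; push_cast; ring
    calc ‖w y‖ ^ 2 ≤ (A * (layerProfile Mp (1 - |y|) + 1 / Mp * layerProfile Mm (1 - |y|))) ^ 2 := by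
          gcongr
      _ ≤ 2 * A ^ 2 * (layerProfile Mp (1 - |y|) ^ 2 +
          1 / Mp ^ 2 * layerProfile Mm (1 - |y|) ^ 2) := by
        have e2 : 1 / Mp ^ 2 * layerProfile Mm (1 - |y|) ^ 2
          = (1 / Mp * layerProfile Mm (1 - |y|)) ^ 2 := by ring
        rw [e2, mul_pow, mul_comm 2, mul_assoc]
        gcongr
        nlinarith [sq_nonneg (layerProfile Mp (1 - |y|) - 1 / Mp * layerProfile Mm (1 - |y|))]
      _ = _ := by rw [e, e]; ring
  · have h1 : 1 / Mp ^ 2 * Mm ≤ 3 := by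
      rw [div_mul_eq_mul_div, one_mul, div_le_iff₀ (by positivity)]; exact h.left_le
    generalize 1 / Mp ^ 2 * Mm = z at *
    have h2 : z ≤ 3 * Mp := by linarith
    rw [mul_pow, Real.sq_sqrt hp.le]
    calc _ ≤ 2 * A ^ 2 * (Mp * (2 / 0.02) + 3 * Mp * (2 / 0.02)) := by
          gcongr
      _ ≤ _ := by nlinarith [mul_nonneg (sq_nonneg A) hp.le]

end LayerBound

/-! ### The Orr-Sommerfeld problem as a first order system -/

lemma uniqueDiffOn_closedChannel : UniqueDiffOn ℝ closedChannel := uniqueDiffOn_Icc (by norm_num)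

lemma dyy_eq (f : ℝ → ℂ) : dyy f = derivWithin (dy f) closedChannel := by
  funext y
  rw [dyy, iteratedDerivWithin_succ, iteratedDerivWithin_one]
  rfl

lemma ContDiffOn.hasDerivWithinAt_dy {f : ℝ → ℂ} (hf : ContDiffOn ℝ 2 f closedChannel) {y : ℝ}
    (hy : y ∈ closedChannel) : HasDerivWithinAt f (dy f y) closedChannel y :=
  (hf.differentiableOn (by norm_num) y hy).hasDerivWithinAt

lemma ContDiffOn.hasDerivWithinAt_dyy {f : ℝ → ℂ} (hf : ContDiffOn ℝ 2 f closedChannel) {y : ℝ}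
    (hy : y ∈ closedChannel) : HasDerivWithinAt (dy f) (dyy f y) closedChannel y := by
  rw [dyy_eq]
  have h1 : ContDiffOn ℝ 1 (derivWithin f closedChannel) closedChannel :=
    hf.derivWithin uniqueDiffOn_closedChannel (by norm_num)
  exact (h1.differentiableOn (by norm_num) y hy).hasDerivWithinAt

section SecondOrder

variable {f f' f'' : ℝ → ℂ}

lemma dy_eq_of_hasDerivWithinAt
    (h : ∀ y ∈ closedChannel, HasDerivWithinAt f (f' y) closedChannel y) :
    EqOn (dy f) f' closedChannel := fun y hy =>
  (h y hy).derivWithin (uniqueDiffOn_closedChannel y hy)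

lemma dyy_eq_of_hasDerivWithinAt
    (h : ∀ y ∈ closedChannel, HasDerivWithinAt f (f' y) closedChannel y)
    (h' : ∀ y ∈ closedChannel, HasDerivWithinAt f' (f'' y) closedChannel y) :
    EqOn (dyy f) f'' closedChannel := fun y hy => by
  have e := dy_eq_of_hasDerivWithinAt h
  rw [dyy_eq, derivWithin_congr e (e hy)]
  exact (h' y hy).derivWithin (uniqueDiffOn_closedChannel y hy)

lemma contDiffOn_two_of_hasDerivWithinAt
    (h : ∀ y ∈ closedChannel, HasDerivWithinAt f (f' y) closedChannel y)
    (h' : ∀ y ∈ closedChannel, HasDerivWithinAt f' (f'' y) closedChannel y)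
    (hc : ContinuousOn f'' closedChannel) :
    ContDiffOn ℝ 2 f closedChannel := by
  have e := dy_eq_of_hasDerivWithinAt h
  have h1 : ContDiffOn ℝ 1 f' closedChannel := by
    rw [contDiffOn_one_iff_derivWithin uniqueDiffOn_closedChannel]
    exact ⟨fun y hy => (h' y hy).differentiableWithinAt,
      hc.congr (dy_eq_of_hasDerivWithinAt h')⟩
  have h2 : ContDiffOn ℝ (1 + 1) f closedChannel := by
    rw [contDiffOn_succ_iff_derivWithin uniqueDiffOn_closedChannel]
    exact ⟨fun y hy => (h y hy).differentiableWithinAt, by simp, h1.congr e⟩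
  simpa [one_add_one_eq_two] using h2

end SecondOrder

/-- The coefficient `η² - a L² + i σ L³ (y - lam)`, where the sign `σ = ± 1` is that of `k`. -/
noncomputable def signedPotential (η a L σ lam y : ℝ) : ℂ :=
  ((η ^ 2 - a * L ^ 2 : ℝ) : ℂ) + ((σ * L ^ 3 * (y - lam) : ℝ) : ℂ) * Complex.I

/-- The Orr-Sommerfeld boundary value problem as a first order system, with Neumann data `bm` at
`y = -1` and `bp` at `y = 1`. -/
structure IsVorticitySystem (η : ℝ) (q : ℝ → ℂ) (bm bp : ℂ) (w w' W W' : ℝ → ℂ) : Prop where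
  deriv_w : ∀ y ∈ closedChannel, HasDerivWithinAt w (w' y) closedChannel y
  deriv_deriv_w : ∀ y ∈ closedChannel, HasDerivWithinAt w' (q y * w y) closedChannel y
  stream : IsStream η w W W'
  W_neg_one : W (-1) = 0
  W_one : W 1 = 0
  W'_neg_one : W' (-1) = bm
  W'_one : W' 1 = bp

namespace IsVorticitySystem

variable {η : ℝ} {q : ℝ → ℂ} {bm bp : ℂ} {w w' W W' : ℝ → ℂ}

lemma continuousOn (h : IsVorticitySystem η q bm bp w w' W W') : ContinuousOn w closedChannel :=
  fun y hy => (h.deriv_w y hy).continuousWithinAt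

lemma isCorrector (h : IsVorticitySystem η q 0 bp w w' W W') : IsCorrector η q bp w w' W W' :=
  ⟨h.deriv_w, h.deriv_deriv_w, h.stream, h.W_neg_one, h.W_one, h.W'_neg_one, h.W'_one⟩

lemma _root_.IsCorrector.isVorticitySystem (h : IsCorrector η q bp w w' W W') :
    IsVorticitySystem η q 0 bp w w' W W' :=
  ⟨h.deriv_w, h.deriv_deriv_w, h.stream, h.W_neg_one, h.W_one, h.W'_neg_one, h.W'_one⟩

open ComplexConjugate in
lemma conjugate (h : IsVorticitySystem η q bm bp w w' W W') :
    IsVorticitySystem η (fun y => conj (q y)) (conj bm) (conj bp) (fun y => conj (w y))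
      (fun y => conj (w' y)) (fun y => conj (W y)) (fun y => conj (W' y)) := by
  have hc : ∀ {u : ℝ → ℂ} {u' : ℂ} {y : ℝ}, HasDerivWithinAt u u' closedChannel y →
      HasDerivWithinAt (fun y => conj (u y)) (conj u') closedChannel y := fun {u u' y} hu =>
    Complex.conjCLE.toContinuousLinearMap.hasFDerivAt.comp_hasDerivWithinAt y hu
  refine ⟨fun y hy => hc (h.deriv_w y hy), fun y hy => ?_, ⟨fun y hy => hc (h.stream.deriv y hy),
    fun y hy => ?_⟩, ?_, ?_, ?_, ?_⟩
  · exact (hc (h.deriv_deriv_w y hy)).congr_deriv (by simp)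
  · exact (hc (h.stream.deriv_deriv y hy)).congr_deriv (by simp)
  · simp [h.W_neg_one]
  · simp [h.W_one]
  · simp [h.W'_neg_one]
  · simp [h.W'_one]

/-- Reflection exchanges the roles of the two walls. -/
lemma reflect (h : IsVorticitySystem η q bm bp w w' W W') :
    IsVorticitySystem η (fun y => q (-y)) bp bm (fun y => -w (-y))
      (fun y => w' (-y)) (fun y => -W (-y)) (fun y => W' (-y)) := by
  have hm : MapsTo (fun y : ℝ => -y) closedChannel closedChannel := fun y hy =>
    ⟨by linarith [hy.2], by linarith [hy.1]⟩
  have hc : ∀ {u : ℝ → ℂ} {u' : ℂ} {y : ℝ}, HasDerivWithinAt u u' closedChannel (-y) →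
      HasDerivWithinAt (fun y => u (-y)) (-u') closedChannel y := fun {u u' y} hu =>
    (hu.scomp y (hasDerivAt_neg y).hasDerivWithinAt hm).congr_deriv (by simp)
  refine ⟨fun y hy => ?_, fun y hy => ?_, ⟨fun y hy => ?_,
    fun y hy => ?_⟩, ?_, ?_, ?_, ?_⟩
  · exact (hc (h.deriv_w (-y) (hm hy))).neg.congr_deriv (by simp)
  · exact (hc (h.deriv_deriv_w (-y) (hm hy))).congr_deriv (by simp)
  · exact (hc (h.stream.deriv (-y) (hm hy))).neg.congr_deriv (by simp)
  · exact (hc (h.stream.deriv_deriv (-y) (hm hy))).congr_deriv (by simp; ring)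
  · simp [h.W_one]
  · simp [h.W_neg_one]
  · simp [h.W'_one]
  · simp [h.W'_neg_one]

lemma sub {bm' bp' : ℂ} {v v' V V' : ℝ → ℂ} (h : IsVorticitySystem η q bm bp w w' W W')
    (hv : IsVorticitySystem η q bm' bp' v v' V V') :
    IsVorticitySystem η q (bm - bm') (bp - bp') (fun y => w y - v y) (fun y => w' y - v' y)
      (fun y => W y - V y) (fun y => W' y - V' y) := by
  refine ⟨fun y hy => (h.deriv_w y hy).sub (hv.deriv_w y hy), fun y hy => ?_,
    ⟨fun y hy => (h.stream.deriv y hy).sub (hv.stream.deriv y hy), fun y hy => ?_⟩, ?_, ?_, ?_, ?_⟩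
  · exact ((h.deriv_deriv_w y hy).sub (hv.deriv_deriv_w y hy)).congr_deriv (by ring)
  · exact ((h.stream.deriv_deriv y hy).sub (hv.stream.deriv_deriv y hy)).congr_deriv (by ring)
  · simp [h.W_neg_one, hv.W_neg_one]
  · simp [h.W_one, hv.W_one]
  · simp [h.W'_neg_one, hv.W'_neg_one]
  · simp [h.W'_one, hv.W'_one]

end IsVorticitySystem

lemma conj_signedPotential (η a L σ lam y : ℝ) :
    (starRingEnd ℂ) (signedPotential η a L σ lam y) = signedPotential η a L (-σ) lam y := by
  simp only [signedPotential, map_add, map_mul, Complex.conj_ofReal, Complex.conj_I]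
  push_cast; ring

lemma signedPotential_neg (η a L σ lam y : ℝ) :
    signedPotential η a L σ lam (-y) = signedPotential η a L (-σ) (-lam) y := by
  simp only [signedPotential]
  push_cast; ring

lemma signedPotential_one (η a L lam : ℝ) :
    signedPotential η a L 1 lam = orrPotential η a L lam := by
  funext y
  simp [signedPotential, orrPotential]

lemma continuous_signedPotential (η a L σ lam : ℝ) : Continuous (signedPotential η a L σ lam) := by
  unfold signedPotential; fun_prop

/-! ### Pointwise bounds, existence and uniqueness -/

lemma le_edgeRate {η L : ℝ} (hη : 0 ≤ η) (x : ℝ) : L ≤ edgeRate η L x := by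
  have := Real.sqrt_nonneg (L ^ 3 * |x|)
  rw [edgeRate]; linarith

/-- The rates of the two walls are comparable up to the contribution `(2 L³)^{1/2}` of the width of
the channel. -/
lemma edgeRate_le {η L x z : ℝ} (hη : 0 ≤ η) (hL : 1 ≤ L) (h : |x| ≤ |z| + 2) :
    edgeRate η L x ≤ 3 * edgeRate η L z ^ 2 := by
  have h1 : √(L ^ 3 * |x|) ≤ √(L ^ 3 * |z|) + 2 * L ^ 2 := by
    refine Real.sqrt_le_iff.2 ⟨by positivity, ?_⟩
    have h2 := Real.sq_sqrt (show 0 ≤ L ^ 3 * |z| by positivity)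
    have h3 := Real.sqrt_nonneg (L ^ 3 * |z|)
    have h4 : L ^ 3 * |x| ≤ L ^ 3 * (|z| + 2) := by gcongr
    have h5 : L ^ 3 ≤ L ^ 4 := pow_le_pow_right₀ hL (by norm_num)
    nlinarith [mul_nonneg h3 (sq_nonneg L)]
  have h2 := le_edgeRate (L := L) hη z
  have h3 : edgeRate η L x ≤ edgeRate η L z + 2 * L ^ 2 := by
    simp only [edgeRate] at *; linarith
  nlinarith

section Bounds

variable {η a L σ lam : ℝ}

/-- The pointwise bound of a corrector of the wall `y = 1`, by the sizes of its coefficients. -/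
lemma IsCorrector.norm_le (hη : 1 ≤ η) (ha0 : 0 ≤ a) (ha : a ≤ 0.0005) (hL : 10 ^ 10 ≤ L) {b : ℂ}
    {w w' W W' : ℝ → ℂ} (h : IsCorrector η (orrPotential η a L lam) b w w' W W') {y : ℝ}
    (hy : y ∈ closedChannel) :
    ‖w y‖ ≤ ‖b‖ * (4e12 * (layerProfile (edgeRate η L (1 - lam)) (1 - |y|) +
      1 / edgeRate η L (1 - lam) * layerProfile (edgeRate η L (1 + lam)) (1 - |y|))) := by
  have hη0 : 0 ≤ η := by linarith
  obtain ⟨p, p', hp⟩ := exists_edgeLayer hη0 ha0 ha (by linarith) lam (L := L)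
  obtain ⟨m, m', hm⟩ := exists_leftEdgeLayer hη0 ha0 ha (by linarith) lam (L := L)
  have hMp := le_edgeRate (L := L) hη0 (1 - lam)
  have hMm := le_edgeRate (L := L) hη0 (1 + lam)
  generalize edgeRate η L (1 - lam) = Mp at *
  generalize edgeRate η L (1 + lam) = Mm at *
  have hMp0 : 0 < Mp := by linarith
  have hMm0 : 0 < Mm := by linarith
  obtain ⟨cp, cm, hw, hcp, hcm⟩ := h.exists_coefficients hp hm hη (by linarith) (by linarith)
  have dp : ‖p y‖ ≤ Real.exp (-(0.01 * Mp * (1 - |y|))) := by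
    refine (hp.decay y hy).trans ?_
    gcongr
    exact le_abs_self y
  have dm : ‖m y‖ ≤ Real.exp (-(0.01 * Mm * (1 - |y|))) := by
    refine (hm.decay y hy).trans ?_
    gcongr
    linarith [neg_abs_le y]
  rw [hw y hy]
  calc ‖cp * p y + cm * m y‖ ≤ ‖cp‖ * ‖p y‖ + ‖cm‖ * ‖m y‖ := by
        refine (norm_add_le _ _).trans_eq ?_
        rw [norm_mul, norm_mul]
    _ ≤ 5e9 * Mp * ‖b‖ * Real.exp (-(0.01 * Mp * (1 - |y|)))
        + 4e12 * (Mm / Mp) * ‖b‖ * Real.exp (-(0.01 * Mm * (1 - |y|))) := by gcongr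
    _ ≤ 4e12 * Mp * ‖b‖ * Real.exp (-(0.01 * Mp * (1 - |y|)))
        + 4e12 * (Mm / Mp) * ‖b‖ * Real.exp (-(0.01 * Mm * (1 - |y|))) := by gcongr; norm_num
    _ = _ := by unfold layerProfile; ring

namespace IsVorticitySystem

lemma norm_le (hη : 1 ≤ η) (ha0 : 0 ≤ a) (ha : a ≤ 0.0005) (hL : 10 ^ 10 ≤ L)
    (hσ : σ = 1 ∨ σ = -1) {b : ℂ} {w w' W W' : ℝ → ℂ}
    (h : IsVorticitySystem η (signedPotential η a L σ lam) 0 b w w' W W') {y : ℝ}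
    (hy : y ∈ closedChannel) :
    ‖w y‖ ≤ ‖b‖ * (4e12 * (layerProfile (edgeRate η L (1 - lam)) (1 - |y|) +
      1 / edgeRate η L (1 - lam) * layerProfile (edgeRate η L (1 + lam)) (1 - |y|))) := by
  rcases hσ with rfl | rfl
  · rw [signedPotential_one] at h
    exact h.isCorrector.norm_le hη ha0 ha hL hy
  · have h' := h.conjugate
    simp only [conj_signedPotential, neg_neg, signedPotential_one, map_zero] at h'
    simpa only [RCLike.norm_conj] using h'.isCorrector.norm_le hη ha0 ha hL hy

/-- Uniqueness: the bound by the Neumann data forces the vorticity to vanish, and then the energy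
estimate forces the stream function to vanish. -/
lemma eqOn_zero (hη : 1 ≤ η) (ha0 : 0 ≤ a) (ha : a ≤ 0.0005) (hL : 10 ^ 10 ≤ L)
    (hσ : σ = 1 ∨ σ = -1) {w w' W W' : ℝ → ℂ}
    (h : IsVorticitySystem η (signedPotential η a L σ lam) 0 0 w w' W W') :
    EqOn w 0 closedChannel ∧ EqOn W 0 closedChannel := by
  have hw : EqOn w 0 closedChannel := fun y hy => by
    have := h.norm_le hη ha0 ha hL hσ hy
    rw [norm_zero, zero_mul] at this
    exact norm_le_zero_iff.1 this
  refine ⟨hw, fun y hy => ?_⟩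
  have h1 := h.stream.energy_le h.continuousOn h.W_neg_one h.W_one
  have h2 : ∫ y in (-1 : ℝ)..1, √(1 - |y|) * ‖w y‖ = 0 := by
    rw [intervalIntegral.integral_congr (g := fun _ => (0 : ℝ)), intervalIntegral.integral_zero]
    intro x hx
    rw [uIcc_of_le (by norm_num)] at hx
    simp [hw hx]
  rw [h2, zero_pow two_ne_zero] at h1
  have h3 := h.stream.norm_le_sqrt_energy h.W_neg_one h.W_one hy
  rw [Real.sqrt_eq_zero_of_nonpos h1, mul_zero] at h3
  exact norm_le_zero_iff.1 h3

lemma exists_right (hη : 1 ≤ η) (ha0 : 0 ≤ a) (ha : a ≤ 0.0005) (hL : 10 ^ 10 ≤ L)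
    (hσ : σ = 1 ∨ σ = -1) (lam : ℝ) : ∃ w w' W W',
    IsVorticitySystem η (signedPotential η a L σ lam) 0 1 w w' W W' := by
  have hη0 : 0 ≤ η := by linarith
  obtain ⟨p, p', hp⟩ := exists_edgeLayer hη0 ha0 ha (by linarith) lam (L := L)
  obtain ⟨m, m', hm⟩ := exists_leftEdgeLayer hη0 ha0 ha (by linarith) lam (L := L)
  obtain ⟨w, w', W, W', h⟩ := exists_isCorrector hp hm hη (hL.trans (le_edgeRate hη0 _))
    (hL.trans (le_edgeRate hη0 _)) 1
  have h1 := h.isVorticitySystem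
  rw [← signedPotential_one] at h1
  rcases hσ with rfl | rfl
  · exact ⟨_, _, _, _, h1⟩
  · have h2 := h1.conjugate
    simp only [conj_signedPotential, map_zero, map_one] at h2
    exact ⟨_, _, _, _, h2⟩

lemma exists_left (hη : 1 ≤ η) (ha0 : 0 ≤ a) (ha : a ≤ 0.0005) (hL : 10 ^ 10 ≤ L)
    (hσ : σ = 1 ∨ σ = -1) (lam : ℝ) : ∃ w w' W W',
    IsVorticitySystem η (signedPotential η a L σ lam) 1 0 w w' W W' := by
  obtain ⟨w, w', W, W', h⟩ := exists_right hη ha0 ha hL (σ := -σ)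
    (by rcases hσ with rfl | rfl <;> simp) (-lam)
  have h2 := h.reflect
  simp only [signedPotential_neg, neg_neg] at h2
  exact ⟨_, _, _, _, h2⟩

lemma layerBound_right (hη : 1 ≤ η) (ha0 : 0 ≤ a) (ha : a ≤ 0.0005) (hL : 10 ^ 10 ≤ L)
    (hσ : σ = 1 ∨ σ = -1) {w w' W W' : ℝ → ℂ}
    (h : IsVorticitySystem η (signedPotential η a L σ lam) 0 1 w w' W W') :
    LayerBound 4e12 L (edgeRate η L (1 - lam)) (edgeRate η L (1 + lam)) w := by
  have hη0 : 0 ≤ η := by linarith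
  refine ⟨by linarith, by norm_num, le_edgeRate hη0 _, le_edgeRate hη0 _,
    edgeRate_le hη0 (by linarith) ?_, fun y hy => ?_⟩
  · have h1 := abs_add_le (-(1 - lam)) 2
    rw [abs_neg, abs_of_pos (by norm_num : (0:ℝ) < 2)] at h1
    rwa [show -(1 - lam) + 2 = 1 + lam by ring] at h1
  · have := h.norm_le hη ha0 ha hL hσ hy
    rwa [norm_one, one_mul] at this

lemma layerBound_left (hη : 1 ≤ η) (ha0 : 0 ≤ a) (ha : a ≤ 0.0005) (hL : 10 ^ 10 ≤ L)
    (hσ : σ = 1 ∨ σ = -1) {w w' W W' : ℝ → ℂ}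
    (h : IsVorticitySystem η (signedPotential η a L σ lam) 1 0 w w' W W') :
    LayerBound 4e12 L (edgeRate η L (1 + lam)) (edgeRate η L (1 - lam)) w := by
  have h2 := h.reflect
  simp only [signedPotential_neg] at h2
  have h3 := h2.layerBound_right hη ha0 ha hL (by rcases hσ with rfl | rfl <;> simp)
  rw [sub_neg_eq_add, ← sub_eq_add_neg] at h3
  refine ⟨h3.one_le, h3.nonneg, h3.le_left, h3.le_right, h3.left_le, fun y hy => ?_⟩
  have := h3.bound (-y) ⟨by linarith [hy.2], by linarith [hy.1]⟩
  simpa only [norm_neg, neg_neg, abs_neg] using this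

lemma eqOn (hη : 1 ≤ η) (ha0 : 0 ≤ a) (ha : a ≤ 0.0005) (hL : 10 ^ 10 ≤ L)
    (hσ : σ = 1 ∨ σ = -1) {bm bp : ℂ} {w w' W W' v v' V V' : ℝ → ℂ}
    (h : IsVorticitySystem η (signedPotential η a L σ lam) bm bp w w' W W')
    (hv : IsVorticitySystem η (signedPotential η a L σ lam) bm bp v v' V V') :
    EqOn w v closedChannel ∧ EqOn W V closedChannel := by
  have h1 := h.sub hv
  rw [sub_self, sub_self] at h1
  obtain ⟨h2, h3⟩ := h1.eqOn_zero hη ha0 ha hL hσ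
  exact ⟨fun y hy => sub_eq_zero.1 (h2 hy), fun y hy => sub_eq_zero.1 (h3 hy)⟩

end IsVorticitySystem

end Bounds

/-! ### The physical parameters -/

section Parameters

variable {ν : ℝ} {k l : ℤ}

lemma layerScale_pow_three (hν : 0 < ν) : layerScale ν k ^ 3 = |(k : ℝ)| / ν := by
  rw [layerScale, ← Real.rpow_natCast, ← Real.rpow_mul (by positivity)]
  norm_num

/-- The zeroth order term of the equation, divided by the viscosity, is `a L²`. -/
lemma viscous_rate (hν : 0 < ν) :
    (ν * (k : ℝ) ^ 2) ^ (1 / 3 : ℝ) = ν * layerScale ν k ^ 2 := by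
  have h0 : 0 ≤ layerScale ν k := by unfold layerScale; positivity
  have e : ν * (k : ℝ) ^ 2 = (ν * layerScale ν k ^ 2) ^ 3 := by
    have : (layerScale ν k ^ 2) ^ 3 = (layerScale ν k ^ 3) ^ 2 := by ring
    rw [mul_pow, this, layerScale_pow_three hν, div_pow, sq_abs]
    field_simp
  rw [e, ← Real.rpow_natCast, ← Real.rpow_mul (by positivity)]
  norm_num

lemma sign_mul_layerScale (hν : 0 < ν) (hk : k ≠ 0) :
    ∃ σ : ℝ, (σ = 1 ∨ σ = -1) ∧ σ * layerScale ν k ^ 3 = k / ν := by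
  rw [layerScale_pow_three hν]
  rcases lt_or_gt_of_ne hk with h | h
  · have : (k : ℝ) < 0 := by exact_mod_cast h
    exact ⟨-1, Or.inr rfl, by rw [abs_of_neg this]; ring⟩
  · have : (0 : ℝ) < k := by exact_mod_cast h
    exact ⟨1, Or.inl rfl, by rw [abs_of_pos this]; ring⟩

lemma one_le_abs_cast (hk : k ≠ 0) : 1 ≤ |(k : ℝ)| := by exact_mod_cast Int.one_le_abs hk

lemma abs_le_waveNumber (k l : ℤ) : |(k : ℝ)| ≤ waveNumber k l := by
  rw [waveNumber]
  exact Real.abs_le_sqrt (by nlinarith [sq_nonneg (l : ℝ)])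

lemma waveNumber_le (k l : ℤ) : waveNumber k l ≤ |(k : ℝ)| + |(l : ℝ)| := by
  rw [waveNumber]
  refine Real.sqrt_le_iff.2 ⟨by positivity, ?_⟩
  nlinarith [sq_abs (k : ℝ), sq_abs (l : ℝ), mul_nonneg (abs_nonneg (k : ℝ)) (abs_nonneg (l : ℝ))]

variable {lam a σ : ℝ} {bm bp : ℂ} {w w' W W' : ℝ → ℂ}

lemma IsOrrSommerfeldSolution.isVorticitySystem (hν : 0 < ν)
    (hσ : σ * layerScale ν k ^ 3 = k / ν) (h : IsOrrSommerfeldSolution ν k l lam a bm bp w W) :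
    IsVorticitySystem (waveNumber k l)
      (signedPotential (waveNumber k l) a (layerScale ν k) σ lam) bm bp w (dy w) W (dy W) := by
  have hνc : (ν : ℂ) ≠ 0 := Complex.ofReal_ne_zero.2 hν.ne'
  refine ⟨fun y hy => h.contDiffOn_w.hasDerivWithinAt_dy hy, fun y hy => ?_,
    ⟨fun y hy => h.contDiffOn_W.hasDerivWithinAt_dy hy, fun y hy => ?_⟩, h.W_neg_one, h.W_one,
    h.dy_W_neg_one, h.dy_W_one⟩
  · refine (h.contDiffOn_w.hasDerivWithinAt_dyy hy).congr_deriv ?_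
    have h1 := h.orrSommerfeld y hy
    rw [viscous_rate hν] at h1
    rw [signedPotential, hσ]
    push_cast at h1 ⊢
    field_simp
    linear_combination -h1
  · refine (h.contDiffOn_W.hasDerivWithinAt_dyy hy).congr_deriv ?_
    rw [h.stream y hy]; ring

lemma IsVorticitySystem.isOrrSommerfeldSolution (hν : 0 < ν)
    (hσ : σ * layerScale ν k ^ 3 = k / ν) (h : IsVorticitySystem (waveNumber k l)
      (signedPotential (waveNumber k l) a (layerScale ν k) σ lam) bm bp w w' W W') :
    IsOrrSommerfeldSolution ν k l lam a bm bp w W := by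
  have hνc : (ν : ℂ) ≠ 0 := Complex.ofReal_ne_zero.2 hν.ne'
  have hI : (-1 : ℝ) ∈ closedChannel := ⟨le_rfl, by norm_num⟩
  have hI' : (1 : ℝ) ∈ closedChannel := ⟨by norm_num, le_rfl⟩
  have eW := dy_eq_of_hasDerivWithinAt h.stream.deriv
  refine ⟨contDiffOn_two_of_hasDerivWithinAt h.deriv_w h.deriv_deriv_w
      ((continuous_signedPotential _ _ _ _ _).continuousOn.mul h.continuousOn),
    contDiffOn_two_of_hasDerivWithinAt h.stream.deriv h.stream.deriv_deriv
      ((continuousOn_const.mul h.stream.continuousOn).add h.continuousOn), fun y hy => ?_,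
    fun y hy => ?_, h.W_neg_one, h.W_one, ?_, ?_⟩
  · rw [dyy_eq_of_hasDerivWithinAt h.deriv_w h.deriv_deriv_w hy, viscous_rate hν]
    simp only [signedPotential, hσ]
    push_cast
    field_simp
    ring
  · rw [dyy_eq_of_hasDerivWithinAt h.stream.deriv h.stream.deriv_deriv hy]
    ring
  · rw [eW hI, h.W'_neg_one]
  · rw [eW hI', h.W'_one]

/-! ### The bounds in terms of the physical parameters -/

lemma edgeRate_le_sup {η L x : ℝ} (hL : 0 ≤ L) :
    edgeRate η L x ≤ 2 * ((L ^ 3 * |x| + η ^ 2) ^ (1 / 2 : ℝ) + L) := by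
  rw [← Real.sqrt_eq_rpow, edgeRate]
  have hX : 0 ≤ L ^ 3 * |x| := by positivity
  have h1 : √(L ^ 3 * |x|) ≤ √(L ^ 3 * |x| + η ^ 2) := Real.sqrt_le_sqrt (by nlinarith)
  have h2 : η ≤ √(L ^ 3 * |x| + η ^ 2) := Real.le_sqrt_of_sq_le (by linarith)
  linarith

lemma sqrt_add_le {x z : ℝ} (hx : 0 ≤ x) (hz : 0 ≤ z) : √(x + z) ≤ √x + √z := by
  rw [Real.sqrt_le_left (by positivity)]
  have := mul_nonneg (Real.sqrt_nonneg x) (Real.sqrt_nonneg z)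
  nlinarith [Real.sq_sqrt hx, Real.sq_sqrt hz]

/-- Either `|l| ≤ L + |k|`, or `|l|^{1/2} ≤ (L + |k|)^{-1/2} |l|`. -/
lemma sqrt_edgeRate_le {L x : ℝ} (hL : 0 < L) (k l : ℤ) :
    √(edgeRate (waveNumber k l) L x) ≤ 2 * (((L ^ 3 * |x|) ^ (1 / 4 : ℝ) + √L + |(k : ℝ)| ^ (1 / 2 : ℝ))
      + (L + |(k : ℝ)|) ^ (-(1 / 2) : ℝ) * |(l : ℝ)|) := by
  have hX : 0 ≤ L ^ 3 * |x| := by positivity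
  have hη : 0 ≤ waveNumber k l := Real.sqrt_nonneg _
  have e1 : √√(L ^ 3 * |x|) = (L ^ 3 * |x|) ^ (1 / 4 : ℝ) := by
    rw [Real.sqrt_eq_rpow, Real.sqrt_eq_rpow, ← Real.rpow_mul hX]; norm_num
  have h1 : √(edgeRate (waveNumber k l) L x) ≤ √L + √(waveNumber k l) + √√(L ^ 3 * |x|) := by
    rw [edgeRate]
    refine (sqrt_add_le (by positivity) (Real.sqrt_nonneg _)).trans ?_
    gcongr
    exact sqrt_add_le hL.le hη
  have h2 : √(waveNumber k l) ≤ √|(k : ℝ)| + √|(l : ℝ)| :=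
    (Real.sqrt_le_sqrt (waveNumber_le k l)).trans (sqrt_add_le (abs_nonneg _) (abs_nonneg _))
  have hS : 0 < L + |(k : ℝ)| := by positivity
  have h3 : √|(l : ℝ)| ≤ √L + √|(k : ℝ)| + (L + |(k : ℝ)|) ^ (-(1 / 2) : ℝ) * |(l : ℝ)| := by
    rw [Real.rpow_neg hS.le, ← Real.sqrt_eq_rpow]
    rcases le_total |(l : ℝ)| (L + |(k : ℝ)|) with h | h
    · have := (Real.sqrt_le_sqrt h).trans (sqrt_add_le hL.le (abs_nonneg _))
      have : 0 ≤ (√(L + |(k : ℝ)|))⁻¹ * |(l : ℝ)| := by positivity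
      linarith
    · have h4 : √|(l : ℝ)| ≤ (√(L + |(k : ℝ)|))⁻¹ * |(l : ℝ)| := by
        rw [inv_mul_eq_div, le_div_iff₀ (Real.sqrt_pos.2 hS)]
        calc √|(l : ℝ)| * √(L + |(k : ℝ)|) ≤ √|(l : ℝ)| * √|(l : ℝ)| := by gcongr
          _ = _ := Real.mul_self_sqrt (abs_nonneg _)
      have := Real.sqrt_nonneg L
      have := Real.sqrt_nonneg |(k : ℝ)|
      linarith
  rw [e1] at h1
  rw [← Real.sqrt_eq_rpow]
  have := Real.rpow_nonneg hX (1 / 4)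
  have := Real.sqrt_nonneg L
  have := Real.sqrt_nonneg |(k : ℝ)|
  have h5 : 0 ≤ (L + |(k : ℝ)|) ^ (-(1 / 2) : ℝ) * |(l : ℝ)| := by positivity
  linarith

/-- The energy estimate with the weighted `L¹` bound of exponent `1 / 2`. -/
lemma normLp_gradLength_le {A L Mp Mm : ℝ} (h : LayerBound A L Mp Mm w)
    (hw : ContinuousOn w closedChannel) (hW : IsStream (waveNumber k l) w W (dy W))
    (h1 : W (-1) = 0) (h2 : W 1 = 0) :
    normLp 2 (gradLength k l W) ≤ ENNReal.ofReal (8000 * A * L ^ (-(1 / 2) : ℝ)) := by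
  have hL : 0 < L := by linarith [h.one_le]
  have hA := h.nonneg
  refine normLp_two_le (by positivity) hW.continuousOn_energy (fun y hy => ?_)
    ((hW.energy_le hw h1 h2).trans ?_)
  · rw [gradLength, Real.norm_of_nonneg (Real.sqrt_nonneg _), Real.sq_sqrt (by positivity)]
  · have h3 := h.integral_weighted_le hw (α := 1 / 2) (by norm_num)
    have e : (200 * (1 / 2) : ℝ) ^ (1 / 2 : ℝ) = 10 := by
      rw [← Real.sqrt_eq_rpow, show (200 * (1 / 2) : ℝ) = 10 ^ 2 by norm_num]
      exact Real.sqrt_sq (by norm_num)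
    have h0 : 0 ≤ ∫ y in (-1 : ℝ)..1, √(1 - |y|) * ‖w y‖ :=
      intervalIntegral.integral_nonneg (by norm_num) fun y _ => by positivity
    rw [e] at h3
    simp only [← Real.sqrt_eq_rpow] at h3
    gcongr
    linarith

/-- The duality estimate with the weighted `L¹` bound of exponent `1`, and `η ≥ |k|`. -/
lemma normLp_stream_le {A L Mp Mm : ℝ} (h : LayerBound A L Mp Mm w) (hk : k ≠ 0)
    (hw : ContinuousOn w closedChannel) (hW : IsStream (waveNumber k l) w W (dy W))
    (h1 : W (-1) = 0) (h2 : W 1 = 0) :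
    ENNReal.ofReal (|(k : ℝ)| ^ (1 / 2 : ℝ)) * normLp 2 W
      ≤ ENNReal.ofReal (4e5 * A * L ^ (-1 : ℝ)) := by
  have hL : 0 < L := by linarith [h.one_le]
  have hA := h.nonneg
  have hk1 := one_le_abs_cast hk
  have hkη := abs_le_waveNumber k l
  have hη0 : 0 < waveNumber k l := by linarith
  have hB := h.integral_weighted_le hw (α := 1) (by norm_num)
  simp only [Real.rpow_one, mul_one] at hB
  have h0 : 0 ≤ ∫ y in (-1 : ℝ)..1, (1 - |y|) * ‖w y‖ :=
    intervalIntegral.integral_nonneg (by norm_num) fun y hy =>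
      mul_nonneg (one_sub_abs_nonneg hy) (norm_nonneg _)
  have h3 : normLp 2 W ≤ ENNReal.ofReal (4e5 * A * L ^ (-1 : ℝ) / √|(k : ℝ)|) := by
    refine normLp_two_le (by positivity) (hW.continuousOn.norm.pow 2) (fun y _ => le_rfl) ?_
    refine (hW.integral_sq_le hw (by linarith) h1 h2).trans ?_
    rw [div_pow, Real.sq_sqrt (abs_nonneg _)]
    calc _ ≤ 6 / |(k : ℝ)| * (800 * A * 200 * L ^ (-1 : ℝ)) ^ 2 := by gcongr
      _ = (6 * (800 * 200) ^ 2) * (A * L ^ (-1 : ℝ)) ^ 2 / |(k : ℝ)| := by ring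
      _ ≤ (4e5) ^ 2 * (A * L ^ (-1 : ℝ)) ^ 2 / |(k : ℝ)| := by gcongr; norm_num
      _ = _ := by ring
  calc _ ≤ ENNReal.ofReal (|(k : ℝ)| ^ (1 / 2 : ℝ)) *
        ENNReal.ofReal (4e5 * A * L ^ (-1 : ℝ) / √|(k : ℝ)|) := by gcongr
    _ = _ := by
      have : √|(k : ℝ)| ≠ 0 := (Real.sqrt_pos.2 (by linarith)).ne'
      rw [← ENNReal.ofReal_mul (by positivity), ← Real.sqrt_eq_rpow, mul_div_cancel₀ _ this]

lemma layerScale_inv_rpow (hν : 0 < ν) (hk : k ≠ 0) (s : ℝ) :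
    |ν / k| ^ s = layerScale ν k ^ (-(3 * s)) := by
  have h0 : 0 ≤ layerScale ν k := by unfold layerScale; positivity
  have hk1 := one_le_abs_cast hk
  rw [Real.rpow_neg h0, Real.rpow_mul h0, show (3 : ℝ) = (3 : ℕ) by norm_num, Real.rpow_natCast,
    layerScale_pow_three hν, ← Real.inv_rpow (by positivity), inv_div, abs_div, abs_of_pos hν]

lemma layerScale_rpow (hν : 0 < ν) (s : ℝ) : |k / ν| ^ s = layerScale ν k ^ (3 * s) := by
  have h0 : 0 ≤ layerScale ν k := by unfold layerScale; positivity
  rw [Real.rpow_mul h0, show (3 : ℝ) = (3 : ℕ) by norm_num, Real.rpow_natCast,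
    layerScale_pow_three hν, abs_div, abs_of_pos hν]

lemma layerScale_pow_three_mul (hν : 0 < ν) (x : ℝ) :
    layerScale ν k ^ 3 * |x| = |k * x / ν| := by
  rw [layerScale_pow_three hν, abs_div, abs_mul, abs_of_pos hν]; ring

lemma ENNReal.add_le_ofReal {x y : ℝ≥0∞} {r s t : ℝ} (hr : 0 ≤ r) (hs : 0 ≤ s)
    (hx : x ≤ ENNReal.ofReal r) (hy : y ≤ ENNReal.ofReal s) (h : r + s ≤ t) :
    x + y ≤ ENNReal.ofReal t :=
  (add_le_add hx hy).trans (by rw [← ENNReal.ofReal_add hr hs]; exact ENNReal.ofReal_le_ofReal h)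

end Parameters

theorem proposition5p1 :
    ∃ ε₁ k₀ C : ℝ, ∃ K : ℝ → ℝ, 0 < ε₁ ∧ 1 < k₀ ∧ 0 < C ∧ (∀ s, 0 < K s) ∧
      ∀ (ν : ℝ) (k l : ℤ) (lam a : ℝ), 0 < ν → 0 ≤ a → a ≤ ε₁ → k₀ ≤ layerScale ν k →
        -- the correctors exist and are unique
        (∃ w W, IsCorrectorOne ν k l lam a w W) ∧
        (∃ w W, IsCorrectorTwo ν k l lam a w W) ∧
        (∀ w W w' W', IsCorrectorOne ν k l lam a w W → IsCorrectorOne ν k l lam a w' W' →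
          EqOn w w' closedChannel ∧ EqOn W W' closedChannel) ∧
        (∀ w W w' W', IsCorrectorTwo ν k l lam a w W → IsCorrectorTwo ν k l lam a w' W' →
          EqOn w w' closedChannel ∧ EqOn W W' closedChannel) ∧
        ∀ w₁ W₁ w₂ W₂ : ℝ → ℂ,
          IsCorrectorOne ν k l lam a w₁ W₁ → IsCorrectorTwo ν k l lam a w₂ W₂ →
          -- sup bounds
          normLp ∞ w₁ ≤ ENNReal.ofReal (C * ((|k * (lam - 1) / ν| + waveNumber k l ^ 2) ^ (1 / 2 : ℝ)
            + (|(k : ℝ)| / ν) ^ (1 / 3 : ℝ))) ∧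
          normLp ∞ w₂ ≤ ENNReal.ofReal (C * ((|k * (lam + 1) / ν| + waveNumber k l ^ 2) ^ (1 / 2 : ℝ)
            + (|(k : ℝ)| / ν) ^ (1 / 3 : ℝ))) ∧
          -- weighted bounds
          (∀ α : ℝ, 0 ≤ α → normLp 1 (weighted α w₁) + normLp 1 (weighted α w₂)
            ≤ ENNReal.ofReal (K α * layerScale ν k ^ (-α))) ∧
          (∀ β : ℝ, 1 ≤ β → normLp ∞ (weighted β w₁) + normLp ∞ (weighted β w₂)
            ≤ ENNReal.ofReal (K β * layerScale ν k ^ (1 - β))) ∧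
          -- square-integral bounds
          normLp 2 w₁ ≤ ENNReal.ofReal (C * ((|k * (lam - 1) / ν| ^ (1 / 4 : ℝ)
              + |k / ν| ^ (1 / 6 : ℝ) + |(k : ℝ)| ^ (1 / 2 : ℝ))
            + (|k / ν| ^ (1 / 3 : ℝ) + |(k : ℝ)|) ^ (-(1 / 2) : ℝ) * |(l : ℝ)|)) ∧
          normLp 2 w₂ ≤ ENNReal.ofReal (C * ((|k * (lam + 1) / ν| ^ (1 / 4 : ℝ)
              + |k / ν| ^ (1 / 6 : ℝ) + |(k : ℝ)| ^ (1 / 2 : ℝ))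
            + (|k / ν| ^ (1 / 3 : ℝ) + |(k : ℝ)|) ^ (-(1 / 2) : ℝ) * |(l : ℝ)|)) ∧
          (∀ β : ℝ, 1 / 2 ≤ β → normLp 2 (weighted β w₁) + normLp 2 (weighted β w₂)
            ≤ ENNReal.ofReal (K β * layerScale ν k ^ (1 / 2 - β))) ∧
          normLp 2 (gradLength k l W₁) + normLp 2 (gradLength k l W₂)
            ≤ ENNReal.ofReal (C * |ν / k| ^ (1 / 6 : ℝ)) ∧
          ENNReal.ofReal (|(k : ℝ)| ^ (1 / 2 : ℝ)) * normLp 2 W₁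
              + ENNReal.ofReal (|(k : ℝ)| ^ (1 / 2 : ℝ)) * normLp 2 W₂
            ≤ ENNReal.ofReal (C * |ν / k| ^ (1 / 3 : ℝ)) := by
  -- `4e12` is the constant of the pointwise bound; `|s|` keeps the constants positive for negative `s`
  refine ⟨0.0005, 10 ^ 10, 4e18, fun s => 1600 * 4e12 * (200 * |s| + 1) ^ s, by norm_num,
    by norm_num, by norm_num, fun s => by positivity, ?_⟩
  intro ν k l lam a hν ha0 ha hL
  -- for `k = 0` the layer scale is `0 ^ (1 / 3) = 0`, which is not large
  have hk : k ≠ 0 := by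
    rintro rfl
    rw [layerScale, Int.cast_zero, abs_zero, zero_div, Real.zero_rpow (by norm_num)] at hL
    norm_num at hL
  obtain ⟨σ, hσ, hσL⟩ := sign_mul_layerScale hν hk
  have hη : 1 ≤ waveNumber k l := (one_le_abs_cast hk).trans (abs_le_waveNumber k l)
  have hL0 : 0 < layerScale ν k := by linarith
  have toSys := fun {bm bp : ℂ} {w W : ℝ → ℂ}
    (h : IsOrrSommerfeldSolution ν k l lam a bm bp w W) => h.isVorticitySystem hν hσL
  refine ⟨?_, ?_, fun w W w' W' h h' => ?_, fun w W w' W' h h' => ?_, ?_⟩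
  · obtain ⟨w, w', W, W', h⟩ := IsVorticitySystem.exists_right hη ha0 ha hL hσ lam
    exact ⟨w, W, h.isOrrSommerfeldSolution hν hσL⟩
  · obtain ⟨w, w', W, W', h⟩ := IsVorticitySystem.exists_left hη ha0 ha hL hσ lam
    exact ⟨w, W, h.isOrrSommerfeldSolution hν hσL⟩
  · exact (toSys h).eqOn hη ha0 ha hL hσ (toSys h')
  · exact (toSys h).eqOn hη ha0 ha hL hσ (toSys h')
  intro w₁ W₁ w₂ W₂ h₁ h₂
  have s₁ := toSys h₁
  have s₂ := toSys h₂
  have b₁ := s₁.layerBound_right hη ha0 ha hL hσ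
  have b₂ := s₂.layerBound_left hη ha0 ha hL hσ
  have x₁ : |k * (lam - 1) / ν| = layerScale ν k ^ 3 * |1 - lam| := by
    rw [abs_sub_comm, layerScale_pow_three_mul hν]
  have x₂ : |k * (lam + 1) / ν| = layerScale ν k ^ 3 * |1 + lam| := by
    rw [add_comm 1 lam, layerScale_pow_three_mul hν]
  have eL : (|(k : ℝ)| / ν) ^ (1 / 3 : ℝ) = layerScale ν k := rfl
  have e13 : |k / ν| ^ (1 / 3 : ℝ) = layerScale ν k := by
    rw [layerScale_rpow hν]; norm_num
  have e16 : |k / ν| ^ (1 / 6 : ℝ) = √(layerScale ν k) := by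
    rw [layerScale_rpow hν, Real.sqrt_eq_rpow]; norm_num
  have i13 : |ν / k| ^ (1 / 3 : ℝ) = layerScale ν k ^ (-1 : ℝ) := by
    rw [layerScale_inv_rpow hν hk]; norm_num
  have i16 : |ν / k| ^ (1 / 6 : ℝ) = layerScale ν k ^ (-(1 / 2) : ℝ) := by
    rw [layerScale_inv_rpow hν hk]; norm_num
  have hK : ∀ s : ℝ, 0 ≤ s → (200 * s) ^ s ≤ (200 * |s| + 1) ^ s := fun s hs => by
    rw [abs_of_nonneg hs]
    gcongr
    linarith
  rw [x₁, x₂, eL, e13, e16, i13, i16]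
  refine ⟨?_, ?_, fun α hα => ?_, fun β hβ => ?_, ?_, ?_, fun β hβ => ?_, ?_, ?_⟩
  · refine b₁.normLp_top_le.trans (ENNReal.ofReal_le_ofReal ?_)
    have := edgeRate_le_sup (η := waveNumber k l) (x := 1 - lam) hL0.le
    have h0 := le_edgeRate (L := layerScale ν k) (by linarith : 0 ≤ waveNumber k l) (1 - lam)
    linarith
  · refine b₂.normLp_top_le.trans (ENNReal.ofReal_le_ofReal ?_)
    have := edgeRate_le_sup (η := waveNumber k l) (x := 1 + lam) hL0.le
    have h0 := le_edgeRate (L := layerScale ν k) (by linarith : 0 ≤ waveNumber k l) (1 + lam)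
    linarith
  · refine ENNReal.add_le_ofReal (by positivity) (by positivity) (b₁.normLp_one_weighted_le hα)
      (b₂.normLp_one_weighted_le hα) ?_
    have := mul_le_mul_of_nonneg_right (hK α hα) (Real.rpow_nonneg hL0.le (-α))
    linarith
  · refine ENNReal.add_le_ofReal (by positivity) (by positivity) (b₁.normLp_top_weighted_le hβ)
      (b₂.normLp_top_weighted_le hβ) ?_
    have := mul_le_mul_of_nonneg_right (hK β (by linarith)) (Real.rpow_nonneg hL0.le (1 - β))
    have h0 : 0 ≤ (200 * β) ^ β * layerScale ν k ^ (1 - β) := by positivity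
    linarith
  · refine b₁.normLp_two_le.trans (ENNReal.ofReal_le_ofReal ?_)
    have := sqrt_edgeRate_le (x := 1 - lam) hL0 k l
    have h0 := Real.sqrt_nonneg (edgeRate (waveNumber k l) (layerScale ν k) (1 - lam))
    linarith
  · refine b₂.normLp_two_le.trans (ENNReal.ofReal_le_ofReal ?_)
    have := sqrt_edgeRate_le (x := 1 + lam) hL0 k l
    have h0 := Real.sqrt_nonneg (edgeRate (waveNumber k l) (layerScale ν k) (1 + lam))
    linarith
  · refine ENNReal.add_le_ofReal (by positivity) (by positivity) (b₁.normLp_two_weighted_le hβ)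
      (b₂.normLp_two_weighted_le hβ) ?_
    have := mul_le_mul_of_nonneg_right (hK β (by linarith)) (Real.rpow_nonneg hL0.le (1 / 2 - β))
    have h0 : 0 ≤ (200 * β) ^ β * layerScale ν k ^ (1 / 2 - β) := by positivity
    linarith
  · have h0 : 0 ≤ layerScale ν k ^ (-(1 / 2) : ℝ) := by positivity
    refine ENNReal.add_le_ofReal (by positivity) (by positivity)
      (normLp_gradLength_le b₁ s₁.continuousOn s₁.stream s₁.W_neg_one s₁.W_one)
      (normLp_gradLength_le b₂ s₂.continuousOn s₂.stream s₂.W_neg_one s₂.W_one) ?_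
    linarith
  · have h0 : 0 ≤ layerScale ν k ^ (-1 : ℝ) := by positivity
    refine ENNReal.add_le_ofReal (by positivity) (by positivity)
      (normLp_stream_le b₁ hk s₁.continuousOn s₁.stream s₁.W_neg_one s₁.W_one)
      (normLp_stream_le b₂ hk s₂.continuousOn s₂.stream s₂.W_neg_one s₂.W_one) ?_
    linarith
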